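/- Let $W:\mathbb R\to[0,\infty)$ be continuous with $W(z)=0$ if and only if $z=\pm1$, and with $\liminf_{z\to+\infty}W(z)>0$ and $\liminf_{z\to-\infty}W(z)>0$. For $s\in(0,1)$ and $u:(0,1)\to\mathbb R$ measurable let $$[u]_s^2=\int_0^1\!\!\int_0^1\frac{|u(x)-u(y)|^2}{|x-y|^{1+2s}}\,dx\,dy\in[0,+\infty],$$ so that $H^s(0,1)=\{u\in L^2(0,1):[u]_s<\infty\}$. For $0<\varepsilon<1$ and $s\in(0,1)$ let $$\lambda(\varepsilon,s)=\begin{cases}\dfrac{1-2s}{\varepsilon^{2s-1}-1}&\text{if }s>\frac12,\\[2mm] \dfrac1{|\log\varepsilon|}&\text{if }s=\frac12,\\[2mm] \dfrac{2s-1}{\varepsilon^{(1-2s)/(2s)}-1}&\text{if }s<\frac12.\end{cases}$$ Let $s_\varepsilon\in(0,1)$ for every $\varepsilon>0$, with $s_\varepsilon\to\frac12$ as $\varepsilon\to0^+$ (in any way), and for $u:(0,1)\to\mathbb R$ measurable set $$F_\varepsilon(u)=\frac{\lambda(\varepsilon,s_\varepsilon)}{\varepsilon}\int_0^1W(u)\,dt+\lambda(\varepsilon,s_\varepsilon)\,\varepsilon^{(2s_\varepsilon-1)^+}[u]_{s_\varepsilon}^2\in[0,+\infty].$$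 Let $BV((0,1),\{-1,1\})$ be the set of functions of bounded variation on $(0,1)$ (modulo a.e. equality) with values in $\{-1,1\}$ a.e., let $S(u)$ be the set of the (essential) discontinuity points of $u$ in $(0,1)$, that is, the points at which $u$ has no approximate limit, and let $$F_0(u)=\begin{cases}8\,\#S(u)&\text{if }u\in BV((0,1),\{-1,1\}),\\+\infty&\text{otherwise.}\end{cases}$$ Then: (a) As $\varepsilon\to0^+$ the functionals $F_\varepsilon$ $\Gamma$-converge to $F_0$ with respect to convergence in measure on $(0,1)$. That is, for every sequence $\varepsilon_j\to0^+$ and every measurable $u$: $F_0(u)\le\liminf_jF_{\varepsilon_j}(u_j)$ whenever $u_j\to u$ in measure, and there is a sequence $u_j\to u$ in measure with $\limsup_jF_{\varepsilon_j}(u_j)\le F_0(u)$. (b) If $\varepsilon_j\to0^+$ and $\limsup_jF_{\varepsilon_j}(u_j)<+\infty$, then a subsequence of $(u_j)$ converges in measure to some $u\in BV((0,1),\{-1,1\})$. (c) For every $u\in BV((0,1),\{-1,1\})$ there are functions $u_\varepsilon\in H^{s_\varepsilon}(0,1)$, $\varepsilon>0$, such that $u_\varepsilon\to u$ in $L^2(0,1)$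 and $F_\varepsilon(u_\varepsilon)\to8\,\#S(u)$ as $\varepsilon\to0^+$. -/

import Mathlib

open MeasureTheory Filter Topology Set
open scoped ENNReal

noncomputable section

/-- Lebesgue measure on the interval `(0,1)`. -/
abbrev unitVol : Measure ℝ := volume.restrict (Ioo (0 : ℝ) 1)

/-- The space of (classes modulo a.e. equality of) real measurable functions on `(0,1)`. -/
abbrev MeasFun : Type := ℝ →ₘ[unitVol] ℝ

/-- Double-well potentials with wells at `±1`. The last two fields say that the lower limits of `W`
at `+∞` and at `-∞` (taken in the extended reals) are strictly positive. -/
structure IsDoubleWell (W : ℝ → ℝ) : Prop where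
  continuous : Continuous W
  nonneg : ∀ z, 0 ≤ W z
  eq_zero_iff : ∀ z, W z = 0 ↔ z = 1 ∨ z = -1
  liminf_atTop : ∃ c : ℝ, 0 < c ∧ ∀ᶠ z in atTop, c ≤ W z
  liminf_atBot : ∃ c : ℝ, 0 < c ∧ ∀ᶠ z in atBot, c ≤ W z

/-- The squared Gagliardo seminorm of order `s` on `(0,1)`, with values in `[0,∞]`. -/
def gagliardoSq (s : ℝ) (u : ℝ → ℝ) : ℝ≥0∞ :=
  ∫⁻ x in Ioo (0 : ℝ) 1, ∫⁻ y in Ioo (0 : ℝ) 1,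
    ENNReal.ofReal (|u x - u y| ^ 2 / |x - y| ^ (1 + 2 * s))

/-- The fractional Sobolev space `H^s(0,1)`. -/
def MemHs (s : ℝ) (u : ℝ → ℝ) : Prop :=
  MemLp u 2 unitVol ∧ gagliardoSq s u < ∞

/-- The scaling factor `λ(ε,s)`, meaningful (and positive) for `0 < ε < 1`, `0 < s < 1`. -/
def scalingFactor (ε s : ℝ) : ℝ :=
  if 1 / 2 < s then (1 - 2 * s) / (ε ^ (2 * s - 1) - 1)
  else if s = 1 / 2 then 1 / |Real.log ε|
  else (2 * s - 1) / (ε ^ ((1 - 2 * s) / (2 * s)) - 1)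

/-- The rescaled energy `(λ/ε) ∫ W(u) + λ ε^{(2s-1)^+} [u]_s^2` on `(0,1)`. It is `∞` for every
measurable `u` outside `H^s(0,1)`, since a finite seminorm on `(0,1)` forces `u ∈ L^2(0,1)`. -/
def rescaledEnergy (W : ℝ → ℝ) (ε s : ℝ) (u : ℝ → ℝ) : ℝ≥0∞ :=
  ENNReal.ofReal (scalingFactor ε s / ε) * (∫⁻ x in Ioo (0 : ℝ) 1, ENNReal.ofReal (W (u x)))
    + ENNReal.ofReal (scalingFactor ε s * ε ^ max (2 * s - 1) 0) * gagliardoSq s u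

/-- `u ∈ BV((0,1),{-1,1})`: `u` takes almost everywhere only the values `±1`, and it agrees almost
everywhere with a function of bounded variation on `(0,1)`. -/
def MemBVpm (u : ℝ → ℝ) : Prop :=
  (∀ᵐ x ∂unitVol, u x = 1 ∨ u x = -1) ∧
    ∃ g : ℝ → ℝ, g =ᵐ[unitVol] u ∧ BoundedVariationOn g (Ioo 0 1)

/-- `z` is the approximate limit of `u` at `t`: for every `η > 0` the set `{|u - z| ≥ η}` has
density `0` at `t`. -/
def HasApproxLimit (u : ℝ → ℝ) (t z : ℝ) : Prop :=
  ∀ η : ℝ, 0 < η →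
    Tendsto (fun r : ℝ => volume {x ∈ Ioo (t - r) (t + r) | η ≤ |u x - z|} / ENNReal.ofReal (2 * r))
      (𝓝[>] 0) (𝓝 0)

/-- The set `S(u)` of essential discontinuity (jump) points of `u` in `(0,1)`: the points at which
`u` has no approximate limit. -/
def jumpSet (u : ℝ → ℝ) : Set ℝ :=
  {t ∈ Ioo (0 : ℝ) 1 | ¬ ∃ z : ℝ, HasApproxLimit u t z}

open Classical in
/-- The limit functional: `8 #S(u)` on `BV((0,1),{-1,1})`, and `∞` elsewhere. -/
def limitEnergy (u : ℝ → ℝ) : ℝ≥0∞ :=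
  if MemBVpm u then 8 * ((jumpSet u).encard : ℝ≥0∞) else ∞

/-- Convergence in measure on `(0,1)` of a sequence of measurable functions. -/
def ConvInMeasure (v : ℕ → MeasFun) (u : MeasFun) : Prop :=
  TendstoInMeasure unitVol (fun j => (v j : ℝ → ℝ)) atTop (u : ℝ → ℝ)

/-- `Γ`-convergence, with respect to convergence in measure on `(0,1)`, of a sequence of functionals:
the lower bound for all converging sequences, and the existence of recovery sequences. -/
def GammaConvergesSeq (F : ℕ → MeasFun → ℝ≥0∞) (F₀ : MeasFun → ℝ≥0∞) : Prop :=
  (∀ (u : MeasFun) (v : ℕ → MeasFun), ConvInMeasure v u →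
      F₀ u ≤ liminf (fun j => F j (v j)) atTop) ∧
  (∀ u : MeasFun, ∃ v : ℕ → MeasFun, ConvInMeasure v u ∧
      limsup (fun j => F j (v j)) atTop ≤ F₀ u)

/-- `Γ`-convergence of a family `(F_ε)` as `ε → 0⁺`: `Γ`-convergence along every sequence of
positive parameters tending to `0`. -/
def GammaConverges (F : ℝ → MeasFun → ℝ≥0∞) (F₀ : MeasFun → ℝ≥0∞) : Prop :=
  ∀ ε : ℕ → ℝ, Tendsto ε atTop (𝓝[>] 0) → GammaConvergesSeq (fun j => F (ε j)) F₀

end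

/-! A single transition is responsible for the constant 8. If $u$ jumps between $-1$ and $1$, the
points $x$ for which $x$ and $x+r$ lie on opposite sides have measure about $r$. So the pairs at
distance $r$, taken in both orders, contribute $2\cdot 2^2\cdot r\cdot r^{-1-2s}=8r^{-2s}$ to the
seminorm. Put $L=\lambda\varepsilon^{(2s-1)^+}$ and let $\delta=\varepsilon^{\max(1,1/(2s))}$ be the
width at which potential and nonlocal cost balance. The factor $\lambda$ is exactly the one with
$L\int_\delta^1 r^{-2s}\,dr=1$ in all three regimes (`seminormFactor_mul_integral`). Since
$\lambda\to0$, bounded multiples of $\lambda$ are negligible.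

Lower bound. Markov's inequality confines the intermediate values to a set $Z$ of measure
$z\sim\varepsilon/\lambda$. Follow a chain $x,x+r,\dots,x+nr$ from one phase to the other: it either
meets $Z$ or contains a direct passage of length $r$. Counting chains shows that shifts by $r$ carry
measure at least about $r-z$ from one phase to the other (`le_shiftMeasure`). Integrating over
$z<r<a$ loses only $O(z^{1-2s})$, which $L$ turns into $O(\lambda)$, and the distances between
$\delta$ and $z$ carry a vanishing part of the kernel (`seminormFactor_mul_integral_layer_le`). Each
essential jump thus costs at least 8, and superadditivity over disjoint intervals handles several of
them (`eventually_card_mul_le_localEnergy`). Hence a limit of bounded energy has finitely many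
essential jumps, is a product of steps, and is of bounded variation.

Upper bound. Replacing each step by a ramp of half-width $\delta$ gives energy at most
$8\,\#S(u)+O(\lambda)$ (`exists_rescaledEnergy_recovery_le`); the lower bound then yields
convergence.

Compactness. By averaging over dyadic shells, at some scale $\rho\ge z$ the phase changes under
shifts by $r\sim\rho$ have measure $O(r)$ on average. Subadditivity of the $L^1$ translation modulus
lifts this to every fixed scale $a$ (`lintegral_shiftModulus_le`). The indicators of the upper phase
are therefore $O(a)$-close in $L^1$ to averages at scale $a$, which converge along a subsequence
independent of $a$ (`exists_subseq_cauchy`). The potential then forces the functions towards the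
corresponding wells. -/

noncomputable section

/-! ### Scaling factor, layer width and normalisation of the kernel -/

/-- The factor in front of the seminorm in the rescaled energy. -/
def seminormFactor (ε s : ℝ) : ℝ := scalingFactor ε s * ε ^ max (2 * s - 1) 0

/-- The width of the optimal transition layer. -/
def layerWidth (ε s : ℝ) : ℝ := ε ^ max 1 (1 / (2 * s))

theorem layerWidth_pos {ε s : ℝ} (hε : 0 < ε) : 0 < layerWidth ε s := Real.rpow_pos_of_pos hε _

theorem layerWidth_le {ε s : ℝ} (hε : 0 < ε) (hε1 : ε < 1) : layerWidth ε s ≤ ε := by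
  simpa [layerWidth] using Real.rpow_le_rpow_of_exponent_ge hε hε1.le (le_max_left 1 (1 / (2 * s)))

theorem layerWidth_of_ge {ε s : ℝ} (hs : 1 / 2 ≤ s) : layerWidth ε s = ε := by
  have : 1 / (2 * s) ≤ 1 := by rw [div_le_one (by linarith)]; linarith
  rw [layerWidth, max_eq_left this, Real.rpow_one]

theorem layerWidth_of_le {ε s : ℝ} (hs0 : 0 < s) (hs : s ≤ 1 / 2) :
    layerWidth ε s = ε ^ (1 / (2 * s)) := by
  have : 1 ≤ 1 / (2 * s) := by rw [le_div_iff₀ (by linarith)]; linarith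
  rw [layerWidth, max_eq_right this]

/-- With $x=cT$ these follow from $1-x\le e^{-x}\le1$ and $(1+x)e^{-x}\le1$. They are uniform in
$c$, so the speed at which $s_\varepsilon$ approaches $1/2$ relative to $1/|\log\varepsilon|$ never
matters. -/
theorem div_one_sub_exp_bounds {c T : ℝ} (hc : 0 < c) (hT : 0 < T) :
    1 / T ≤ c / (1 - Real.exp (-(c * T))) ∧ c ≤ c / (1 - Real.exp (-(c * T))) ∧
      c / (1 - Real.exp (-(c * T))) ≤ c + 1 / T := by
  have hx : 0 < c * T := mul_pos hc hT
  have h1 : Real.exp (-(c * T)) < 1 := by rw [Real.exp_lt_one_iff]; linarith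
  have h2 : -(c * T) + 1 ≤ Real.exp (-(c * T)) := Real.add_one_le_exp _
  have h3 : (1 + c * T) * Real.exp (-(c * T)) ≤ 1 := by
    have := Real.add_one_le_exp (c * T)
    calc (1 + c * T) * Real.exp (-(c * T)) ≤ Real.exp (c * T) * Real.exp (-(c * T)) := by
          gcongr; linarith
      _ = 1 := by rw [← Real.exp_add]; simp
  have h4 := Real.exp_pos (-(c * T))
  have hd : 0 < 1 - Real.exp (-(c * T)) := by linarith
  refine ⟨?_, ?_, ?_⟩
  · rw [div_le_div_iff₀ hT hd]; linarith
  · rw [le_div_iff₀ hd]; nlinarith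
  · rw [div_le_iff₀ hd]
    have : c + 1 / T = (1 + c * T) / T := by field_simp; ring
    rw [this, div_mul_eq_mul_div, le_div_iff₀ hT]
    nlinarith

theorem neg_log_layerWidth {ε s : ℝ} (hε : 0 < ε) :
    -Real.log (layerWidth ε s) = -Real.log ε * max 1 (1 / (2 * s)) := by
  rw [layerWidth, Real.log_rpow hε]; ring

/-- In both off-critical branches the power of $\varepsilon$ in $\lambda$ equals $\delta^{|2s-1|}$,
where $\delta$ is the layer width. -/
theorem scalingFactor_eq {ε s : ℝ} (hε : 0 < ε) (hs0 : 0 < s) (hs : s ≠ 1 / 2) :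
    scalingFactor ε s =
      |2 * s - 1| / (1 - Real.exp (-(|2 * s - 1| * -Real.log (layerWidth ε s)))) := by
  unfold scalingFactor
  rcases lt_or_gt_of_ne hs with h | h
  · rw [if_neg (by linarith), if_neg hs, abs_of_neg (by linarith), neg_log_layerWidth hε,
      max_eq_right (by rw [le_div_iff₀ (by linarith)]; linarith), Real.rpow_def_of_pos hε,
      ← neg_div_neg_eq]
    congr 1
    rw [neg_sub]
    congr 2
    field_simp
    ring
  · rw [if_pos h, abs_of_pos (by linarith), layerWidth_of_ge h.le, Real.rpow_def_of_pos hε,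
      ← neg_div_neg_eq]
    congr 1
    · ring
    · rw [neg_sub]; congr 2; ring

theorem neg_log_layerWidth_pos {ε s : ℝ} (hε : 0 < ε) (hε1 : ε < 1) :
    0 < -Real.log (layerWidth ε s) := by
  have := Real.log_neg (layerWidth_pos (s := s) hε) ((layerWidth_le hε hε1).trans_lt hε1)
  linarith

theorem scalingFactor_half {ε : ℝ} (hε : 0 < ε) (hε1 : ε < 1) :
    scalingFactor ε (1 / 2) = 1 / -Real.log ε := by
  rw [scalingFactor, if_neg (lt_irrefl _), if_pos rfl, abs_of_neg (Real.log_neg hε hε1)]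

theorem scalingFactor_bounds {ε s : ℝ} (hε : 0 < ε) (hε1 : ε < 1) (hs0 : 0 < s) :
    1 / -Real.log (layerWidth ε s) ≤ scalingFactor ε s ∧ |2 * s - 1| ≤ scalingFactor ε s ∧
      scalingFactor ε s ≤ |2 * s - 1| + 1 / -Real.log (layerWidth ε s) := by
  have hT := neg_log_layerWidth_pos (s := s) hε hε1
  by_cases hs : s = 1 / 2
  · subst hs
    rw [scalingFactor_half hε hε1, layerWidth_of_ge le_rfl]
    rw [layerWidth_of_ge le_rfl] at hT
    have : 0 ≤ 1 / -Real.log ε := by positivity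
    norm_num at this ⊢
    exact this
  · rw [scalingFactor_eq hε hs0 hs]
    exact div_one_sub_exp_bounds (abs_pos.2 fun h => hs (by linarith)) hT

theorem scalingFactor_pos {ε s : ℝ} (hε : 0 < ε) (hε1 : ε < 1) (hs0 : 0 < s) :
    0 < scalingFactor ε s :=
  (by have := neg_log_layerWidth_pos (s := s) hε hε1; positivity : (0 : ℝ) <
    1 / -Real.log (layerWidth ε s)).trans_le (scalingFactor_bounds hε hε1 hs0).1

theorem seminormFactor_le {ε s : ℝ} (hε : 0 < ε) (hε1 : ε < 1) (hs0 : 0 < s) :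
    seminormFactor ε s ≤ scalingFactor ε s :=
  mul_le_of_le_one_right (scalingFactor_pos hε hε1 hs0).le
    (Real.rpow_le_one hε.le hε1.le (le_max_right _ _))

theorem seminormFactor_pos {ε s : ℝ} (hε : 0 < ε) (hε1 : ε < 1) (hs0 : 0 < s) :
    0 < seminormFactor ε s :=
  mul_pos (scalingFactor_pos hε hε1 hs0) (Real.rpow_pos_of_pos hε _)

theorem seminormFactor_of_ge {ε s : ℝ} (hs : 1 / 2 ≤ s) :
    seminormFactor ε s = scalingFactor ε s * ε ^ (2 * s - 1) := by
  rw [seminormFactor, max_eq_left (by linarith)]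

theorem seminormFactor_of_le {ε s : ℝ} (hs : s ≤ 1 / 2) :
    seminormFactor ε s = scalingFactor ε s := by
  rw [seminormFactor, max_eq_right (by linarith), Real.rpow_zero, mul_one]

theorem notMem_uIcc_of_pos {a b : ℝ} (ha : 0 < a) (hb : 0 < b) : (0 : ℝ) ∉ uIcc a b :=
  fun h => absurd h.1 (not_le.2 (lt_min ha hb))

theorem intervalIntegrable_rpow_of_pos {a b p : ℝ} (ha : 0 < a) (hb : 0 < b) :
    IntervalIntegrable (fun r : ℝ => r ^ p) volume a b :=
  intervalIntegral.intervalIntegrable_rpow (Or.inr (notMem_uIcc_of_pos ha hb))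

/-- The seminorm factor normalises the kernel on the range between the layer width and `1`. -/
theorem seminormFactor_mul_integral {ε s : ℝ} (hε : 0 < ε) (hε1 : ε < 1) (hs0 : 0 < s) :
    seminormFactor ε s * ∫ r in layerWidth ε s..1, r ^ (-(2 * s)) = 1 := by
  have hlog := Real.log_neg hε hε1
  rcases lt_trichotomy s (1 / 2) with h | h | h
  · rw [seminormFactor_of_le h.le, integral_rpow
      (Or.inr ⟨by linarith, notMem_uIcc_of_pos (layerWidth_pos hε) one_pos⟩),
      layerWidth_of_le hs0 h.le, scalingFactor, if_neg (by linarith), if_neg h.ne,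
      ← Real.rpow_mul hε.le, Real.one_rpow]
    have e : 1 / (2 * s) * (-(2 * s) + 1) = (1 - 2 * s) / (2 * s) := by ring
    rw [e]
    have : ε ^ ((1 - 2 * s) / (2 * s)) < 1 :=
      Real.rpow_lt_one hε.le hε1 (by apply div_pos <;> linarith)
    have h1 : ε ^ ((1 - 2 * s) / (2 * s)) - 1 ≠ 0 := by linarith
    have h2 : -(2 * s) + 1 ≠ 0 := by linarith
    field_simp
    ring
  · subst h
    rw [seminormFactor_of_le le_rfl, scalingFactor_half hε hε1, layerWidth_of_ge le_rfl]
    have : ∀ r : ℝ, r ^ (-(2 * (1 / 2 : ℝ))) = r⁻¹ := fun r => by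
      norm_num [Real.rpow_neg_one]
    simp_rw [this]
    rw [integral_inv_of_pos hε one_pos, Real.log_div one_ne_zero hε.ne', Real.log_one]
    have := hlog.ne
    field_simp
    ring
  · rw [seminormFactor_of_ge h.le, integral_rpow
      (Or.inr ⟨by linarith, notMem_uIcc_of_pos (layerWidth_pos hε) one_pos⟩),
      layerWidth_of_ge h.le, scalingFactor, if_pos h, Real.one_rpow]
    have e : -(2 * s) + 1 = -(2 * s - 1) := by ring
    rw [e, Real.rpow_neg hε.le]
    have h0 : 0 < ε ^ (2 * s - 1) := Real.rpow_pos_of_pos hε _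
    have : ε ^ (2 * s - 1) < 1 := Real.rpow_lt_one hε.le hε1 (by linarith)
    have h1 : ε ^ (2 * s - 1) - 1 ≠ 0 := by linarith
    have h2 : (2 * s - 1) ≠ 0 := by linarith
    field_simp
    ring

/-- Distances between the layer width and `C ε / λ` contribute little. -/
theorem seminormFactor_mul_integral_layer_le {ε s C : ℝ} (hε : 0 < ε) (hε1 : ε < 1)
    (hs0 : 1 / 4 ≤ s) (hC : 1 ≤ C) (hl1 : scalingFactor ε s ≤ 1)
    (hz : C * ε / scalingFactor ε s ≤ 1) :
    seminormFactor ε s * ∫ r in layerWidth ε s..(C * ε / scalingFactor ε s), r ^ (-(2 * s)) ≤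
      6 * C * scalingFactor ε s * (1 + Real.log (C / scalingFactor ε s)) := by
  have hs : 0 < s := by linarith
  set l := scalingFactor ε s with hl
  have hlp : 0 < l := scalingFactor_pos hε hε1 hs
  set z := C * ε / l with hzdef
  have hCl : 1 ≤ C / l := by rw [le_div_iff₀ hlp]; linarith
  have hlogCl : 0 ≤ Real.log (C / l) := Real.log_nonneg hCl
  have hεz : ε ≤ z := by
    rw [hzdef, le_div_iff₀ hlp]; nlinarith
  have hzp : 0 < z := hε.trans_le hεz
  have hδp := layerWidth_pos (s := s) hε
  have hδz : layerWidth ε s ≤ z := (layerWidth_le hε hε1).trans hεz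
  have hinv : IntervalIntegrable (fun r : ℝ => r⁻¹) volume (layerWidth ε s) z := by
    simpa [Real.rpow_neg_one] using intervalIntegrable_rpow_of_pos (p := -1) hδp hzp
  -- Since $r^{-2s}=r^{1-2s}r^{-1}$, any bound on the first factor leaves a logarithm.
  have key : ∀ M : ℝ, (∀ r ∈ Icc (layerWidth ε s) z, r ^ (1 - 2 * s) ≤ M) →
      ∫ r in layerWidth ε s..z, r ^ (-(2 * s)) ≤ M * Real.log (z / layerWidth ε s) := by
    intro M hM
    rw [← integral_inv_of_pos hδp hzp, ← intervalIntegral.integral_const_mul]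
    refine intervalIntegral.integral_mono_on hδz (intervalIntegrable_rpow_of_pos hδp hzp)
      (hinv.const_mul M) fun r hr => ?_
    have hr0 : 0 < r := hδp.trans_le hr.1
    have : r ^ (-(2 * s)) = r ^ (1 - 2 * s) * r⁻¹ := by
      rw [← Real.rpow_neg_one, ← Real.rpow_add hr0]; congr 1; ring
    rw [this]
    exact mul_le_mul_of_nonneg_right (hM r hr) (inv_pos.2 hr0).le
  rcases le_total (1 / 2) s with h | h
  -- For $s\ge1/2$ the bound $\varepsilon^{1-2s}$ cancels the weight $\varepsilon^{2s-1}$ in $L$,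
  -- and the logarithm is $\log(z/\varepsilon)=\log(C/\lambda)$.
  · have := key (ε ^ (1 - 2 * s)) (by
      intro r hr
      rw [layerWidth_of_ge h] at hr
      exact Real.rpow_le_rpow_of_nonpos hε hr.1 (by linarith))
    rw [layerWidth_of_ge h] at this ⊢
    have e : z / ε = C / l := by rw [hzdef]; field_simp
    rw [e] at this
    have e2 : ε ^ (2 * s - 1) * ε ^ (1 - 2 * s) = 1 := by
      rw [← Real.rpow_add hε]; simp
    rw [seminormFactor_of_ge h]
    calc l * ε ^ (2 * s - 1) * ∫ r in ε..z, r ^ (-(2 * s))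
        ≤ l * ε ^ (2 * s - 1) * (ε ^ (1 - 2 * s) * Real.log (C / l)) := by gcongr
      _ = l * Real.log (C / l) * (ε ^ (2 * s - 1) * ε ^ (1 - 2 * s)) := by ring
      _ = 1 * l * (0 + Real.log (C / l)) := by rw [e2]; ring
      _ ≤ 6 * C * l * (1 + Real.log (C / l)) := by gcongr <;> linarith
  · have := key (z ^ (1 - 2 * s)) (by
      intro r hr
      exact Real.rpow_le_rpow (hδp.le.trans hr.1) hr.2 (by linarith))
    rw [seminormFactor_of_le h]
    set t := -Real.log ε with ht
    have htp : 0 < t := by have := Real.log_neg hε hε1; linarith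
    set τ := 1 - 2 * s with hτ
    have hτ0 : 0 ≤ τ := by linarith
    have hτl : τ ≤ l := by
      have := (scalingFactor_bounds hε hε1 hs).2.1
      rw [abs_of_nonpos (by linarith)] at this
      linarith
    have e1 : Real.log (z / layerWidth ε s) = Real.log (C / l) + t * τ / (2 * s) := by
      have : z = C / l * ε := by rw [hzdef]; ring
      rw [Real.log_div hzp.ne' hδp.ne', this, Real.log_mul (by positivity) hε.ne',
        layerWidth_of_le hs h, Real.log_rpow hε]
      field_simp
      rw [ht, hτ]
      ring
    have hz1 : z ^ τ ≤ 1 := Real.rpow_le_one hzp.le hz hτ0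
    -- The term $t\tau$ may be unbounded, but $z^\tau$ contains $e^{-t\tau}$, and $xe^{-x}\le1$. The
    -- remaining factor satisfies $\lambda^{-\tau}\le\lambda^{-\lambda}\le e\le3$ because
    -- $\tau\le\lambda\le1$.
    have hz2 : z ^ τ * (t * τ) ≤ C * 3 := by
      have e3 : z ^ τ = C ^ τ * (l⁻¹) ^ τ * Real.exp (-(t * τ)) := by
        have : z = C * l⁻¹ * ε := by rw [hzdef]; field_simp
        rw [this, Real.mul_rpow (by positivity) hε.le, Real.mul_rpow (by positivity) (by positivity),
          Real.rpow_def_of_pos hε]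
        congr 2
        rw [ht]; ring
      have h1 : C ^ τ ≤ C := by
        simpa using Real.rpow_le_rpow_of_exponent_le hC (show τ ≤ 1 by linarith)
      have h2 : (l⁻¹) ^ τ ≤ 3 := by
        have hli : 1 ≤ l⁻¹ := (one_le_inv₀ hlp).2 hl1
        calc (l⁻¹) ^ τ ≤ (l⁻¹) ^ l := Real.rpow_le_rpow_of_exponent_le hli hτl
          _ = Real.exp (Real.log l⁻¹ * l) := Real.rpow_def_of_pos (by positivity) _
          _ ≤ Real.exp 1 := by
              apply Real.exp_le_exp.2
              have : Real.log l⁻¹ ≤ l⁻¹ := (Real.log_le_sub_one_of_pos (by positivity)).trans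
                (by linarith)
              calc Real.log l⁻¹ * l ≤ l⁻¹ * l := by gcongr
                _ = 1 := inv_mul_cancel₀ hlp.ne'
          _ ≤ 3 := Real.exp_one_lt_d9.le.trans (by norm_num)
      have h3 : Real.exp (-(t * τ)) * (t * τ) ≤ 1 := by
        have := Real.add_one_le_exp (t * τ)
        calc Real.exp (-(t * τ)) * (t * τ) ≤ Real.exp (-(t * τ)) * Real.exp (t * τ) := by
              gcongr; linarith
          _ = 1 := by rw [← Real.exp_add]; simp
      rw [e3]
      calc C ^ τ * (l⁻¹) ^ τ * Real.exp (-(t * τ)) * (t * τ)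
          = C ^ τ * (l⁻¹) ^ τ * (Real.exp (-(t * τ)) * (t * τ)) := by ring
        _ ≤ C * 3 * 1 := by gcongr
        _ = C * 3 := by ring
    rw [e1] at this
    calc l * ∫ r in layerWidth ε s..z, r ^ (-(2 * s))
        ≤ l * (z ^ τ * (Real.log (C / l) + t * τ / (2 * s))) := by gcongr
      _ = l * (z ^ τ * Real.log (C / l) + (z ^ τ * (t * τ)) / (2 * s)) := by ring
      _ ≤ l * (1 * Real.log (C / l) + (C * 3) / (2 * (1 / 4))) := by gcongr
      _ = l * (1 * Real.log (C / l) + 6 * C) := by ring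
      _ ≤ l * (6 * C * Real.log (C / l) + 6 * C) := by gcongr; linarith
      _ = 6 * C * l * (1 + Real.log (C / l)) := by ring

theorem eventually_small : ∀ᶠ ε : ℝ in 𝓝[>] 0, 0 < ε ∧ ε < 1 := by
  filter_upwards [Ioo_mem_nhdsGT (show (0 : ℝ) < 1 by norm_num)] with ε h using h

section Family

variable {s : ℝ → ℝ}

theorem eventually_exponent_near (hlim : Tendsto s (𝓝[>] 0) (𝓝 (1 / 2))) :
    ∀ᶠ ε in 𝓝[>] 0, 1 / 4 ≤ s ε ∧ s ε ≤ 3 / 4 := by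
  filter_upwards [hlim (Icc_mem_nhds (show (1 / 4 : ℝ) < 1 / 2 by norm_num)
    (show (1 / 2 : ℝ) < 3 / 4 by norm_num))] with ε h using h

theorem tendsto_neg_log : Tendsto (fun ε : ℝ => -Real.log ε) (𝓝[>] 0) atTop :=
  tendsto_neg_atBot_atTop.comp Real.tendsto_log_nhdsGT_zero

theorem tendsto_scalingFactor (hlim : Tendsto s (𝓝[>] 0) (𝓝 (1 / 2))) :
    Tendsto (fun ε => scalingFactor ε (s ε)) (𝓝[>] 0) (𝓝 0) := by
  have h1 : Tendsto (fun ε => |2 * s ε - 1| + 1 / -Real.log ε) (𝓝[>] 0) (𝓝 0) := by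
    have h2 : Tendsto (fun ε => |2 * s ε - 1|) (𝓝[>] 0) (𝓝 0) := by
      have := ((hlim.const_mul 2).sub_const 1).abs
      norm_num at this
      exact this
    have h3 : Tendsto (fun ε : ℝ => 1 / -Real.log ε) (𝓝[>] 0) (𝓝 0) := by
      simp only [one_div]
      exact tendsto_neg_log.inv_tendsto_atTop
    simpa using h2.add h3
  refine tendsto_of_tendsto_of_tendsto_of_le_of_le' tendsto_const_nhds h1 ?_ ?_
  · filter_upwards [eventually_small, eventually_exponent_near hlim] with ε h hs
    exact (scalingFactor_pos h.1 h.2 (by linarith)).le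
  · filter_upwards [eventually_small, eventually_exponent_near hlim] with ε h hs
    refine (scalingFactor_bounds h.1 h.2 (by linarith)).2.2.trans ?_
    gcongr
    · have := Real.log_neg h.1 h.2; linarith
    · exact layerWidth_pos h.1
    · exact layerWidth_le h.1 h.2

/-- This is the size of the set where the potential tolerates intermediate values. Near the limit
$\lambda\ge1/|\log\delta|\ge1/(2|\log\varepsilon|)$, so
$\varepsilon/\lambda\le2\varepsilon|\log\varepsilon|$. -/
theorem tendsto_div_scalingFactor (hlim : Tendsto s (𝓝[>] 0) (𝓝 (1 / 2))) (C : ℝ) :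
    Tendsto (fun ε => C * ε / scalingFactor ε (s ε)) (𝓝[>] 0) (𝓝 0) := by
  suffices h : Tendsto (fun ε => ε / scalingFactor ε (s ε)) (𝓝[>] 0) (𝓝 0) by
    simpa [mul_div_assoc] using h.const_mul C
  have h1 : Tendsto (fun ε : ℝ => -(2 * (ε * Real.log ε))) (𝓝[>] 0) (𝓝 0) := by
    have := (Real.continuous_mul_log.tendsto 0).mono_left (nhdsWithin_le_nhds (s := Ioi 0))
    simpa using (this.const_mul 2).neg
  refine tendsto_of_tendsto_of_tendsto_of_le_of_le' tendsto_const_nhds h1 ?_ ?_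
  · filter_upwards [eventually_small, eventually_exponent_near hlim] with ε h hs
    exact div_nonneg h.1.le (scalingFactor_pos h.1 h.2 (by linarith)).le
  · filter_upwards [eventually_small, eventually_exponent_near hlim] with ε h hs
    have hs0 : 0 < s ε := by linarith
    have hT := neg_log_layerWidth_pos (s := s ε) h.1 h.2
    have := (scalingFactor_bounds h.1 h.2 hs0).1
    rw [div_le_iff₀ hT] at this
    rw [div_le_iff₀ (scalingFactor_pos h.1 h.2 hs0)]
    have hlog := Real.log_neg h.1 h.2
    have h2 : -Real.log (layerWidth ε (s ε)) ≤ -Real.log ε * 2 := by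
      rw [neg_log_layerWidth h.1]
      gcongr
      · linarith
      · refine max_le (by norm_num) ?_
        rw [div_le_iff₀ (by linarith)]; linarith
    have h3 : 1 ≤ scalingFactor ε (s ε) * (-Real.log ε * 2) :=
      this.trans (mul_le_mul_of_nonneg_left h2 (scalingFactor_pos h.1 h.2 hs0).le)
    nlinarith [h.1]

/-- Distances between `C ε / λ` and `a` carry asymptotically all the mass of the kernel. -/
theorem eventually_seminormFactor_mul_integral_ge (hlim : Tendsto s (𝓝[>] 0) (𝓝 (1 / 2)))
    {C a η : ℝ} (hC : 1 ≤ C) (ha : 0 < a) (hη : 0 < η) :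
    ∀ᶠ ε in 𝓝[>] 0, 1 - η ≤ seminormFactor ε (s ε) *
      ∫ r in (C * ε / scalingFactor ε (s ε))..a, r ^ (-(2 * s ε)) := by
  have hl := tendsto_scalingFactor hlim
  -- Both losses, from the distances below $C\varepsilon/\lambda$ and beyond $a$, are bounded by one
  -- function of $\lambda$, which is continuous and vanishes at $0$ because $l\log l$ does.
  have hcont : Continuous fun l : ℝ => 6 * C * (l + l * Real.log C - l * Real.log l) +
      l * max 1 ((a ^ 2)⁻¹) :=
    (((continuous_id.add (continuous_id.mul continuous_const)).sub
      Real.continuous_mul_log).const_mul _).add (continuous_id.mul continuous_const)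
  have h0 := (hcont.tendsto 0).comp hl
  simp only [zero_mul, add_zero, sub_zero, mul_zero] at h0
  filter_upwards [eventually_small, eventually_exponent_near hlim,
    h0.eventually (gt_mem_nhds hη), hl.eventually (gt_mem_nhds one_pos),
    (tendsto_div_scalingFactor hlim C).eventually (gt_mem_nhds one_pos)] with ε h hs hsmall hl1 hz
  have hs0 : 0 < s ε := by linarith
  have hlp := scalingFactor_pos h.1 h.2 hs0
  have hL := seminormFactor_mul_integral_layer_le h.1 h.2 hs.1 hC hl1.le hz.le
  have hzp : 0 < C * ε / scalingFactor ε (s ε) := by have := h.1; positivity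
  have hone := seminormFactor_mul_integral h.1 h.2 hs0
  have hLp := seminormFactor_pos h.1 h.2 hs0
  set l := scalingFactor ε (s ε)
  set z := C * ε / l
  have hδp := layerWidth_pos (s := s ε) h.1
  have split : (∫ r in layerWidth ε (s ε)..1, r ^ (-(2 * s ε))) =
      (∫ r in layerWidth ε (s ε)..z, r ^ (-(2 * s ε))) + (∫ r in z..a, r ^ (-(2 * s ε))) +
        ∫ r in a..1, r ^ (-(2 * s ε)) := by
    rw [intervalIntegral.integral_add_adjacent_intervals (intervalIntegrable_rpow_of_pos hδp hzp)
      (intervalIntegrable_rpow_of_pos hzp ha),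
      intervalIntegral.integral_add_adjacent_intervals (intervalIntegrable_rpow_of_pos hδp ha)
      (intervalIntegrable_rpow_of_pos ha one_pos)]
  -- The upper limit $a$ may exceed $1$; the oriented integral is then nonpositive.
  have htail : (∫ r in a..1, r ^ (-(2 * s ε))) ≤ max 1 ((a ^ 2)⁻¹) := by
    rcases le_total a 1 with ha1 | ha1
    · calc (∫ r in a..1, r ^ (-(2 * s ε))) ≤ ∫ r in a..1, (a ^ 2)⁻¹ := by
            refine intervalIntegral.integral_mono_on ha1 (intervalIntegrable_rpow_of_pos ha one_pos)
              intervalIntegrable_const fun r hr => ?_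
            calc r ^ (-(2 * s ε)) ≤ a ^ (-(2 * s ε)) :=
                  Real.rpow_le_rpow_of_nonpos ha hr.1 (by linarith)
              _ ≤ a ^ (-2 : ℝ) := Real.rpow_le_rpow_of_exponent_ge ha ha1 (by linarith)
              _ = (a ^ 2)⁻¹ := by rw [Real.rpow_neg ha.le]; norm_num
        _ = (1 - a) * (a ^ 2)⁻¹ := by simp
        _ ≤ 1 * (a ^ 2)⁻¹ := by gcongr; linarith
        _ ≤ max 1 ((a ^ 2)⁻¹) := by rw [one_mul]; exact le_max_right _ _
    · rw [intervalIntegral.integral_symm]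
      have : 0 ≤ ∫ r in (1 : ℝ)..a, r ^ (-(2 * s ε)) :=
        intervalIntegral.integral_nonneg ha1 fun r hr => Real.rpow_nonneg (by linarith [hr.1]) _
      linarith [le_max_left 1 ((a ^ 2)⁻¹)]
  have htail2 : seminormFactor ε (s ε) * (∫ r in a..1, r ^ (-(2 * s ε))) ≤
      l * max 1 ((a ^ 2)⁻¹) :=
    (mul_le_mul_of_nonneg_left htail hLp.le).trans
      (mul_le_mul_of_nonneg_right (seminormFactor_le h.1 h.2 hs0) (by positivity))
  rw [split, mul_add, mul_add] at hone
  rw [Real.log_div (by positivity) hlp.ne'] at hL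
  simp only [Function.comp] at hsmall
  have e : 6 * C * l * (1 + (Real.log C - Real.log l)) =
    6 * C * (l + l * Real.log C - l * Real.log l) := by ring
  rw [e] at hL
  linarith

end Family

/-- This makes the loss $z^{1-2s}/(2s)$ in `le_setInteraction` negligible at
$z=C\varepsilon/\lambda$: use $z\ge\varepsilon$ if $s\ge1/2$ and $z\le1$ if $s\le1/2$. -/
theorem seminormFactor_mul_rpow_le {ε s C : ℝ} (hε : 0 < ε) (hε1 : ε < 1)
    (hs0 : 0 < s) (hC : 1 ≤ C) (hl1 : scalingFactor ε s ≤ 1)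
    (hz : C * ε / scalingFactor ε s ≤ 1) :
    seminormFactor ε s * (C * ε / scalingFactor ε s) ^ (1 - 2 * s) ≤ scalingFactor ε s := by
  have hlp := scalingFactor_pos hε hε1 hs0
  rcases le_total (1 / 2) s with h | h
  · rw [seminormFactor_of_ge h, mul_assoc]
    refine mul_le_of_le_one_right hlp.le ?_
    have hεz : ε ≤ C * ε / scalingFactor ε s := by
      rw [le_div_iff₀ hlp]; nlinarith
    calc ε ^ (2 * s - 1) * (C * ε / scalingFactor ε s) ^ (1 - 2 * s)
        ≤ ε ^ (2 * s - 1) * ε ^ (1 - 2 * s) :=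
          mul_le_mul_of_nonneg_left (Real.rpow_le_rpow_of_nonpos hε hεz (by linarith))
            (Real.rpow_nonneg hε.le _)
      _ = 1 := by rw [← Real.rpow_add hε]; simp
  · rw [seminormFactor_of_le h]
    exact mul_le_of_le_one_right hlp.le
      (Real.rpow_le_one (by positivity) hz (by linarith))

/-- The left side is the nonlocal cost of a layer of width $\delta$, up to a constant. It equals
$\lambda\delta/\varepsilon$, the scale of its potential cost; this balance is what determines
$\delta$. -/
theorem seminormFactor_mul_layerWidth_rpow_le {ε s : ℝ} (hε : 0 < ε) (hε1 : ε < 1)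
    (hs0 : 0 < s) :
    seminormFactor ε s * layerWidth ε s ^ (1 - 2 * s) ≤ scalingFactor ε s := by
  have hlp := scalingFactor_pos hε hε1 hs0
  rcases le_total (1 / 2) s with h | h
  · rw [seminormFactor_of_ge h, mul_assoc, layerWidth_of_ge h, ← Real.rpow_add hε]
    simp
  · rw [seminormFactor_of_le h]
    exact mul_le_of_le_one_right hlp.le
      (Real.rpow_le_one (layerWidth_pos hε).le ((layerWidth_le hε hε1).trans hε1.le) (by linarith))

/-! ### Interaction of sets as an integral over translations -/

/-- The Gagliardo energy of `u` on `I × I`. -/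
def localEnergy (s : ℝ) (u : ℝ → ℝ) (I : Set ℝ) : ℝ≥0∞ :=
  ∫⁻ x in I, ∫⁻ y in I, ENNReal.ofReal (|u x - u y| ^ 2 / |x - y| ^ (1 + 2 * s))

/-- The interaction between two sets through the Gagliardo kernel. -/
def setInteraction (s : ℝ) (A B : Set ℝ) : ℝ≥0∞ :=
  ∫⁻ x in A, ∫⁻ y in B, ENNReal.ofReal (1 / |x - y| ^ (1 + 2 * s))

theorem measurable_kernel (s : ℝ) :
    Measurable fun p : ℝ × ℝ => ENNReal.ofReal (1 / |p.1 - p.2| ^ (1 + 2 * s)) := by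
  fun_prop

theorem setInteraction_comm (s : ℝ) (A B : Set ℝ) :
    setInteraction s A B = setInteraction s B A := by
  unfold setInteraction
  rw [lintegral_lintegral_swap (measurable_kernel s).aemeasurable]
  simp_rw [abs_sub_comm]

/-- Measure of the set of points of `A` that are moved into `B` by the translation by `r`. -/
def shiftMeasure (A B : Set ℝ) (r : ℝ) : ℝ≥0∞ := volume (A ∩ (fun x => x + r) ⁻¹' B)

/-- Substitute $y=x+r$ and apply Tonelli. Lower bounds for the interaction are thereby reduced to
bounds for each single shift $r$. -/
theorem setInteraction_eq (s : ℝ) {A B : Set ℝ} (hA : MeasurableSet A) (hB : MeasurableSet B) :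
    setInteraction s A B =
      ∫⁻ r, ENNReal.ofReal (1 / |r| ^ (1 + 2 * s)) * shiftMeasure A B r := by
  have hmeas : Measurable fun p : ℝ × ℝ =>
      (A ∩ (fun x => x + p.2) ⁻¹' B).indicator (fun _ => ENNReal.ofReal (1 / |p.2| ^ (1 + 2 * s)))
        p.1 := by
    have : MeasurableSet {p : ℝ × ℝ | p.1 ∈ A ∧ p.1 + p.2 ∈ B} :=
      (measurable_fst hA).inter ((measurable_fst.add measurable_snd) hB)
    have h2 : Measurable fun p : ℝ × ℝ => ENNReal.ofReal (1 / |p.2| ^ (1 + 2 * s)) := by fun_prop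
    exact h2.indicator this
  calc setInteraction s A B
      = ∫⁻ x, ∫⁻ r, (A ∩ (fun x => x + r) ⁻¹' B).indicator
          (fun _ => ENNReal.ofReal (1 / |r| ^ (1 + 2 * s))) x := by
        unfold setInteraction
        rw [← lintegral_indicator hA]
        refine lintegral_congr fun x => ?_
        by_cases hx : x ∈ A
        · rw [indicator_of_mem hx, ← lintegral_indicator hB,
            ← lintegral_add_left_eq_self _ x]
          refine lintegral_congr fun r => ?_
          by_cases hr : x + r ∈ B
          · rw [indicator_of_mem hr, indicator_of_mem (by exact ⟨hx, hr⟩)]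
            congr 3
            rw [sub_add_cancel_left, abs_neg]
          · rw [indicator_of_notMem hr, indicator_of_notMem (by exact fun h => hr h.2)]
        · rw [indicator_of_notMem hx]
          symm
          rw [lintegral_eq_zero_of_ae_eq_zero]
          exact ae_of_all _ fun r => indicator_of_notMem (by exact fun h => hx h.1) _
    _ = ∫⁻ r, ∫⁻ x, (A ∩ (fun x => x + r) ⁻¹' B).indicator
          (fun _ => ENNReal.ofReal (1 / |r| ^ (1 + 2 * s))) x :=
        lintegral_lintegral_swap hmeas.aemeasurable
    _ = _ := by
        refine lintegral_congr fun r => ?_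
        rw [lintegral_indicator_const (hA.inter ((measurable_add_const r) hB))]
        rfl

/-- The factor two counts $A\times B$ and $B\times A$; for $d$ close to $2$ the constant is close to
$8$. -/
theorem le_localEnergy (s : ℝ) {u : ℝ → ℝ} {I A B : Set ℝ} {d : ℝ}
    (hA : MeasurableSet A) (hB : MeasurableSet B) (hd : 0 ≤ d)
    (hAI : A ⊆ I) (hBI : B ⊆ I) (hAB : Disjoint A B)
    (hu : ∀ x ∈ A, ∀ y ∈ B, d ≤ |u x - u y|) :
    ENNReal.ofReal (2 * d ^ 2) * setInteraction s A B ≤ localEnergy s u I := by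
  have key : ∀ A B : Set ℝ, MeasurableSet A → MeasurableSet B → B ⊆ I →
      (∀ x ∈ A, ∀ y ∈ B, d ≤ |u x - u y|) →
      ENNReal.ofReal (d ^ 2) * setInteraction s A B ≤
        ∫⁻ x in A, ∫⁻ y in I, ENNReal.ofReal (|u x - u y| ^ 2 / |x - y| ^ (1 + 2 * s)) := by
    intro A B hA hB hBI hu
    unfold setInteraction
    rw [← lintegral_const_mul' _ _ ENNReal.ofReal_ne_top]
    refine setLIntegral_mono' hA fun x hx => ?_
    rw [← lintegral_const_mul' _ _ ENNReal.ofReal_ne_top]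
    refine (setLIntegral_mono' hB fun y hy => ?_).trans (lintegral_mono_set hBI)
    rw [← ENNReal.ofReal_mul (by positivity), mul_one_div]
    have := hu x hx y hy
    gcongr
  calc ENNReal.ofReal (2 * d ^ 2) * setInteraction s A B
      = ENNReal.ofReal (d ^ 2) * setInteraction s A B +
          ENNReal.ofReal (d ^ 2) * setInteraction s B A := by
        rw [setInteraction_comm s B A, ENNReal.ofReal_mul two_pos.le]
        simp only [ENNReal.ofReal_ofNat]
        ring
    _ ≤ _ := add_le_add (key A B hA hB hBI hu)
        (key B A hB hA hAI fun x hx y hy => by rw [abs_sub_comm]; exact hu y hy x hx)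
    _ = ∫⁻ x in A ∪ B, ∫⁻ y in I, ENNReal.ofReal (|u x - u y| ^ 2 / |x - y| ^ (1 + 2 * s)) :=
        (lintegral_union hB hAB).symm
    _ ≤ _ := lintegral_mono_set (union_subset hAI hBI)

/-! ### Chains of translations and the sharp interaction bound -/

theorem volume_inter_Ico_add (S : Set ℝ) {a b c : ℝ} (hab : a ≤ b) (hbc : b ≤ c) :
    volume (S ∩ Ico a b) + volume (S ∩ Ico b c) = volume (S ∩ Ico a c) := by
  have h : ∀ x y, volume (S ∩ Ico x y) = volume.restrict S (Ico x y) := fun x y => by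
    rw [Measure.restrict_apply measurableSet_Ico, inter_comm]
  rw [h, h, h, ← Ico_union_Ico_eq_Ico hab hbc,
    measure_union (Ico_disjoint_Ico_same) measurableSet_Ico]

theorem volume_inter_preimage_add (S : Set ℝ) (c r t : ℝ) :
    volume (Ico c (c + r) ∩ (fun x => x + t) ⁻¹' S) = volume (S ∩ Ico (c + t) (c + t + r)) := by
  rw [← measure_preimage_add_right volume t (S ∩ Ico (c + t) (c + t + r))]
  congr 1
  ext x
  simp only [mem_inter_iff, mem_Ico, mem_preimage]
  constructor
  · rintro ⟨⟨h1, h2⟩, h3⟩; exact ⟨h3, by linarith, by linarith⟩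
  · rintro ⟨h3, h1, h2⟩; exact ⟨⟨by linarith, by linarith⟩, h3⟩

/-- Along the chain `x, x + r, …, x + n r` from `A` to `B` there is either a point outside `A ∪ B`
or a direct passage from `A` to `B`. -/
theorem volume_chain_le {A B Z : Set ℝ} (hAB : Disjoint A B) {c r : ℝ} (hr : 0 < r) (n : ℕ)
    (hcov : Ico c (c + n * r) ⊆ A ∪ B ∪ Z) :
    volume (Ico c (c + r) ∩ (A ∩ (fun x => x + n * r) ⁻¹' B)) ≤
      volume (Z ∩ Ico c (c + n * r)) +
        volume ((A ∩ (fun x => x + r) ⁻¹' B) ∩ Ico c (c + n * r)) := by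
  induction n with
  | zero =>
    have : Ico c (c + r) ∩ (A ∩ (fun x => x + (0 : ℕ) * r) ⁻¹' B) = ∅ := by
      ext x
      simp only [Nat.cast_zero, zero_mul, add_zero, mem_inter_iff, mem_preimage, mem_empty_iff_false,
        iff_false]
      rintro ⟨-, h1, h2⟩
      exact disjoint_left.1 hAB h1 h2
    rw [this, measure_empty]
    exact zero_le
  | succ n ih =>
    have hnr : (0 : ℝ) ≤ n * r := by positivity
    have e : c + ((n + 1 : ℕ) : ℝ) * r = c + n * r + r := by push_cast; ring
    rw [e] at hcov ⊢
    rw [← volume_inter_Ico_add Z (show c ≤ c + n * r by linarith)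
        (show c + n * r ≤ c + n * r + r by linarith),
      ← volume_inter_Ico_add (A ∩ (fun x => x + r) ⁻¹' B) (show c ≤ c + n * r by linarith)
        (show c + n * r ≤ c + n * r + r by linarith)]
    have ih' := ih ((Ico_subset_Ico_right (by linarith)).trans hcov)
    -- Classify the penultimate point $x+nr$: in $A$ the last step is a direct passage, in $B$ the
    -- shorter chain already arrives, and otherwise the point lies in $Z$. Translated by $nr$, the
    -- new contributions sit in the last cell, disjoint from those of the induction hypothesis.
    have hsub : Ico c (c + r) ∩ (A ∩ (fun x => x + (n + 1 : ℕ) * r) ⁻¹' B) ⊆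
        (Ico c (c + r) ∩ (A ∩ (fun x => x + n * r) ⁻¹' B)) ∪
        ((Ico c (c + r) ∩ (fun x => x + n * r) ⁻¹' Z) ∪
         (Ico c (c + r) ∩ (fun x => x + n * r) ⁻¹' (A ∩ (fun x => x + r) ⁻¹' B))) := by
      rintro x ⟨hx, hxA, hxB⟩
      have hx' : x + n * r ∈ A ∪ B ∪ Z := hcov ⟨by linarith [hx.1], by linarith [hx.2]⟩
      have hxB' : x + n * r + r ∈ B := by
        have : x + n * r + r = x + (n + 1 : ℕ) * r := by push_cast; ring
        rw [this]; exact hxB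
      rcases hx' with (h | h) | h
      · exact Or.inr (Or.inr ⟨hx, h, hxB'⟩)
      · exact Or.inl ⟨hx, hxA, h⟩
      · exact Or.inr (Or.inl ⟨hx, h⟩)
    refine (measure_mono hsub).trans ((measure_union_le _ _).trans ?_)
    refine (add_le_add ih' (measure_union_le _ _)).trans (le_of_eq ?_)
    rw [volume_inter_preimage_add, volume_inter_preimage_add]
    ring

theorem ofReal_le_chain {A B Z : Set ℝ} (hAB : Disjoint A B) {c r : ℝ} (hr : 0 < r) (n : ℕ)
    (hcov : Ico c (c + n * r) ⊆ A ∪ B ∪ Z) :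
    ENNReal.ofReal r ≤ volume (Aᶜ ∩ Ico c (c + r)) + volume (Bᶜ ∩ Ico (c + n * r) (c + n * r + r))
      + (shiftMeasure A B r + volume Z) := by
  have h1 : ENNReal.ofReal r = volume (Ico c (c + r)) := by rw [Real.volume_Ico]; congr 1; ring
  have hsub : Ico c (c + r) ⊆ (Aᶜ ∩ Ico c (c + r)) ∪ ((Ico c (c + r) ∩ (fun x => x + n * r) ⁻¹' Bᶜ)
      ∪ (Ico c (c + r) ∩ (A ∩ (fun x => x + n * r) ⁻¹' B))) := by
    intro x hx
    by_cases hA : x ∈ A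
    · by_cases hB : x + n * r ∈ B
      · exact Or.inr (Or.inr ⟨hx, hA, hB⟩)
      · exact Or.inr (Or.inl ⟨hx, hB⟩)
    · exact Or.inl ⟨hA, hx⟩
  rw [h1]
  refine (measure_mono hsub).trans ((measure_union_le _ _).trans ?_)
  rw [add_assoc]
  gcongr
  refine (measure_union_le _ _).trans ?_
  rw [volume_inter_preimage_add]
  gcongr
  refine (volume_chain_le hAB hr n hcov).trans ?_
  rw [add_comm]
  exact add_le_add (measure_mono inter_subset_left) (measure_mono inter_subset_left)

/-- The starting cell slides over $m$ adjacent positions. The defects of $A$ and $B$ add up over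
disjoint cells and so are paid once, whereas each position is charged the full `shiftMeasure` and
the full measure of $Z$. Division by $m$ will spread the defects. -/
theorem ofReal_mul_le_chain {A B Z : Set ℝ} (hAB : Disjoint A B) {p r : ℝ} (hr : 0 < r) (n m : ℕ)
    (hcov : Ico p (p + n * r + m * r) ⊆ A ∪ B ∪ Z) :
    ENNReal.ofReal (m * r) ≤ volume (Aᶜ ∩ Ico p (p + m * r)) +
      volume (Bᶜ ∩ Ico (p + n * r) (p + n * r + m * r))
      + m * (shiftMeasure A B r + volume Z) := by
  induction m with
  | zero => simp
  | succ m ih =>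
    have hmr : (0 : ℝ) ≤ m * r := by positivity
    have hnr : (0 : ℝ) ≤ n * r := by positivity
    have e : ((m + 1 : ℕ) : ℝ) * r = m * r + r := by push_cast; ring
    rw [e] at hcov ⊢
    have ih' := ih ((Ico_subset_Ico_right (by linarith)).trans hcov)
    have h2 := ofReal_le_chain hAB (c := p + m * r) hr n
      ((Ico_subset_Ico (by linarith) (by linarith)).trans hcov)
    rw [ENNReal.ofReal_add hmr hr.le, ← add_assoc, ← add_assoc,
      ← volume_inter_Ico_add Aᶜ (show p ≤ p + m * r by linarith)
        (show p + m * r ≤ p + m * r + r by linarith),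
      ← volume_inter_Ico_add Bᶜ (show p + n * r ≤ p + n * r + m * r by linarith)
        (show p + n * r + m * r ≤ p + n * r + m * r + r by linarith)]
    rw [add_right_comm p (m * r) (n * r)] at h2
    refine (add_le_add ih' h2).trans (le_of_eq ?_)
    push_cast
    ring

/-- If `A` nearly fills an interval of length `ℓ`, and `B` another one to its right, then all short
translations move a large part of `A` into `B`. -/
theorem le_shiftMeasure {A B Z : Set ℝ} (hAB : Disjoint A B) {p q ℓ r κ z : ℝ} (hr : 0 < r)
    (hpq : p + ℓ ≤ q) (hrℓ : r ≤ ℓ / 4) (hz : 0 ≤ z) (hκ : 0 ≤ κ)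
    (hcov : Ico p (q + ℓ) ⊆ A ∪ B ∪ Z)
    (hκ' : volume (Aᶜ ∩ Ico p (p + ℓ)) + volume (Bᶜ ∩ Ico q (q + ℓ)) ≤ ENNReal.ofReal κ)
    (hZ : volume Z ≤ ENNReal.ofReal z) :
    ENNReal.ofReal (r * (1 - 2 * κ / ℓ) - z) ≤ shiftMeasure A B r := by
  by_cases htop : shiftMeasure A B r = ∞
  · rw [htop]; exact le_top
  have hℓ : 0 < ℓ := by linarith
  -- The first choice sends $p$ into $[q,q+r)$. The second keeps $m$ cells within length $\ell-r$,
  -- so that all endpoints stay below $q+\ell$, while $mr\ge\ell-2r\ge\ell/2$.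
  set n := ⌈(q - p) / r⌉₊
  set m := ⌊ℓ / r - 1⌋₊
  have hn1 : q - p ≤ n * r := by rw [← div_le_iff₀ hr]; exact Nat.le_ceil _
  have hn2 : n * r < q - p + r := by
    have := Nat.ceil_lt_add_one (show 0 ≤ (q - p) / r from div_nonneg (by linarith) hr.le)
    calc n * r < ((q - p) / r + 1) * r := by gcongr
      _ = q - p + r := by field_simp
  have hx0 : 0 ≤ ℓ / r - 1 := by
    rw [sub_nonneg, le_div_iff₀ hr]; linarith
  have hm1 : m * r ≤ ℓ - r := by
    calc m * r ≤ (ℓ / r - 1) * r := by gcongr; exact Nat.floor_le hx0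
      _ = ℓ - r := by field_simp
  have hm2 : ℓ / 2 ≤ m * r := by
    have := Nat.lt_floor_add_one (ℓ / r - 1)
    have h2 : (ℓ / r - 1 - 1) * r ≤ m * r := by gcongr; linarith
    have e : (ℓ / r - 1 - 1) * r = ℓ - 2 * r := by field_simp; ring
    linarith
  have h := ofReal_mul_le_chain (Z := Z) hAB (p := p) hr n m
    ((Ico_subset_Ico_right (by linarith)).trans hcov)
  have h' : ENNReal.ofReal (m * r) ≤ ENNReal.ofReal κ +
      m * (ENNReal.ofReal (shiftMeasure A B r).toReal + ENNReal.ofReal z) := by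
    refine h.trans (add_le_add (le_trans (add_le_add (measure_mono ?_) (measure_mono ?_)) hκ') ?_)
    · exact inter_subset_inter_right _ (Ico_subset_Ico_right (by linarith))
    · exact inter_subset_inter_right _ (Ico_subset_Ico (by linarith) (by linarith))
    · rw [ENNReal.ofReal_toReal htop]
      gcongr
  set g := (shiftMeasure A B r).toReal
  have hg : 0 ≤ g := ENNReal.toReal_nonneg
  rw [← ENNReal.ofReal_add hg hz, ← ENNReal.ofReal_natCast m,
    ← ENNReal.ofReal_mul (by positivity), ← ENNReal.ofReal_add hκ (by positivity),
    ENNReal.ofReal_le_ofReal_iff (by positivity)] at h'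
  rw [← ENNReal.ofReal_toReal htop]
  apply ENNReal.ofReal_le_ofReal
  have hmp : (0 : ℝ) < m := by
    by_contra hm
    have : (m : ℝ) = 0 := le_antisymm (not_lt.1 hm) (by positivity)
    rw [this] at hm2
    linarith
  have h3 : κ ≤ m * (2 * κ / ℓ * r) := by
    have : m * (2 * κ / ℓ * r) = (m * r) * (2 * κ / ℓ) := by ring
    rw [this]
    calc κ = ℓ / 2 * (2 * κ / ℓ) := by field_simp
      _ ≤ m * r * (2 * κ / ℓ) := by gcongr
  have h4 : m * r ≤ m * (2 * κ / ℓ * r + (g + z)) := by rw [mul_add]; linarith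
  have h5 := le_of_mul_le_mul_left h4 hmp
  have : r * (1 - 2 * κ / ℓ) = r - 2 * κ / ℓ * r := by ring
  rw [this]
  linarith

theorem ofReal_integral_le_lintegral {α : Type*} [MeasurableSpace α] {μ : Measure α} {f : α → ℝ}
    (hf : Integrable f μ) : ENNReal.ofReal (∫ x, f x ∂μ) ≤ ∫⁻ x, ENNReal.ofReal (f x) ∂μ := by
  calc ENNReal.ofReal (∫ x, f x ∂μ) ≤ ENNReal.ofReal (∫ x, max (f x) 0 ∂μ) :=
        ENNReal.ofReal_le_ofReal (integral_mono hf hf.pos_part fun x => le_max_left _ _)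
    _ = ∫⁻ x, ENNReal.ofReal (max (f x) 0) ∂μ :=
        ofReal_integral_eq_lintegral_ofReal hf.pos_part (ae_of_all _ fun x => le_max_right _ _)
    _ = _ := by simp [ENNReal.ofReal_max]

/-- The total loss due to an intermediate set of measure $z$ when only shifts larger than $z$ are
kept. -/
theorem mul_integral_kernel_le {s z a : ℝ} (hs : 0 < s) (hz : 0 < z) (ha : 0 < a) :
    z * ∫ r in z..a, r ^ (-(1 + 2 * s)) ≤ z ^ (1 - 2 * s) / (2 * s) := by
  rw [integral_rpow (Or.inr ⟨by linarith, notMem_uIcc_of_pos hz ha⟩)]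
  have e : -(1 + 2 * s) + 1 = -(2 * s) := by ring
  have e2 : z ^ (1 - 2 * s) = z * z ^ (-(2 * s)) := by
    rw [sub_eq_add_neg, Real.rpow_add hz, Real.rpow_one]
  rw [e, e2, div_neg, ← neg_div, mul_div_assoc]
  gcongr
  have := Real.rpow_nonneg ha.le (-(2 * s))
  linarith

/-- Sharp lower bound for the interaction between two sets that nearly fill two intervals. -/
theorem le_setInteraction {A B Z : Set ℝ} (hA : MeasurableSet A) (hB : MeasurableSet B)
    (hAB : Disjoint A B) {s p q ℓ κ z a : ℝ} (hs : 0 < s) (hpq : p + ℓ ≤ q) (ha : a ≤ ℓ / 4)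
    (hz : 0 < z) (hza : z ≤ a) (hκ : 0 ≤ κ)
    (hcov : Ico p (q + ℓ) ⊆ A ∪ B ∪ Z)
    (hκ' : volume (Aᶜ ∩ Ico p (p + ℓ)) + volume (Bᶜ ∩ Ico q (q + ℓ)) ≤ ENNReal.ofReal κ)
    (hZ : volume Z ≤ ENNReal.ofReal z) :
    ENNReal.ofReal ((1 - 2 * κ / ℓ) * (∫ r in z..a, r ^ (-(2 * s))) - z ^ (1 - 2 * s) / (2 * s)) ≤
      setInteraction s A B := by
  have hap : 0 < a := hz.trans_le hza
  have i1 := intervalIntegrable_rpow_of_pos (p := -(2 * s)) hz hap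
  have i2 := intervalIntegrable_rpow_of_pos (p := -(1 + 2 * s)) hz hap
  have i3 : IntervalIntegrable (fun r : ℝ => (1 - 2 * κ / ℓ) * r ^ (-(2 * s)) -
      z * r ^ (-(1 + 2 * s))) volume z a := (i1.const_mul _).sub (i2.const_mul _)
  calc ENNReal.ofReal ((1 - 2 * κ / ℓ) * (∫ r in z..a, r ^ (-(2 * s))) - z ^ (1 - 2 * s) / (2 * s))
      ≤ ENNReal.ofReal (∫ r in z..a, ((1 - 2 * κ / ℓ) * r ^ (-(2 * s)) -
          z * r ^ (-(1 + 2 * s)))) := by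
        apply ENNReal.ofReal_le_ofReal
        rw [intervalIntegral.integral_sub (i1.const_mul _) (i2.const_mul _),
          intervalIntegral.integral_const_mul, intervalIntegral.integral_const_mul]
        have := mul_integral_kernel_le hs hz hap
        linarith
    _ ≤ ∫⁻ r in Ioc z a, ENNReal.ofReal ((1 - 2 * κ / ℓ) * r ^ (-(2 * s)) -
          z * r ^ (-(1 + 2 * s))) := by
        rw [intervalIntegral.integral_of_le hza]
        exact ofReal_integral_le_lintegral
          ((intervalIntegrable_iff_integrableOn_Ioc_of_le hza).1 i3)
    _ ≤ ∫⁻ r in Ioc z a, ENNReal.ofReal (1 / |r| ^ (1 + 2 * s)) * shiftMeasure A B r := by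
        refine setLIntegral_mono' measurableSet_Ioc fun r hr => ?_
        have hr0 : 0 < r := hz.trans hr.1
        have e : (1 - 2 * κ / ℓ) * r ^ (-(2 * s)) - z * r ^ (-(1 + 2 * s)) =
            1 / |r| ^ (1 + 2 * s) * (r * (1 - 2 * κ / ℓ) - z) := by
          have : r ^ (-(2 * s)) = r * r ^ (-(1 + 2 * s)) := by
            have := Real.rpow_add hr0 1 (-(1 + 2 * s))
            rw [Real.rpow_one] at this
            rw [← this]; congr 1; ring
          rw [this, abs_of_pos hr0, one_div, ← Real.rpow_neg hr0.le]
          ring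
        rw [e, ENNReal.ofReal_mul (by positivity)]
        gcongr
        exact le_shiftMeasure hAB hr0 hpq (hr.2.trans ha) hz.le hκ hcov hκ' hZ
    _ ≤ _ := by
        rw [setInteraction_eq s hA hB]
        exact setLIntegral_le_lintegral _ _

/-! ### Essential jumps and the sharp local lower bound -/

theorem unitVol_apply_eq {S : Set ℝ} : unitVol S = volume (S ∩ Ioo 0 1) := by
  rw [Measure.restrict_apply' measurableSet_Ioo]

/-- Both values `1` and `-1` are taken on sets of positive measure in `I`. -/
def Alternates (u : ℝ → ℝ) (I : Set ℝ) : Prop :=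
  0 < volume (I ∩ {x | u x = 1}) ∧ 0 < volume (I ∩ {x | u x = -1})

theorem Alternates.mono {u : ℝ → ℝ} {I J : Set ℝ} (h : Alternates u I) (hIJ : I ⊆ J) :
    Alternates u J :=
  ⟨h.1.trans_le (measure_mono (inter_subset_inter_left _ hIJ)),
    h.2.trans_le (measure_mono (inter_subset_inter_left _ hIJ))⟩

/-- The points near which `u` takes both values `1` and `-1`. -/
def essJumps (u : ℝ → ℝ) : Set ℝ :=
  {t ∈ Ioo (0 : ℝ) 1 | ∀ h : ℝ, 0 < h → Alternates u (Ioo (t - h) (t + h) ∩ Ioo 0 1)}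

theorem alternates_of_mem_essJumps {u : ℝ → ℝ} {t a b : ℝ} (ht : t ∈ essJumps u)
    (hab : t ∈ Ioo a b) : Alternates u (Ioo a b) := by
  have hh : 0 < min (t - a) (b - t) := lt_min (by linarith [hab.1]) (by linarith [hab.2])
  refine (ht.2 _ hh).mono (inter_subset_left.trans (Ioo_subset_Ioo ?_ ?_))
  · linarith [min_le_left (t - a) (b - t)]
  · linarith [min_le_right (t - a) (b - t)]

/-- Lebesgue's density theorem provides intervals almost filled by one phase, without any regularity
of the limit function. -/
theorem exists_density_point {S I : Set ℝ} (hS : MeasurableSet S) (hI : 0 < volume (I ∩ S)) :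
    ∃ x ∈ I ∩ S, ∀ κ : ℝ, 0 < κ → ∀ᶠ r in 𝓝[>] (0 : ℝ),
      volume (Sᶜ ∩ Ico (x - r) (x + r)) ≤ ENNReal.ofReal (κ * (2 * r)) := by
  have h := Besicovitch.ae_tendsto_measure_inter_div_of_measurableSet (volume : Measure ℝ) hS
  have hne : ∃ x ∈ I ∩ S, Tendsto (fun r => volume (S ∩ Metric.closedBall x r) /
      volume (Metric.closedBall x r)) (𝓝[>] 0) (𝓝 (S.indicator 1 x)) := by
    by_contra hcon
    push Not at hcon
    have : volume (I ∩ S) = 0 := measure_mono_null (fun x hx => hcon x hx) (ae_iff.1 h)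
    exact hI.ne' this
  obtain ⟨x, hx, hlim⟩ := hne
  refine ⟨x, hx, fun κ hκ => ?_⟩
  rw [indicator_of_mem hx.2, Pi.one_apply] at hlim
  have h1 : (1 : ℝ≥0∞) - ENNReal.ofReal κ < 1 :=
    ENNReal.sub_lt_self ENNReal.one_ne_top one_ne_zero (by simpa using hκ)
  filter_upwards [hlim.eventually (lt_mem_nhds h1), self_mem_nhdsWithin] with r hr hr0
  have hr0' : 0 < r := hr0
  rw [Real.volume_closedBall] at hr
  have hb0 : ENNReal.ofReal (2 * r) ≠ 0 := by simpa using hr0'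
  have hr2 := (ENNReal.lt_div_iff_mul_lt (Or.inl hb0) (Or.inl ENNReal.ofReal_ne_top)).1 hr
  have hsum : volume (Metric.closedBall x r ∩ S) + volume (Metric.closedBall x r \ S) =
      ENNReal.ofReal (2 * r) := by
    rw [measure_inter_add_sdiff _ hS, Real.volume_closedBall]
  have hle : volume (Sᶜ ∩ Ico (x - r) (x + r)) ≤ volume (Metric.closedBall x r \ S) := by
    apply measure_mono
    rintro y ⟨hy, hy1, hy2⟩
    refine ⟨?_, hy⟩
    rw [Real.closedBall_eq_Icc]
    exact ⟨hy1, hy2.le⟩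
  refine hle.trans ?_
  rw [inter_comm] at hsum
  have hfin : volume (S ∩ Metric.closedBall x r) ≠ ∞ :=
    ((measure_mono inter_subset_right).trans_lt (by
      rw [Real.volume_closedBall]; exact ENNReal.ofReal_lt_top)).ne
  have e : volume (Metric.closedBall x r \ S) =
      ENNReal.ofReal (2 * r) - volume (S ∩ Metric.closedBall x r) := by
    rw [← hsum, ENNReal.add_sub_cancel_left hfin]
  rw [e, tsub_le_iff_right]
  calc ENNReal.ofReal (2 * r) = 1 * ENNReal.ofReal (2 * r) := (one_mul _).symm
    _ ≤ (ENNReal.ofReal κ + (1 - ENNReal.ofReal κ)) * ENNReal.ofReal (2 * r) := by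
        gcongr; exact le_add_tsub
    _ ≤ _ := by
        rw [add_mul, ← ENNReal.ofReal_mul hκ.le]
        gcongr

section Sequences

variable {W : ℝ → ℝ} {s : ℝ → ℝ} {ε : ℕ → ℝ} {v : ℕ → ℝ → ℝ} {u : ℝ → ℝ} {C : ℝ}

theorem lintegral_potential_le {e σ : ℝ} {f : ℝ → ℝ} (he : 0 < e) (he1 : e < 1) (hσ : 0 < σ)
    (hF : rescaledEnergy W e σ f ≤ ENNReal.ofReal C) :
    ∫⁻ x in Ioo (0 : ℝ) 1, ENNReal.ofReal (W (f x)) ≤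
      ENNReal.ofReal (C * e / scalingFactor e σ) := by
  have hl := scalingFactor_pos he he1 hσ
  have h := le_self_add.trans hF
  have hq : 0 < scalingFactor e σ / e := by positivity
  calc ∫⁻ x in Ioo (0 : ℝ) 1, ENNReal.ofReal (W (f x))
      = ENNReal.ofReal (e / scalingFactor e σ) * (ENNReal.ofReal (scalingFactor e σ / e) *
          ∫⁻ x in Ioo (0 : ℝ) 1, ENNReal.ofReal (W (f x))) := by
        rw [← mul_assoc, ← ENNReal.ofReal_mul (by positivity)]
        have : e / scalingFactor e σ * (scalingFactor e σ / e) = 1 := by field_simp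
        rw [this, ENNReal.ofReal_one, one_mul]
    _ ≤ ENNReal.ofReal (e / scalingFactor e σ) * ENNReal.ofReal C := by gcongr
    _ = _ := by
        rw [← ENNReal.ofReal_mul (by positivity)]
        congr 1
        ring

/-- Markov's inequality applied to the potential term; the length scale $\varepsilon/\lambda$
originates here. -/
theorem volume_potential_ge_le (hW : Continuous W) {e σ c : ℝ} {f : ℝ → ℝ} (hf : Measurable f)
    (he : 0 < e) (he1 : e < 1) (hσ : 0 < σ) (hc : 0 < c)
    (hF : rescaledEnergy W e σ f ≤ ENNReal.ofReal C) :
    unitVol {x | c ≤ W (f x)} ≤ ENNReal.ofReal (C / c * e / scalingFactor e σ) := by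
  have h := mul_meas_ge_le_lintegral (μ := unitVol) (f := fun x => ENNReal.ofReal (W (f x)))
    (by fun_prop) (ENNReal.ofReal c)
  have h2 := h.trans (lintegral_potential_le he he1 hσ hF)
  have e1 : {x | ENNReal.ofReal c ≤ ENNReal.ofReal (W (f x))} = {x | c ≤ W (f x)} := by
    ext x
    simp only [mem_ofPred_eq]
    rw [ENNReal.ofReal_le_ofReal_iff', or_iff_left (not_le.2 hc)]
  rw [e1] at h2
  calc unitVol {x | c ≤ W (f x)}
      = ENNReal.ofReal c⁻¹ * (ENNReal.ofReal c * unitVol {x | c ≤ W (f x)}) := by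
        rw [← mul_assoc, ← ENNReal.ofReal_mul (by positivity), inv_mul_cancel₀ hc.ne',
          ENNReal.ofReal_one, one_mul]
    _ ≤ ENNReal.ofReal c⁻¹ * ENNReal.ofReal (C * e / scalingFactor e σ) := by gcongr
    _ = _ := by
        rw [← ENNReal.ofReal_mul (by positivity)]
        congr 1
        field_simp

theorem seminormFactor_mul_localEnergy_le {e σ : ℝ} {f : ℝ → ℝ} {I : Set ℝ}
    (hI : I ⊆ Ioo 0 1) :
    ENNReal.ofReal (seminormFactor e σ) * localEnergy σ f I ≤ rescaledEnergy W e σ f := by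
  refine le_trans ?_ le_add_self
  unfold seminormFactor localEnergy gagliardoSq
  gcongr

theorem eventually_scale (hs : ∀ ε : ℝ, 0 < ε → s ε ∈ Ioo (0 : ℝ) 1)
    (hε : Tendsto ε atTop (𝓝[>] 0)) :
    ∀ᶠ j in atTop, 0 < ε j ∧ ε j < 1 ∧ 0 < s (ε j) := by
  filter_upwards [hε.eventually eventually_small] with j h using ⟨h.1, h.2, (hs _ h.1).1⟩

/-- Fatou's lemma along an a.e. convergent subsequence, since the potential integral is at most
$C\varepsilon/\lambda\to0$. -/
theorem ae_eq_one_or_of_bounded_energy (hW : IsDoubleWell W)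
    (hs : ∀ ε : ℝ, 0 < ε → s ε ∈ Ioo (0 : ℝ) 1) (hlim : Tendsto s (𝓝[>] 0) (𝓝 (1 / 2)))
    (hε : Tendsto ε atTop (𝓝[>] 0)) (hv : ∀ j, Measurable (v j))
    (hconv : TendstoInMeasure unitVol v atTop u) (hu : Measurable u)
    (hF : ∀ j, rescaledEnergy W (ε j) (s (ε j)) (v j) ≤ ENNReal.ofReal C) :
    ∀ᵐ x ∂unitVol, u x = 1 ∨ u x = -1 := by
  obtain ⟨φ, hφ, hae⟩ := hconv.exists_seq_tendsto_ae
  have hWc := hW.continuous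
  have hzero : ∫⁻ x, ENNReal.ofReal (W (u x)) ∂unitVol = 0 := by
    have h1 : ∫⁻ x, ENNReal.ofReal (W (u x)) ∂unitVol ≤
        ∫⁻ x, liminf (fun j => ENNReal.ofReal (W (v (φ j) x))) atTop ∂unitVol := by
      refine lintegral_mono_ae (hae.mono fun x hx => ?_)
      have : Tendsto (fun j => ENNReal.ofReal (W (v (φ j) x))) atTop
          (𝓝 (ENNReal.ofReal (W (u x)))) :=
        ENNReal.tendsto_ofReal ((hWc.tendsto _).comp hx)
      rw [this.liminf_eq]
    have h2 := lintegral_liminf_le (μ := unitVol) (u := atTop)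
      (f := fun j x => ENNReal.ofReal (W (v (φ j) x)))
      (fun j => by have := hv (φ j); fun_prop)
    have h3 : Tendsto (fun j => ∫⁻ x, ENNReal.ofReal (W (v (φ j) x)) ∂unitVol) atTop (𝓝 0) := by
      have h4 : Tendsto (fun j => ENNReal.ofReal (C * ε j / scalingFactor (ε j) (s (ε j)))) atTop
          (𝓝 0) := by
        have := ENNReal.tendsto_ofReal ((tendsto_div_scalingFactor hlim C).comp hε)
        simpa using this
      refine tendsto_of_tendsto_of_tendsto_of_le_of_le' tendsto_const_nhds
        (h4.comp hφ.tendsto_atTop) (Eventually.of_forall fun _ => zero_le) ?_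
      filter_upwards [hφ.tendsto_atTop.eventually (eventually_scale hs hε)] with j hj
      exact lintegral_potential_le hj.1 hj.2.1 hj.2.2 (hF (φ j))
    have h5 := h3.liminf_eq
    rw [h5] at h2
    exact le_antisymm (h1.trans h2) zero_le
  rw [lintegral_eq_zero_iff (by fun_prop)] at hzero
  filter_upwards [hzero] with x hx
  rw [← hW.eq_zero_iff]
  exact le_antisymm (by simpa using hx) (hW.nonneg _)

theorem exists_pos_le_potential (hW : IsDoubleWell W) {η : ℝ} (hη : 0 < η) (hη1 : η < 1) :
    ∃ c > 0, ∀ z, |z| ≤ 1 - η → c ≤ W z := by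
  obtain ⟨z₀, hz₀, hmin⟩ := (isCompact_Icc (a := -(1 - η)) (b := 1 - η)).exists_isMinOn
    ⟨0, by constructor <;> linarith⟩ hW.continuous.continuousOn
  refine ⟨W z₀, lt_of_le_of_ne (hW.nonneg _) fun h => ?_, fun z hz => hmin (abs_le.1 hz)⟩
  rcases (hW.eq_zero_iff z₀).1 h.symm with h | h
  · rw [h] at hz₀; linarith [hz₀.2]
  · rw [h] at hz₀; linarith [hz₀.1]

/-- The sign $\tau$ records which well is on the left. The sets where $\tau v_j$ exceeds $1-\eta$ or
lies below $-(1-\eta)$ differ in value by at least $d=2(1-\eta)$, whence the prefactor $2d^2$. The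
factor $1-8\eta$ comes from the defects, $1-\eta$ from the kernel mass and $-\eta$ from the
intermediate set. -/
theorem eventually_le_localEnergy_of_intervals (hW : IsDoubleWell W)
    (hs : ∀ ε : ℝ, 0 < ε → s ε ∈ Ioo (0 : ℝ) 1) (hlim : Tendsto s (𝓝[>] 0) (𝓝 (1 / 2)))
    (hε : Tendsto ε atTop (𝓝[>] 0)) (hv : ∀ j, Measurable (v j))
    (hconv : TendstoInMeasure unitVol v atTop u)
    (hF : ∀ j, rescaledEnergy W (ε j) (s (ε j)) (v j) ≤ ENNReal.ofReal C)
    {a b p q ℓ η τ : ℝ} (hη : 0 < η) (hη8 : η < 1 / 8) (hτ : τ = 1 ∨ τ = -1) (hℓ : 0 < ℓ)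
    (hpq : p + ℓ ≤ q) (hI : Ico p (q + ℓ) ⊆ Ioo a b) (hab : Ioo a b ⊆ Ioo 0 1)
    (hp : volume ({x | u x = τ}ᶜ ∩ Ico p (p + ℓ)) ≤ ENNReal.ofReal (η * ℓ))
    (hq : volume ({x | u x = -τ}ᶜ ∩ Ico q (q + ℓ)) ≤ ENNReal.ofReal (η * ℓ)) :
    ∀ᶠ j in atTop, ENNReal.ofReal (8 * (1 - η) ^ 2 * ((1 - 8 * η) * (1 - η) - η)) ≤
      ENNReal.ofReal (seminormFactor (ε j) (s (ε j))) * localEnergy (s (ε j)) (v j) (Ioo a b) := by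
  obtain ⟨c, hc, hcW⟩ := exists_pos_le_potential hW hη (by linarith)
  set K := max 1 (C / c)
  have hK : 1 ≤ K := le_max_left _ _
  have hℓ4 : 0 < ℓ / 4 := by linarith
  have hmeas : ∀ᶠ j in atTop, unitVol {x | η ≤ dist (v j x) (u x)} ≤ ENNReal.ofReal (η * ℓ) :=
    ((tendstoInMeasure_iff_dist.1 hconv η hη).eventually
      (gt_mem_nhds (show (0 : ℝ≥0∞) < ENNReal.ofReal (η * ℓ) by
        rw [ENNReal.ofReal_pos]; positivity))).mono fun j h => h.le
  filter_upwards [hmeas, eventually_scale hs hε,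
    hε.eventually (eventually_exponent_near hlim),
    hε.eventually (eventually_seminormFactor_mul_integral_ge hlim hK hℓ4 hη),
    ((tendsto_scalingFactor hlim).comp hε).eventually (gt_mem_nhds (show 0 < η / 2 by linarith)),
    ((tendsto_div_scalingFactor hlim K).comp hε).eventually (gt_mem_nhds hℓ4),
    ((tendsto_div_scalingFactor hlim K).comp hε).eventually (gt_mem_nhds one_pos)]
    with j hj hscale hsj hint hl hz hz1
  obtain ⟨he, he1, hs0⟩ := hscale
  simp only [Function.comp] at hl hz hz1
  have hlp := scalingFactor_pos he he1 hs0
  have hrp := seminormFactor_mul_rpow_le he he1 hs0 hK (by linarith) hz1.le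
  have hLp := seminormFactor_pos he he1 hs0
  have hvol := volume_potential_ge_le hW.continuous (hv j) he he1 hs0 hc (hF j)
  set L := seminormFactor (ε j) (s (ε j))
  set l := scalingFactor (ε j) (s (ε j))
  set z := K * ε j / l
  have hzp : 0 < z := by positivity
  have hvj := hv j
  have hτ2 : τ * τ = 1 := by rcases hτ with h | h <;> rw [h] <;> norm_num
  have hτabs : |τ| = 1 := by rcases hτ with h | h <;> rw [h] <;> norm_num
  set A := Ioo a b ∩ {x | 1 - η < τ * v j x} with hA
  set B := Ioo a b ∩ {x | τ * v j x < -(1 - η)} with hB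
  set Z := Ioo (0 : ℝ) 1 ∩ {x | |v j x| ≤ 1 - η} with hZ
  have hAm : MeasurableSet A :=
    measurableSet_Ioo.inter (measurableSet_lt measurable_const (by fun_prop))
  have hBm : MeasurableSet B :=
    measurableSet_Ioo.inter (measurableSet_lt (by fun_prop) measurable_const)
  have hdisj : Disjoint A B := by
    refine disjoint_left.2 fun x hx hx' => ?_
    have h1 := hx.2
    have h2 := hx'.2
    simp only [mem_ofPred_eq] at h1 h2
    linarith
  have hcov : Ico p (q + ℓ) ⊆ A ∪ B ∪ Z := by
    intro x hx
    have hx' := hI hx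
    by_cases h1 : 1 - η < τ * v j x
    · exact Or.inl (Or.inl ⟨hx', h1⟩)
    by_cases h2 : τ * v j x < -(1 - η)
    · exact Or.inl (Or.inr ⟨hx', h2⟩)
    refine Or.inr ⟨hab hx', ?_⟩
    have : |τ * v j x| ≤ 1 - η := abs_le.2 ⟨not_lt.1 h2, not_lt.1 h1⟩
    rwa [abs_mul, hτabs, one_mul] at this
  have hZv : volume Z ≤ ENNReal.ofReal z := by
    calc volume Z ≤ unitVol {x | c ≤ W (v j x)} := by
          rw [unitVol_apply_eq, inter_comm]
          exact measure_mono (inter_subset_inter_right _ fun x hx => hcW _ hx)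
      _ ≤ _ := hvol
      _ ≤ _ := by
          apply ENNReal.ofReal_le_ofReal
          have : C / c ≤ K := le_max_right 1 (C / c)
          change C / c * ε j / l ≤ K * ε j / l
          gcongr
  have hnear : ∀ ρ : ℝ, (ρ = 1 ∨ ρ = -1) → ∀ x, u x = ρ → dist (v j x) (u x) < η →
      1 - η < ρ * v j x := by
    intro ρ hρ x hx hd
    rw [hx, Real.dist_eq, abs_lt] at hd
    rcases hρ with h | h <;> rw [h] at hd ⊢ <;> linarith [hd.1, hd.2]
  have hbad : ∀ (S : Set ℝ) (ρ y : ℝ), Ico y (y + ℓ) ⊆ Ioo a b →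
      volume ({x | u x = ρ}ᶜ ∩ Ico y (y + ℓ)) ≤ ENNReal.ofReal (η * ℓ) →
      (∀ x ∈ Ioo a b, u x = ρ → dist (v j x) (u x) < η → x ∈ S) →
      volume (Sᶜ ∩ Ico y (y + ℓ)) ≤ ENNReal.ofReal (2 * (η * ℓ)) := by
    intro S ρ y hy hvol hS
    have hsub : Sᶜ ∩ Ico y (y + ℓ) ⊆ ({x | u x = ρ}ᶜ ∩ Ico y (y + ℓ)) ∪
        ({x | η ≤ dist (v j x) (u x)} ∩ Ioo 0 1) := by
      rintro x ⟨hx, hxI⟩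
      by_cases h1 : u x = ρ
      · refine Or.inr ⟨?_, hab (hy hxI)⟩
        by_contra h2
        exact hx (hS x (hy hxI) h1 (not_le.1 h2))
      · exact Or.inl ⟨h1, hxI⟩
    refine (measure_mono hsub).trans ((measure_union_le _ _).trans ?_)
    rw [unitVol_apply_eq] at hj
    refine (add_le_add hvol hj).trans (le_of_eq ?_)
    rw [← ENNReal.ofReal_add (by positivity) (by positivity)]
    congr 1
    ring
  -- On each of the two intervals, $\eta\ell$ is lost where $u$ has the wrong value and $\eta\ell$
  -- where $v_j$ is far from $u$.
  have hκ : volume (Aᶜ ∩ Ico p (p + ℓ)) + volume (Bᶜ ∩ Ico q (q + ℓ)) ≤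
      ENNReal.ofReal (4 * η * ℓ) := by
    have h1 := hbad A τ p ((Ico_subset_Ico_right (by linarith)).trans hI) hp
      fun x hx h1 h2 => ⟨hx, hnear τ hτ x h1 h2⟩
    have h2 := hbad B (-τ) q ((Ico_subset_Ico_left (by linarith)).trans hI) hq
      fun x hx h1 h2 => ⟨hx, by
        have := hnear (-τ) (by rcases hτ with h | h <;> simp [h]) x h1 h2
        simp only [mem_ofPred_eq]
        linarith⟩
    refine (add_le_add h1 h2).trans (le_of_eq ?_)
    rw [← ENNReal.ofReal_add (by positivity) (by positivity)]
    congr 1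
    ring
  have hlow := le_setInteraction hAm hBm hdisj hs0 hpq le_rfl hzp hz.le (by positivity) hcov hκ hZv
  have hloc := le_localEnergy (s (ε j)) (u := v j) (I := Ioo a b) (d := 2 * (1 - η)) hAm hBm
    (by linarith) inter_subset_left inter_subset_left hdisj (by
      rintro x ⟨-, hx⟩ y ⟨-, hy⟩
      simp only [mem_ofPred_eq] at hx hy
      calc 2 * (1 - η) ≤ τ * v j x - τ * v j y := by linarith
        _ ≤ |τ * (v j x - v j y)| := by rw [mul_sub]; exact le_abs_self _
        _ = |v j x - v j y| := by rw [abs_mul, hτabs, one_mul])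
  refine le_trans ?_ (mul_le_mul_right (le_trans (mul_le_mul_right hlow _) hloc) _)
  rw [← ENNReal.ofReal_mul (by positivity), ← ENNReal.ofReal_mul hLp.le]
  apply ENNReal.ofReal_le_ofReal
  have e : 2 * (4 * η * ℓ) / ℓ = 8 * η := by field_simp; norm_num
  rw [e]
  -- Here $Lz^{1-2s}\le\lambda<\eta/2$ and $2s\ge1/2$.
  have hr2 : L * (z ^ (1 - 2 * s (ε j)) / (2 * s (ε j))) ≤ η := by
    rw [← mul_div_assoc, div_le_iff₀ (by linarith)]
    nlinarith
  calc 8 * (1 - η) ^ 2 * ((1 - 8 * η) * (1 - η) - η)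
      ≤ 8 * (1 - η) ^ 2 * ((1 - 8 * η) * (L * ∫ r in z..ℓ / 4, r ^ (-(2 * s (ε j)))) -
        L * (z ^ (1 - 2 * s (ε j)) / (2 * s (ε j)))) := by
        gcongr
        linarith
    _ = _ := by ring

/-- Take a density point of each phase and small disjoint intervals around them. Their order decides
the sign $\tau$, and $\eta\to0$ brings the constant up to $8$. -/
theorem eventually_le_localEnergy (hW : IsDoubleWell W)
    (hs : ∀ ε : ℝ, 0 < ε → s ε ∈ Ioo (0 : ℝ) 1) (hlim : Tendsto s (𝓝[>] 0) (𝓝 (1 / 2)))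
    (hε : Tendsto ε atTop (𝓝[>] 0)) (hv : ∀ j, Measurable (v j)) (hu : Measurable u)
    (hconv : TendstoInMeasure unitVol v atTop u)
    (hF : ∀ j, rescaledEnergy W (ε j) (s (ε j)) (v j) ≤ ENNReal.ofReal C)
    {a b c : ℝ} (hab : Ioo a b ⊆ Ioo 0 1) (halt : Alternates u (Ioo a b)) (hc : c < 8) :
    ∀ᶠ j in atTop, ENNReal.ofReal c ≤
      ENNReal.ofReal (seminormFactor (ε j) (s (ε j))) * localEnergy (s (ε j)) (v j) (Ioo a b) := by
  obtain ⟨η, hη, hη8, hηc⟩ : ∃ η : ℝ, 0 < η ∧ η < 1 / 8 ∧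
      c ≤ 8 * (1 - η) ^ 2 * ((1 - 8 * η) * (1 - η) - η) := by
    have hcont : Continuous fun η : ℝ => 8 * (1 - η) ^ 2 * ((1 - 8 * η) * (1 - η) - η) := by
      fun_prop
    have h0 := (hcont.tendsto 0).mono_left (nhdsWithin_le_nhds (s := Ioi 0))
    have h1 := h0.eventually (lt_mem_nhds (show c < _ by norm_num; exact hc))
    obtain ⟨η, h2, h3⟩ := (h1.and (Ioo_mem_nhdsGT (show (0 : ℝ) < 1 / 8 by norm_num))).exists
    exact ⟨η, h3.1, h3.2, h2.le⟩
  obtain ⟨x, hx, hxd⟩ := exists_density_point (hu (measurableSet_singleton 1)) halt.1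
  obtain ⟨y, hy, hyd⟩ := exists_density_point (hu (measurableSet_singleton (-1))) halt.2
  have hxy : x ≠ y := by
    rintro rfl
    have h1 : u x = 1 := hx.2
    have h2 : u x = -1 := hy.2
    rw [h1] at h2
    norm_num at h2
  have hr : ∀ M : ℝ, 0 < M → ∀ᶠ r in 𝓝[>] (0 : ℝ), 0 < r ∧ r < M := fun M hM => by
    filter_upwards [Ioo_mem_nhdsGT hM] with r h using h
  obtain ⟨r, ⟨hr0, hr1⟩, ⟨-, hr2⟩, ⟨-, hr3⟩, ⟨-, hr4⟩, ⟨-, hr5⟩, hrx, hry⟩ :=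
    ((hr (|x - y| / 2) (by have := abs_pos.2 (sub_ne_zero.2 hxy); positivity)).and
    ((hr (x - a) (by linarith [hx.1.1])).and ((hr (b - x) (by linarith [hx.1.2])).and
    ((hr (y - a) (by linarith [hy.1.1])).and ((hr (b - y) (by linarith [hy.1.2])).and
    ((hxd η hη).and (hyd η hη))))))).exists
  have ex : x - r + 2 * r = x + r := by ring
  have ey : y - r + 2 * r = y + r := by ring
  have key : ∀ᶠ j in atTop, ENNReal.ofReal (8 * (1 - η) ^ 2 * ((1 - 8 * η) * (1 - η) - η)) ≤
      ENNReal.ofReal (seminormFactor (ε j) (s (ε j))) * localEnergy (s (ε j)) (v j) (Ioo a b) := by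
    rcases lt_or_gt_of_ne hxy with h | h
    · rw [abs_of_neg (by linarith)] at hr1
      refine eventually_le_localEnergy_of_intervals hW hs hlim hε hv hconv hF (p := x - r)
        (q := y - r) (ℓ := 2 * r) (τ := 1) hη hη8 (Or.inl rfl) (by linarith) (by linarith) ?_ hab
        (by rw [ex]; exact hrx) (by rw [ey]; exact hry)
      rintro w ⟨h1, h2⟩
      exact ⟨by linarith, by linarith⟩
    · rw [abs_of_pos (by linarith)] at hr1
      refine eventually_le_localEnergy_of_intervals hW hs hlim hε hv hconv hF (p := y - r)
        (q := x - r) (ℓ := 2 * r) (τ := -1) hη hη8 (Or.inr rfl) (by linarith) (by linarith) ?_ hab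
        (by rw [ey]; exact hry) (by rw [ex, neg_neg]; exact hrx)
      rintro w ⟨h1, h2⟩
      exact ⟨by linarith, by linarith⟩
  exact key.mono fun j hj => (ENNReal.ofReal_le_ofReal hηc).trans hj

/-- Superadditivity: the discarded cross interactions are nonnegative. -/
theorem localEnergy_add_le (σ : ℝ) (f : ℝ → ℝ) {a m b : ℝ} (ham : a ≤ m) (hmb : m ≤ b) :
    localEnergy σ f (Ioo a m) + localEnergy σ f (Ioo m b) ≤ localEnergy σ f (Ioo a b) := by
  have h1 : Ioo a m ⊆ Ioo a b := Ioo_subset_Ioo_right hmb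
  have h2 : Ioo m b ⊆ Ioo a b := Ioo_subset_Ioo_left ham
  have hd : Disjoint (Ioo a m) (Ioo m b) :=
    disjoint_left.2 fun x hx hx' => lt_asymm hx.2 hx'.1
  unfold localEnergy
  refine (add_le_add (lintegral_mono fun x => lintegral_mono_set h1)
    (lintegral_mono fun x => lintegral_mono_set h2)).trans ?_
  rw [← lintegral_union measurableSet_Ioo hd]
  exact lintegral_mono_set (union_subset h1 h2)

theorem exists_separating_point {T : Finset ℝ} {a m : ℝ} (ham : a < m) (hT : ∀ x ∈ T, x < m) :
    ∃ c, a < c ∧ c < m ∧ ∀ x ∈ T, x < c := by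
  have h : (insert a T).max' (Finset.insert_nonempty _ _) < m := by
    rw [Finset.max'_lt_iff]
    intro x hx
    rcases Finset.mem_insert.1 hx with rfl | hx
    · exact ham
    · exact hT x hx
  obtain ⟨c, hc1, hc2⟩ := exists_between h
  exact ⟨c, (Finset.le_max' _ _ (Finset.mem_insert_self _ _)).trans_lt hc1, hc2,
    fun x hx => (Finset.le_max' _ _ (Finset.mem_insert_of_mem hx)).trans_lt hc1⟩

/-- Induction on the largest jump: cut the interval between it and the others, and add the two
energies by superadditivity. The interval varies in the induction. -/
theorem eventually_card_mul_le_localEnergy (hW : IsDoubleWell W)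
    (hs : ∀ ε : ℝ, 0 < ε → s ε ∈ Ioo (0 : ℝ) 1) (hlim : Tendsto s (𝓝[>] 0) (𝓝 (1 / 2)))
    (hε : Tendsto ε atTop (𝓝[>] 0)) (hv : ∀ j, Measurable (v j)) (hu : Measurable u)
    (hconv : TendstoInMeasure unitVol v atTop u)
    (hF : ∀ j, rescaledEnergy W (ε j) (s (ε j)) (v j) ≤ ENNReal.ofReal C)
    {c : ℝ} (hc : c < 8) (T : Finset ℝ) :
    ∀ a b : ℝ, Ioo a b ⊆ Ioo 0 1 → ↑T ⊆ essJumps u ∩ Ioo a b →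
    ∀ᶠ j in atTop, T.card * ENNReal.ofReal c ≤
      ENNReal.ofReal (seminormFactor (ε j) (s (ε j))) * localEnergy (s (ε j)) (v j) (Ioo a b) := by
  induction T using Finset.induction_on_max with
  | empty => intro a b _ _; simp
  | insert m T hT ih =>
    intro a b hab hsub
    have hm : m ∈ essJumps u ∩ Ioo a b := hsub (by simp)
    obtain ⟨d, had, hdm, hTd⟩ := exists_separating_point hm.2.1 hT
    have hdb : d < b := hdm.trans hm.2.2
    have h1 := ih a d ((Ioo_subset_Ioo_right hdb.le).trans hab) fun x hx =>
      ⟨(hsub (by simp [Finset.mem_coe.1 hx])).1,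
        (hsub (by simp [Finset.mem_coe.1 hx])).2.1, hTd x hx⟩
    have h2 := eventually_le_localEnergy hW hs hlim hε hv hu hconv hF
      ((Ioo_subset_Ioo_left had.le).trans hab)
      (alternates_of_mem_essJumps hm.1 ⟨hdm, hm.2.2⟩) hc
    filter_upwards [h1, h2] with j hj1 hj2
    rw [Finset.card_insert_of_notMem fun h => lt_irrefl _ (hT m h), Nat.cast_add, Nat.cast_one,
      add_mul, one_mul]
    refine (add_le_add hj1 hj2).trans ?_
    rw [← mul_add]
    gcongr
    exact localEnergy_add_le _ _ had.le hdb.le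

theorem card_mul_le_of_bounded_energy (hW : IsDoubleWell W)
    (hs : ∀ ε : ℝ, 0 < ε → s ε ∈ Ioo (0 : ℝ) 1) (hlim : Tendsto s (𝓝[>] 0) (𝓝 (1 / 2)))
    (hε : Tendsto ε atTop (𝓝[>] 0)) (hv : ∀ j, Measurable (v j)) (hu : Measurable u)
    (hconv : TendstoInMeasure unitVol v atTop u)
    (hF : ∀ j, rescaledEnergy W (ε j) (s (ε j)) (v j) ≤ ENNReal.ofReal C)
    (T : Finset ℝ) (hT : ↑T ⊆ essJumps u) : 8 * (T.card : ℝ≥0∞) ≤ ENNReal.ofReal C := by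
  have key : ∀ c : ℝ, c < 8 → (T.card : ℝ≥0∞) * ENNReal.ofReal c ≤ ENNReal.ofReal C := by
    intro c hc
    obtain ⟨j, hj⟩ := (eventually_card_mul_le_localEnergy hW hs hlim hε hv hu hconv hF hc T 0 1
      subset_rfl fun x hx => ⟨hT hx, (hT hx).1⟩).exists
    exact hj.trans ((seminormFactor_mul_localEnergy_le subset_rfl).trans (hF j))
  have hlim8 : Tendsto (fun c : ℝ => (T.card : ℝ≥0∞) * ENNReal.ofReal c) (𝓝[<] 8)
      (𝓝 (T.card * ENNReal.ofReal 8)) :=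
    (ENNReal.Tendsto.const_mul (ENNReal.tendsto_ofReal tendsto_id)
      (Or.inr (ENNReal.natCast_ne_top _))).mono_left nhdsWithin_le_nhds
  have := le_of_tendsto hlim8 (by
    filter_upwards [self_mem_nhdsWithin] with c hc using key c hc)
  rw [mul_comm]
  simpa using this

end Sequences

/-! ### Functions with values $\pm1$ and finitely many essential jumps -/

theorem ae_const_of_not_alternates {u : ℝ → ℝ} (hu : ∀ᵐ x ∂unitVol, u x = 1 ∨ u x = -1)
    {I : Set ℝ} (hI : I ⊆ Ioo 0 1) (h : ¬ Alternates u I) :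
    ∃ σ : ℝ, (σ = 1 ∨ σ = -1) ∧ volume (I ∩ {x | u x ≠ σ}) = 0 := by
  have h0 : volume ({x | ¬ (u x = 1 ∨ u x = -1)} ∩ Ioo 0 1) = 0 := by
    rw [← unitVol_apply_eq]; exact hu
  have key : ∀ σ : ℝ, (σ = 1 ∨ σ = -1) → volume (I ∩ {x | u x = -σ}) = 0 →
      volume (I ∩ {x | u x ≠ σ}) = 0 := by
    intro σ hσ hv
    refine measure_mono_null ?_ (measure_union_null hv h0)
    rintro x ⟨hxI, hx⟩
    by_cases h1 : u x = -σ
    · exact Or.inl ⟨hxI, h1⟩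
    · refine Or.inr ⟨?_, hI hxI⟩
      simp only [mem_ofPred_eq] at hx ⊢
      rcases hσ with rfl | rfl
      · tauto
      · rw [neg_neg] at h1; tauto
  unfold Alternates at h
  rw [not_and_or, not_lt, not_lt, nonpos_iff_eq_zero, nonpos_iff_eq_zero] at h
  rcases h with h | h
  · exact ⟨-1, Or.inr rfl, key (-1) (Or.inr rfl) (by rwa [neg_neg])⟩
  · exact ⟨1, Or.inl rfl, key 1 (Or.inl rfl) h⟩

theorem jumpSet_subset_essJumps {u : ℝ → ℝ} (hu : ∀ᵐ x ∂unitVol, u x = 1 ∨ u x = -1) :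
    jumpSet u ⊆ essJumps u := by
  rintro t ⟨ht, hlim⟩
  by_contra hcon
  apply hlim
  have : ∃ h : ℝ, 0 < h ∧ ¬ Alternates u (Ioo (t - h) (t + h) ∩ Ioo 0 1) := by
    by_contra h2
    push Not at h2
    exact hcon ⟨ht, h2⟩
  obtain ⟨h, hh, halt⟩ := this
  obtain ⟨σ, -, hσ⟩ := ae_const_of_not_alternates hu inter_subset_right halt
  refine ⟨σ, fun η hη => ?_⟩
  refine tendsto_const_nhds.congr' ?_
  have hd : 0 < min h (min t (1 - t)) := lt_min hh (lt_min ht.1 (by linarith [ht.2]))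
  filter_upwards [Ioo_mem_nhdsGT hd] with r hr
  have h1 : r < h := hr.2.trans_le (min_le_left _ _)
  have h2 : r < t := hr.2.trans_le ((min_le_right _ _).trans (min_le_left _ _))
  have h3 : r < 1 - t := hr.2.trans_le ((min_le_right _ _).trans (min_le_right _ _))
  have : volume {x | x ∈ Ioo (t - r) (t + r) ∧ η ≤ |u x - σ|} = 0 := by
    refine measure_mono_null ?_ hσ
    rintro x ⟨hx, hxη⟩
    refine ⟨⟨⟨by linarith [hx.1], by linarith [hx.2]⟩, by linarith [hx.1], by linarith [hx.2]⟩, ?_⟩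
    intro hxσ
    rw [hxσ, sub_self, abs_zero] at hxη
    linarith
  rw [this, ENNReal.zero_div]

/-- Connectedness: the largest open sets where $u=1$ a.e. and where $u=-1$ a.e. cover the interval,
and they cannot meet inside it because a nonempty open set is not null. So one of them covers
everything. -/
theorem ae_const_of_disjoint_essJumps {u : ℝ → ℝ} (hu : ∀ᵐ x ∂unitVol, u x = 1 ∨ u x = -1)
    {a b : ℝ} (hab : Ioo a b ⊆ Ioo 0 1) (hd : Disjoint (essJumps u) (Ioo a b)) :
    ∃ σ : ℝ, (σ = 1 ∨ σ = -1) ∧ volume (Ioo a b ∩ {x | u x ≠ σ}) = 0 := by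
  let U : ℝ → Set ℝ := fun σ => ⋃₀ {O | IsOpen O ∧ volume (O ∩ Ioo 0 1 ∩ {x | u x ≠ σ}) = 0}
  have hUo : ∀ σ, IsOpen (U σ) := fun σ => isOpen_sUnion fun O hO => hO.1
  have hnull : ∀ σ, Ioo a b ⊆ U σ → volume (Ioo a b ∩ {x | u x ≠ σ}) = 0 := by
    intro σ hσ
    refine measure_null_of_locally_null _ fun x hx => ?_
    obtain ⟨O, hO, hxO⟩ := hσ hx.1
    refine ⟨O ∩ (Ioo a b ∩ {x | u x ≠ σ}),
      inter_comm O _ ▸ inter_mem_nhdsWithin _ (hO.1.mem_nhds hxO), measure_mono_null ?_ hO.2⟩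
    rintro y ⟨h1, h2, h3⟩
    exact ⟨⟨h1, hab h2⟩, h3⟩
  have hcov : Ioo a b ⊆ U 1 ∪ U (-1) := by
    intro t ht
    have : ∃ h : ℝ, 0 < h ∧ ¬ Alternates u (Ioo (t - h) (t + h) ∩ Ioo 0 1) := by
      by_contra h2
      push Not at h2
      exact disjoint_left.1 hd ⟨hab ht, h2⟩ ht
    obtain ⟨h, hh, halt⟩ := this
    obtain ⟨σ, hσ1, hσ⟩ := ae_const_of_not_alternates hu inter_subset_right halt
    have htm : t ∈ U σ := ⟨Ioo (t - h) (t + h), ⟨isOpen_Ioo, hσ⟩, by constructor <;> linarith⟩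
    rcases hσ1 with rfl | rfl
    · exact Or.inl htm
    · exact Or.inr htm
  by_cases h1 : (Ioo a b ∩ U 1).Nonempty
  · by_cases h2 : (Ioo a b ∩ U (-1)).Nonempty
    · exfalso
      obtain ⟨t, ht, ⟨O, hO, htO⟩, ⟨O', hO', htO'⟩⟩ :=
        isPreconnected_Ioo _ _ (hUo 1) (hUo (-1)) hcov h1 h2
      have hopen : IsOpen (O ∩ O' ∩ Ioo 0 1) := (hO.1.inter hO'.1).inter isOpen_Ioo
      refine (hopen.measure_pos volume ⟨t, ⟨htO, htO'⟩, hab ht⟩).ne' ?_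
      refine measure_mono_null ?_ (measure_union_null hO.2 hO'.2)
      rintro x ⟨⟨h1, h2⟩, h3⟩
      by_cases hx : u x = 1
      · refine Or.inr ⟨⟨h2, h3⟩, ?_⟩
        simp only [mem_ofPred_eq, hx]
        norm_num
      · exact Or.inl ⟨⟨h1, h3⟩, hx⟩
    · refine ⟨1, Or.inl rfl, hnull 1 fun x hx => ?_⟩
      exact (hcov hx).resolve_right fun h => h2 ⟨x, hx, h⟩
  · refine ⟨-1, Or.inr rfl, hnull (-1) fun x hx => ?_⟩
    exact (hcov hx).resolve_left fun h => h1 ⟨x, hx, h⟩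

/-- The function jumping from `-1` to `1` at `t`. -/
def stepAt (t x : ℝ) : ℝ := if x < t then -1 else 1

theorem stepAt_eq_or (t x : ℝ) : stepAt t x = 1 ∨ stepAt t x = -1 := by
  unfold stepAt; split_ifs <;> simp

theorem monotone_stepAt (t : ℝ) : Monotone (stepAt t) := by
  intro x y hxy
  unfold stepAt
  split_ifs with h1 h2 h2
  · exact le_rfl
  · norm_num
  · exact absurd (hxy.trans_lt h2) h1
  · exact le_rfl

theorem prod_eq_one_or {ι : Type*} (T : Finset ι) (f : ι → ℝ) (h : ∀ i ∈ T, f i = 1 ∨ f i = -1) :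
    ∏ i ∈ T, f i = 1 ∨ ∏ i ∈ T, f i = -1 := by
  refine Finset.prod_induction f (fun x => x = 1 ∨ x = -1) ?_ (Or.inl rfl) h
  rintro a b (rfl | rfl) (rfl | rfl) <;> simp

theorem exists_isolating_radius (T : Finset ℝ) {t : ℝ} (ht : t ∈ Ioo (0 : ℝ) 1) :
    ∃ h > 0, Ioo (t - h) (t + h) ⊆ Ioo 0 1 ∧ ∀ t' ∈ T, t' ≠ t → t' ∉ Ioo (t - h) (t + h) := by
  have hopen : IsOpen (Ioo (0 : ℝ) 1 ∩ (↑(T.erase t))ᶜ) :=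
    isOpen_Ioo.inter (T.erase t).finite_toSet.isClosed.isOpen_compl
  obtain ⟨h, hh, hsub⟩ := Metric.isOpen_iff.1 hopen t ⟨ht, by simp⟩
  rw [Real.ball_eq_Ioo] at hsub
  refine ⟨h, hh, fun x hx => (hsub hx).1, fun t' ht' hne hmem => (hsub hmem).2 ?_⟩
  simp [ht', hne]

/-- Near an isolated essential jump, `u` is a step function. -/
theorem ae_eq_stepAt_of_isolated {u : ℝ → ℝ} (hu : ∀ᵐ x ∂unitVol, u x = 1 ∨ u x = -1) {t h : ℝ}
    (ht : t ∈ essJumps u) (hh : 0 < h) (hsub : Ioo (t - h) (t + h) ⊆ Ioo 0 1)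
    (hiso : ∀ t' ∈ essJumps u, t' ≠ t → t' ∉ Ioo (t - h) (t + h)) :
    ∃ σ : ℝ, (σ = 1 ∨ σ = -1) ∧ volume (Ioo (t - h) (t + h) ∩ {x | u x ≠ σ * stepAt t x}) = 0 := by
  have hl : Ioo (t - h) t ⊆ Ioo (t - h) (t + h) := Ioo_subset_Ioo_right (by linarith)
  have hr : Ioo t (t + h) ⊆ Ioo (t - h) (t + h) := Ioo_subset_Ioo_left (by linarith)
  obtain ⟨σ₁, hσ₁, h1⟩ := ae_const_of_disjoint_essJumps hu (hl.trans hsub)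
    (disjoint_left.2 fun x hx hx' => hiso x hx hx'.2.ne (hl hx'))
  obtain ⟨σ₂, hσ₂, h2⟩ := ae_const_of_disjoint_essJumps hu (hr.trans hsub)
    (disjoint_left.2 fun x hx hx' => hiso x hx hx'.1.ne' (hr hx'))
  have hnull : ∀ P : ℝ → Prop, (∀ x, x < t → u x = σ₁ → P x) → (∀ x, t < x → u x = σ₂ → P x) →
      volume (Ioo (t - h) (t + h) ∩ {x | ¬ P x}) = 0 := by
    intro P hP1 hP2
    refine measure_mono_null ?_
      (measure_union_null (measure_union_null h1 h2) (Real.volume_singleton (a := t)))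
    rintro x ⟨hx, hxP⟩
    rcases lt_trichotomy x t with hlt | heq | hgt
    · exact Or.inl (Or.inl ⟨⟨hx.1, hlt⟩, fun hc => hxP (hP1 x hlt hc)⟩)
    · exact Or.inr heq
    · exact Or.inl (Or.inr ⟨⟨hgt, hx.2⟩, fun hc => hxP (hP2 x hgt hc)⟩)
  have halt := alternates_of_mem_essJumps ht (a := t - h) (b := t + h) (by constructor <;> linarith)
  have hne : σ₁ ≠ σ₂ := by
    rintro rfl
    rcases hσ₁ with rfl | rfl
    · refine halt.2.ne' ?_
      have := hnull (fun x => u x ≠ -1) (fun x _ hx => by rw [hx]; norm_num)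
        (fun x _ hx => by rw [hx]; norm_num)
      simpa using this
    · refine halt.1.ne' ?_
      have := hnull (fun x => u x ≠ 1) (fun x _ hx => by rw [hx]; norm_num)
        (fun x _ hx => by rw [hx]; norm_num)
      simpa using this
  have hopp : σ₁ = -σ₂ := by
    rcases hσ₁ with rfl | rfl <;> rcases hσ₂ with rfl | rfl <;> simp_all
  refine ⟨σ₂, hσ₂, hnull (fun x => u x = σ₂ * stepAt t x) (fun x hx hux => ?_) fun x hx hux => ?_⟩
  · rw [hux, stepAt, if_pos hx, hopp]; ring
  · rw [hux, stepAt, if_neg (by linarith)]; ring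

theorem stepAt_eq_of_notMem {t t' h x : ℝ} (hh : 0 < h) (ht' : t' ∉ Ioo (t - h) (t + h))
    (hx : x ∈ Ioo (t - h) (t + h)) : stepAt t' x = stepAt t' t := by
  unfold stepAt
  have : x < t' ↔ t < t' := by
    constructor
    · intro h1
      by_contra h2
      exact ht' ⟨by linarith [hx.1], by linarith [not_lt.1 h2]⟩
    · intro h1
      by_contra h2
      exact ht' ⟨by linarith, by linarith [not_lt.1 h2, hx.2]⟩
  simp [this]

theorem not_alternates_of_ae_const {u : ℝ → ℝ} {I : Set ℝ} {σ : ℝ} 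
    (h : volume (I ∩ {x | u x ≠ σ}) = 0) : ¬ Alternates u I := by
  intro ha
  by_cases h1 : σ = 1
  · refine ha.2.ne' (measure_mono_null ?_ h)
    rintro x ⟨hx, hx2⟩
    refine ⟨hx, ?_⟩
    simp only [mem_ofPred_eq] at hx2 ⊢
    rw [hx2, h1]
    norm_num
  · refine ha.1.ne' (measure_mono_null ?_ h)
    rintro x ⟨hx, hx2⟩
    refine ⟨hx, ?_⟩
    simp only [mem_ofPred_eq] at hx2 ⊢
    rw [hx2]
    exact fun hc => h1 hc.symm

/-- A function with values `±1` and finitely many essential jumps is a product of steps. -/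
theorem ae_eq_prod_stepAt {u : ℝ → ℝ} (hu : ∀ᵐ x ∂unitVol, u x = 1 ∨ u x = -1) {T : Finset ℝ}
    (hT : ↑T = essJumps u) :
    ∃ σ : ℝ, (σ = 1 ∨ σ = -1) ∧ ∀ᵐ x ∂unitVol, u x = σ * ∏ t ∈ T, stepAt t x := by
  set P : ℝ → ℝ := fun x => ∏ t ∈ T, stepAt t x with hP
  have hP1 : ∀ x, P x = 1 ∨ P x = -1 := fun x => prod_eq_one_or _ _ fun t _ => stepAt_eq_or t x
  have hPP : ∀ x, P x * P x = 1 := fun x => by rcases hP1 x with h | h <;> rw [h] <;> norm_num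
  -- Near a point of $T$ both $u$ and $P$ are, up to sign, the same step, whose square is $1$;
  -- elsewhere both are locally a.e. constant. Hence $w$ has no essential jump and is a.e. constant,
  -- and $u=wP$ because $P^2=1$.
  set w : ℝ → ℝ := fun x => u x * P x with hw
  have hw1 : ∀ᵐ x ∂unitVol, w x = 1 ∨ w x = -1 := by
    filter_upwards [hu] with x hx
    rcases hx with h | h <;> rcases hP1 x with h' | h' <;> simp [hw, h, h']
  have hD : Disjoint (essJumps w) (Ioo 0 1) := by
    refine disjoint_left.2 fun t ht _ => ?_
    obtain ⟨h, hh, hsub, hiso⟩ := exists_isolating_radius T ht.1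
    by_cases htT : t ∈ T
    · obtain ⟨σ, -, hσ⟩ := ae_eq_stepAt_of_isolated hu (hT ▸ htT : t ∈ essJumps u) hh hsub
        fun t' ht' => hiso t' (by rw [← hT] at ht'; exact ht')
      have hnull : volume (Ioo (t - h) (t + h) ∩
          {x | w x ≠ σ * ∏ t' ∈ T.erase t, stepAt t' t}) = 0 := by
        refine measure_mono_null ?_ hσ
        rintro x ⟨hx, hx2⟩
        refine ⟨hx, fun hux => hx2 ?_⟩
        have e1 : P x = stepAt t x * ∏ t' ∈ T.erase t, stepAt t' t := by
          change ∏ t' ∈ T, stepAt t' x = _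
          rw [← Finset.mul_prod_erase T _ htT]
          congr 1
          refine Finset.prod_congr rfl fun t' ht' => ?_
          exact stepAt_eq_of_notMem hh
            (hiso t' (Finset.mem_of_mem_erase ht') (Finset.ne_of_mem_erase ht')) hx
        have e2 : stepAt t x * stepAt t x = 1 := by
          rcases stepAt_eq_or t x with h | h <;> rw [h] <;> norm_num
        change u x * P x = _
        rw [hux, e1]
        linear_combination (σ * ∏ t' ∈ T.erase t, stepAt t' t) * e2
      exact not_alternates_of_ae_const hnull
        (alternates_of_mem_essJumps ht (by constructor <;> linarith))
    · have htD : t ∉ essJumps u := by rw [← hT]; exact htT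
      obtain ⟨σ, -, hσ⟩ := ae_const_of_disjoint_essJumps hu hsub (disjoint_left.2 fun t' ht' hm => by
        have ht'T : t' ∈ T := by rw [← hT] at ht'; exact ht'
        exact hiso t' ht'T (fun hc => htT (hc ▸ ht'T)) hm)
      have hnull : volume (Ioo (t - h) (t + h) ∩ {x | w x ≠ σ * P t}) = 0 := by
        refine measure_mono_null ?_ hσ
        rintro x ⟨hx, hx2⟩
        refine ⟨hx, fun hux => hx2 ?_⟩
        have e1 : P x = P t := Finset.prod_congr rfl fun t' ht' =>
          stepAt_eq_of_notMem hh (hiso t' ht' fun hc => htT (hc ▸ ht')) hx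
        change u x * P x = _
        rw [hux, e1]
      exact not_alternates_of_ae_const hnull
        (alternates_of_mem_essJumps ht (by constructor <;> linarith))
  obtain ⟨σ, hσ, hnull⟩ := ae_const_of_disjoint_essJumps hw1 subset_rfl hD
  refine ⟨σ, hσ, ?_⟩
  have : ∀ᵐ x ∂unitVol, w x = σ := by
    rw [ae_iff, unitVol_apply_eq, inter_comm]
    exact hnull
  filter_upwards [this] with x hx
  calc u x = u x * (P x * P x) := by rw [hPP, mul_one]
    _ = w x * P x := by rw [hw]; ring
    _ = σ * P x := by rw [hx]

theorem eVariationOn_mul_le {f g : ℝ → ℝ} {S : Set ℝ} (hf : ∀ x, |f x| ≤ 1) (hg : ∀ x, |g x| ≤ 1) :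
    eVariationOn (fun x => f x * g x) S ≤ eVariationOn f S + eVariationOn g S := by
  refine iSup_le fun p => ?_
  calc ∑ i ∈ Finset.range p.1, edist (f (p.2.1 (i + 1)) * g (p.2.1 (i + 1)))
        (f (p.2.1 i) * g (p.2.1 i))
      ≤ ∑ i ∈ Finset.range p.1, (edist (f (p.2.1 (i + 1))) (f (p.2.1 i)) +
          edist (g (p.2.1 (i + 1))) (g (p.2.1 i))) := by
        refine Finset.sum_le_sum fun i _ => ?_
        set x := p.2.1 (i + 1)
        set y := p.2.1 i
        simp only [edist_dist]
        rw [← ENNReal.ofReal_add dist_nonneg dist_nonneg]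
        apply ENNReal.ofReal_le_ofReal
        simp only [Real.dist_eq]
        have e : f x * g x - f y * g y = (f x - f y) * g x + f y * (g x - g y) := by ring
        rw [e]
        refine (abs_add_le _ _).trans ?_
        rw [abs_mul, abs_mul]
        have h1 := mul_le_mul_of_nonneg_left (hg x) (abs_nonneg (f x - f y))
        have h2 := mul_le_mul_of_nonneg_right (hf y) (abs_nonneg (g x - g y))
        linarith
    _ = _ := Finset.sum_add_distrib
    _ ≤ _ := add_le_add (eVariationOn.sum_le p.2.2.1 p.2.2.2)
        (eVariationOn.sum_le p.2.2.1 p.2.2.2)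

theorem abs_le_one_of_eq_or {x : ℝ} (h : x = 1 ∨ x = -1) : |x| ≤ 1 := by
  rcases h with h | h <;> rw [h] <;> norm_num

theorem boundedVariationOn_prod_stepAt (T : Finset ℝ) (S : Set ℝ) :
    BoundedVariationOn (fun x => ∏ t ∈ T, stepAt t x) S := by
  induction T using Finset.induction_on with
  | empty =>
    simp only [Finset.prod_empty]
    have : eVariationOn (fun _ : ℝ => (1 : ℝ)) S = 0 :=
      eVariationOn.constant_on fun x hx y hy => by
        obtain ⟨_, _, rfl⟩ := hx
        obtain ⟨_, _, rfl⟩ := hy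
        rfl
    rw [BoundedVariationOn, this]
    exact ENNReal.zero_ne_top
  | insert t T ht ih =>
    simp only [Finset.prod_insert ht]
    have h1 : BoundedVariationOn (stepAt t) S :=
      ((monotone_stepAt t).monotoneOn S).boundedVariationOn (C := 1)
        fun x _ => abs_le_one_of_eq_or (stepAt_eq_or t x)
    exact ((eVariationOn_mul_le (fun x => abs_le_one_of_eq_or (stepAt_eq_or t x))
      fun x => abs_le_one_of_eq_or (prod_eq_one_or _ _ fun t _ => stepAt_eq_or t x)).trans_lt
      (ENNReal.add_lt_top.2 ⟨h1.lt_top, ih.lt_top⟩)).ne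

theorem memBVpm_of_finite_essJumps {u : ℝ → ℝ} (hu : ∀ᵐ x ∂unitVol, u x = 1 ∨ u x = -1)
    (hfin : (essJumps u).Finite) : MemBVpm u := by
  obtain ⟨σ, hσ, hae⟩ := ae_eq_prod_stepAt hu hfin.coe_toFinset
  refine ⟨hu, fun x => σ * ∏ t ∈ hfin.toFinset, stepAt t x, ?_, ?_⟩
  · filter_upwards [hae] with x hx using hx.symm
  · have h0 : eVariationOn (fun _ : ℝ => σ) (Ioo 0 1) = 0 :=
      eVariationOn.constant_on fun x hx y hy => by
        obtain ⟨_, _, rfl⟩ := hx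
        obtain ⟨_, _, rfl⟩ := hy
        rfl
    refine ((eVariationOn_mul_le (fun x => abs_le_one_of_eq_or hσ)
      fun x => abs_le_one_of_eq_or (prod_eq_one_or _ _ fun t _ => stepAt_eq_or t x)).trans_lt ?_).ne
    rw [h0, zero_add]
    exact (boundedVariationOn_prod_stepAt _ _).lt_top

/-- Any representative attains both $1$ and $-1$ close to each essential jump, which costs variation
$2$. Cutting between jumps separates these contributions. -/
theorem two_mul_card_le_eVariationOn {u g : ℝ → ℝ} (hg : g =ᵐ[unitVol] u) (T : Finset ℝ) :
    ∀ a b : ℝ, Ioo a b ⊆ Ioo 0 1 → ↑T ⊆ essJumps u ∩ Ioo a b →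
      2 * (T.card : ℝ≥0∞) ≤ eVariationOn g (Ioo a b) := by
  have hnull : volume ({x | g x ≠ u x} ∩ Ioo 0 1) = 0 := by
    rw [← unitVol_apply_eq]; exact hg
  have hpick : ∀ I : Set ℝ, I ⊆ Ioo 0 1 → ∀ σ, 0 < volume (I ∩ {x | u x = σ}) →
      ∃ x ∈ I, g x = σ := by
    intro I hI σ hpos
    by_contra hcon
    push Not at hcon
    refine hpos.ne' (measure_mono_null ?_ hnull)
    rintro x ⟨hx, hxσ⟩
    refine ⟨?_, hI hx⟩
    simp only [mem_ofPred_eq] at hxσ ⊢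
    rw [hxσ]
    exact hcon x hx
  induction T using Finset.induction_on_max with
  | empty => intro a b _ _; simp
  | insert m T hT ih =>
    intro a b hab hsub
    have hm : m ∈ essJumps u ∩ Ioo a b := hsub (by simp)
    obtain ⟨d, had, hdm, hTd⟩ := exists_separating_point hm.2.1 hT
    have hdb : d < b := hdm.trans hm.2.2
    have h1 := ih a d ((Ioo_subset_Ioo_right hdb.le).trans hab) fun x hx =>
      ⟨(hsub (by simp [Finset.mem_coe.1 hx])).1,
        (hsub (by simp [Finset.mem_coe.1 hx])).2.1, hTd x hx⟩
    have halt := alternates_of_mem_essJumps hm.1 ⟨hdm, hm.2.2⟩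
    have hdb01 := (Ioo_subset_Ioo_left had.le).trans hab
    obtain ⟨x, hx, hgx⟩ := hpick _ hdb01 _ halt.1
    obtain ⟨y, hy, hgy⟩ := hpick _ hdb01 _ halt.2
    have h2 := eVariationOn.edist_le g hx hy
    have h3 : edist (g x) (g y) = 2 := by
      rw [hgx, hgy, edist_dist, Real.dist_eq]; norm_num
    rw [h3] at h2
    rw [Finset.card_insert_of_notMem fun h => lt_irrefl _ (hT m h), Nat.cast_add, Nat.cast_one,
      mul_add, mul_one]
    refine (add_le_add h1 h2).trans ((eVariationOn.add_le_union g
      fun x hx y hy => (hx.2.trans hy.1).le).trans (eVariationOn.mono _ ?_))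
    exact union_subset (Ioo_subset_Ioo_right hdb.le) (Ioo_subset_Ioo_left had.le)

theorem finite_of_forall_finset_card_le {D : Set ℝ} {N : ℕ}
    (h : ∀ T : Finset ℝ, ↑T ⊆ D → T.card ≤ N) : D.Finite := by
  by_contra hinf
  obtain ⟨T, hT, hcard⟩ := (Set.not_finite.1 hinf).exists_subset_card_eq (N + 1)
  have := h T hT
  omega

theorem finite_of_forall_card_mul_le {D : Set ℝ} {C : ℝ≥0∞} (hC : C ≠ ∞)
    (h : ∀ T : Finset ℝ, ↑T ⊆ D → (T.card : ℝ≥0∞) ≤ C) : D.Finite := by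
  obtain ⟨N, hN⟩ := ENNReal.exists_nat_gt hC
  refine finite_of_forall_finset_card_le (N := N) fun T hT => ?_
  exact_mod_cast ((h T hT).trans_lt hN).le

theorem MemBVpm.finite_essJumps {u : ℝ → ℝ} (hu : MemBVpm u) : (essJumps u).Finite := by
  obtain ⟨-, g, hg, hbv⟩ := hu
  refine finite_of_forall_card_mul_le hbv fun T hT => ?_
  refine le_trans ?_ (two_mul_card_le_eVariationOn hg T 0 1 subset_rfl fun x hx =>
    ⟨hT hx, (hT hx).1⟩)
  exact le_mul_of_one_le_left' (by norm_num)

/-- At an isolated essential jump $u$ is a step. No $z$ is at distance less than $1$ from both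
wells, so on one side of $t$, which is half of every centred interval, $|u-z|\ge1$. This excludes
density zero. -/
theorem jumpSet_eq_essJumps {u : ℝ → ℝ} (hu : ∀ᵐ x ∂unitVol, u x = 1 ∨ u x = -1)
    (hfin : (essJumps u).Finite) : jumpSet u = essJumps u := by
  refine (jumpSet_subset_essJumps hu).antisymm fun t ht => ⟨ht.1, ?_⟩
  rintro ⟨z, hz⟩
  obtain ⟨h, hh, hsub, hiso⟩ := exists_isolating_radius hfin.toFinset ht.1
  obtain ⟨σ, hσ, hnull⟩ := ae_eq_stepAt_of_isolated hu ht hh hsub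
    fun t' ht' => hiso t' (by simpa using ht')
  have key : ∃ I : ℝ → Set ℝ, (∀ r, volume (I r) = ENNReal.ofReal r) ∧
      ∀ r, 0 < r → r < h → I r ⊆ Ioo (t - r) (t + r) ∧ ∀ x ∈ I r, 1 ≤ |σ * stepAt t x - z| := by
    have hz2 : 1 ≤ |σ - z| ∨ 1 ≤ |-σ - z| := by
      by_contra hcon
      push Not at hcon
      have h1 := abs_lt.1 hcon.1
      have h2 := abs_lt.1 hcon.2
      rcases hσ with h | h <;> rw [h] at h1 h2 <;> linarith [h1.1, h1.2, h2.1, h2.2]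
    rcases hz2 with hz2 | hz2
    · refine ⟨fun r => Ioo t (t + r), fun r => by simp, fun r hr hrh => ⟨?_, fun x hx => ?_⟩⟩
      · exact Ioo_subset_Ioo_left (by linarith)
      · rw [stepAt, if_neg (not_lt.2 hx.1.le), mul_one]; exact hz2
    · refine ⟨fun r => Ioo (t - r) t, fun r => by simp, fun r hr hrh => ⟨?_, fun x hx => ?_⟩⟩
      · exact Ioo_subset_Ioo_right (by linarith)
      · rw [stepAt, if_pos hx.2, mul_neg_one]; exact hz2
  obtain ⟨I, hIv, hI⟩ := key
  have hlim := (hz 1 one_pos).eventually (gt_mem_nhds (show (0 : ℝ≥0∞) < 1 / 2 by norm_num))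
  obtain ⟨r, hr, hr0, hrh⟩ := (hlim.and (Ioo_mem_nhdsGT hh)).exists
  obtain ⟨hI1, hI2⟩ := hI r hr0 hrh
  have hle : ENNReal.ofReal r ≤ volume {x | x ∈ Ioo (t - r) (t + r) ∧ 1 ≤ |u x - z|} := by
    rw [← hIv r]
    calc volume (I r) ≤ volume ({x | x ∈ Ioo (t - r) (t + r) ∧ 1 ≤ |u x - z|} ∪
          (Ioo (t - h) (t + h) ∩ {x | u x ≠ σ * stepAt t x})) := by
          refine measure_mono fun x hx => ?_
          by_cases hux : u x = σ * stepAt t x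
          · exact Or.inl ⟨hI1 hx, by rw [hux]; exact hI2 x hx⟩
          · exact Or.inr ⟨⟨by linarith [(hI1 hx).1], by linarith [(hI1 hx).2]⟩, hux⟩
      _ ≤ _ := measure_union_le _ _
      _ = _ := by rw [hnull, add_zero]
  have h2r : (0 : ℝ) < 2 * r := by linarith
  rw [ENNReal.div_lt_iff (Or.inl (by simpa using hr0)) (Or.inl ENNReal.ofReal_ne_top)] at hr
  refine absurd (hle.trans_lt hr) (not_lt.2 (le_of_eq ?_))
  rw [ENNReal.ofReal_mul two_pos.le, ← mul_assoc, ENNReal.ofReal_ofNat, one_div,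
    ENNReal.inv_mul_cancel (by norm_num) (by norm_num), one_mul]

theorem limitEnergy_eq_of_finite {u : ℝ → ℝ} (hu : ∀ᵐ x ∂unitVol, u x = 1 ∨ u x = -1)
    (hfin : (essJumps u).Finite) : limitEnergy u = 8 * (hfin.toFinset.card : ℝ≥0∞) := by
  rw [limitEnergy, if_pos (memBVpm_of_finite_essJumps hu hfin), jumpSet_eq_essJumps hu hfin,
    hfin.encard_eq_coe_toFinset_card]
  rfl

/-! ### The liminf inequality -/

theorem limitEnergy_le_of_bounded_energy {W : ℝ → ℝ} {s : ℝ → ℝ} {ε : ℕ → ℝ} {v : ℕ → ℝ → ℝ}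
    {u : ℝ → ℝ} {C : ℝ} (hW : IsDoubleWell W)
    (hs : ∀ ε : ℝ, 0 < ε → s ε ∈ Ioo (0 : ℝ) 1) (hlim : Tendsto s (𝓝[>] 0) (𝓝 (1 / 2)))
    (hε : Tendsto ε atTop (𝓝[>] 0)) (hv : ∀ j, Measurable (v j)) (hu : Measurable u)
    (hconv : TendstoInMeasure unitVol v atTop u)
    (hF : ∀ j, rescaledEnergy W (ε j) (s (ε j)) (v j) ≤ ENNReal.ofReal C) :
    limitEnergy u ≤ ENNReal.ofReal C := by
  have hpm := ae_eq_one_or_of_bounded_energy hW hs hlim hε hv hconv hu hF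
  have hcard := card_mul_le_of_bounded_energy hW hs hlim hε hv hu hconv hF
  have hfin : (essJumps u).Finite := finite_of_forall_card_mul_le (C := ENNReal.ofReal C)
    ENNReal.ofReal_ne_top fun T hT => le_trans (le_mul_of_one_le_left' (by norm_num)) (hcard T hT)
  rw [limitEnergy_eq_of_finite hpm hfin]
  exact hcard _ (by simp)

theorem limitEnergy_le_liminf {W : ℝ → ℝ} {s : ℝ → ℝ} {ε : ℕ → ℝ} {v : ℕ → ℝ → ℝ}
    {u : ℝ → ℝ} (hW : IsDoubleWell W)
    (hs : ∀ ε : ℝ, 0 < ε → s ε ∈ Ioo (0 : ℝ) 1) (hlim : Tendsto s (𝓝[>] 0) (𝓝 (1 / 2)))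
    (hε : Tendsto ε atTop (𝓝[>] 0)) (hv : ∀ j, Measurable (v j)) (hu : Measurable u)
    (hconv : TendstoInMeasure unitVol v atTop u) :
    limitEnergy u ≤ liminf (fun j => rescaledEnergy W (ε j) (s (ε j)) (v j)) atTop := by
  refine le_of_forall_gt fun C hC => ?_
  obtain ⟨C', hC1, hC2⟩ := exists_between hC
  have hfreq := frequently_lt_of_liminf_lt (by isBoundedDefault) hC1
  obtain ⟨φ, hφ, hφF⟩ := extraction_of_frequently_atTop hfreq
  refine lt_of_le_of_lt ?_ hC2
  have htop : C' ≠ ∞ := (hC2.trans_le le_top).ne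
  rw [← ENNReal.ofReal_toReal htop]
  refine limitEnergy_le_of_bounded_energy hW hs hlim (ε := ε ∘ φ) (v := v ∘ φ)
    (hε.comp hφ.tendsto_atTop) (fun j => hv _) hu (hconv.comp hφ.tendsto_atTop) fun j => ?_
  rw [ENNReal.ofReal_toReal htop]
  exact (hφF j).le

/-! ### The recovery family and its energy -/

theorem gagliardoSq_le_shift (s : ℝ) {f : ℝ → ℝ} (hf : Measurable f) :
    gagliardoSq s f ≤ ∫⁻ r in Ioo (-1 : ℝ) 1, ∫⁻ x in Ioo (0 : ℝ) 1,
      ENNReal.ofReal (|f x - f (x + r)| ^ 2 / |r| ^ (1 + 2 * s)) := by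
  have hm : Measurable fun p : ℝ × ℝ =>
      ENNReal.ofReal (|f p.1 - f (p.1 + p.2)| ^ 2 / |p.2| ^ (1 + 2 * s)) := by fun_prop
  rw [lintegral_lintegral_swap (f := fun r x =>
    ENNReal.ofReal (|f x - f (x + r)| ^ 2 / |r| ^ (1 + 2 * s)))
    (hm.comp measurable_swap).aemeasurable]
  refine setLIntegral_mono' measurableSet_Ioo fun x hx => ?_
  rw [← lintegral_indicator measurableSet_Ioo, ← lintegral_add_left_eq_self _ x,
    ← lintegral_indicator measurableSet_Ioo]
  refine lintegral_mono fun r => ?_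
  by_cases hr : x + r ∈ Ioo (0 : ℝ) 1
  · have hr' : r ∈ Ioo (-1 : ℝ) 1 := ⟨by linarith [hx.2, hr.1], by linarith [hx.1, hr.2]⟩
    rw [indicator_of_mem hr, indicator_of_mem hr', sub_add_cancel_left, abs_neg]
  · rw [indicator_of_notMem hr]; exact zero_le

theorem lintegral_Ioo_abs (h : ℝ → ℝ≥0∞) :
    ∫⁻ r in Ioo (-1 : ℝ) 1, h |r| = 2 * ∫⁻ r in Ioo (0 : ℝ) 1, h r := by
  have hneg : ∫⁻ r in Ioo (-1 : ℝ) 0, h |r| = ∫⁻ r in Ioo (0 : ℝ) 1, h |r| := by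
    have := (Measure.measurePreserving_neg (volume : Measure ℝ)).setLIntegral_comp_preimage_emb
      (MeasurableEquiv.neg ℝ).measurableEmbedding (fun r => h |r|) (Ioo 0 1)
    simpa using this
  have hpos : ∫⁻ r in Ioo (0 : ℝ) 1, h |r| = ∫⁻ r in Ioo (0 : ℝ) 1, h r :=
    setLIntegral_congr_fun measurableSet_Ioo fun r hr => by
      simp only [abs_of_pos hr.1]
  have hunion : ∫⁻ r in Ioo (-1 : ℝ) 1, h |r| =
      ∫⁻ r in Ioo (-1 : ℝ) 0 ∪ Ioo (0 : ℝ) 1, h |r| := by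
    refine setLIntegral_congr ?_
    have : Ioo (-1 : ℝ) 1 = Ioo (-1) 0 ∪ Ico 0 1 :=
      (Ioo_union_Ico_eq_Ioo (by norm_num) (by norm_num)).symm
    rw [this]
    exact (ae_eq_refl _).union Ioo_ae_eq_Ico.symm
  rw [hunion, lintegral_union measurableSet_Ioo
    (disjoint_left.2 fun x hx hx' => lt_asymm hx.2 hx'.1), hneg, hpos, two_mul]

/-- The quadratic translation modulus controls the seminorm; the factor two accounts for shifts of
either sign. -/
theorem gagliardoSq_le_of_shift_le (s : ℝ) {f : ℝ → ℝ} (hf : Measurable f) {Ψ : ℝ → ℝ}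
    (hΨ : ∀ r : ℝ, r ≠ 0 → |r| < 1 →
      ∫⁻ x in Ioo (0 : ℝ) 1, ENNReal.ofReal (|f x - f (x + r)| ^ 2) ≤ ENNReal.ofReal (Ψ |r|)) :
    gagliardoSq s f ≤ 2 * ∫⁻ r in Ioo (0 : ℝ) 1, ENNReal.ofReal (Ψ r * r ^ (-(1 + 2 * s))) := by
  refine (gagliardoSq_le_shift s hf).trans ?_
  rw [← lintegral_Ioo_abs fun r => ENNReal.ofReal (Ψ r * r ^ (-(1 + 2 * s)))]
  refine lintegral_mono_ae ?_
  have h0 : ∀ᵐ r ∂(volume.restrict (Ioo (-1 : ℝ) 1)), r ≠ 0 :=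
    ae_restrict_of_ae (Measure.ae_ne volume 0)
  filter_upwards [h0, ae_restrict_mem measurableSet_Ioo] with r hr0 hr
  have habs : 0 < |r| := abs_pos.2 hr0
  have e : ∀ x, ENNReal.ofReal (|f x - f (x + r)| ^ 2 / |r| ^ (1 + 2 * s)) =
      ENNReal.ofReal (|r| ^ (-(1 + 2 * s))) * ENNReal.ofReal (|f x - f (x + r)| ^ 2) := fun x => by
    rw [← ENNReal.ofReal_mul (by positivity), Real.rpow_neg habs.le, div_eq_mul_inv, mul_comm]
  simp_rw [e]
  rw [lintegral_const_mul _ (by fun_prop), mul_comm (Ψ |r|), ENNReal.ofReal_mul (by positivity)]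
  gcongr
  exact hΨ r hr0 (abs_lt.2 hr)

/-- The Lipschitz transition from `-1` to `1` on `(t - δ, t + δ)`. -/
def ramp (δ t x : ℝ) : ℝ := max (-1) (min 1 ((x - t) / δ))

theorem continuous_ramp (δ t : ℝ) : Continuous (ramp δ t) := by unfold ramp; fun_prop

theorem abs_ramp_le (δ t x : ℝ) : |ramp δ t x| ≤ 1 :=
  abs_le.2 ⟨le_max_left _ _, max_le (by norm_num) (min_le_left _ _)⟩

theorem abs_ramp_sub_le {δ : ℝ} (hδ : 0 < δ) (t x y : ℝ) :
    |ramp δ t x - ramp δ t y| ≤ |x - y| / δ := by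
  unfold ramp
  calc _ ≤ |min 1 ((x - t) / δ) - min 1 ((y - t) / δ)| := by
        simpa using abs_max_sub_max_le_max (-1) (min 1 ((x - t) / δ)) (-1) (min 1 ((y - t) / δ))
    _ ≤ |(x - t) / δ - (y - t) / δ| := by
        simpa using abs_min_sub_min_le_max 1 ((x - t) / δ) 1 ((y - t) / δ)
    _ = |x - y| / δ := by
        rw [← sub_div, abs_div, abs_of_pos hδ]; congr 2; ring

theorem ramp_of_ge {δ t x : ℝ} (hδ : 0 < δ) (h : t + δ ≤ x) : ramp δ t x = 1 := by
  have : 1 ≤ (x - t) / δ := by rw [le_div_iff₀ hδ]; linarith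
  rw [ramp, min_eq_left this, max_eq_right (by norm_num)]

theorem ramp_of_le {δ t x : ℝ} (hδ : 0 < δ) (h : x ≤ t - δ) : ramp δ t x = -1 := by
  have : (x - t) / δ ≤ -1 := by rw [div_le_iff₀ hδ]; linarith
  rw [ramp, min_eq_right (this.trans (by norm_num)), max_eq_left this]

theorem ramp_eq_stepAt {δ t x : ℝ} (hδ : 0 < δ) (h : x ∉ Ioo (t - δ) (t + δ)) :
    ramp δ t x = stepAt t x := by
  rw [mem_Ioo, not_and_or, not_lt, not_lt] at h
  rcases h with h | h
  · rw [ramp_of_le hδ h, stepAt, if_pos (by linarith)]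
  · rw [ramp_of_ge hδ h, stepAt, if_neg (by linarith)]

theorem ramp_ne {δ t x y : ℝ} (hδ : 0 < δ) (h : ramp δ t x ≠ ramp δ t y) :
    t - δ < max x y ∧ min x y < t + δ := by
  constructor
  · by_contra hc
    exact h (by rw [ramp_of_le hδ ((le_max_left _ _).trans (not_lt.1 hc)),
      ramp_of_le hδ ((le_max_right _ _).trans (not_lt.1 hc))])
  · by_contra hc
    exact h (by rw [ramp_of_ge hδ ((not_lt.1 hc).trans (min_le_left _ _)),
      ramp_of_ge hδ ((not_lt.1 hc).trans (min_le_right _ _))])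

/-- A ramp and its translate can differ only on an interval of length $2\delta+|r|$. For short
shifts $M=|r|/\delta$ will be used, for long ones $M=2$. -/
theorem lintegral_ramp_shift_le {δ M r : ℝ} (hδ : 0 < δ) (t : ℝ)
    (h : ∀ x, |ramp δ t x - ramp δ t (x + r)| ≤ M) (S : Set ℝ) :
    ∫⁻ x in S, ENNReal.ofReal (|ramp δ t x - ramp δ t (x + r)| ^ 2) ≤
      ENNReal.ofReal (M ^ 2 * (2 * δ + |r|)) := by
  refine (setLIntegral_le_lintegral _ _).trans ?_
  set J := Ioo (t - δ - max r 0) (t + δ - min r 0)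
  calc ∫⁻ x, ENNReal.ofReal (|ramp δ t x - ramp δ t (x + r)| ^ 2)
      ≤ ∫⁻ x, J.indicator (fun _ => ENNReal.ofReal (M ^ 2)) x := by
        refine lintegral_mono fun x => ?_
        by_cases hx : x ∈ J
        · rw [indicator_of_mem hx]
          have := h x
          gcongr
        · rw [indicator_of_notMem hx]
          have : ramp δ t x = ramp δ t (x + r) := by
            by_contra hne
            obtain ⟨h1, h2⟩ := ramp_ne hδ hne
            apply hx
            have e1 : max x (x + r) = x + max r 0 := by
              rw [max_comm r 0, ← max_add_add_left]; simp
            have e2 : min x (x + r) = x + min r 0 := by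
              rw [min_comm r 0, ← min_add_add_left]; simp
            rw [e1] at h1
            rw [e2] at h2
            exact ⟨by linarith, by linarith⟩
          rw [this, sub_self, abs_zero]
          simp
    _ = ENNReal.ofReal (M ^ 2) * volume J := lintegral_indicator_const measurableSet_Ioo _
    _ = _ := by
        rw [Real.volume_Ioo, ← ENNReal.ofReal_mul (by positivity)]
        congr 2
        rcases le_total r 0 with hr | hr
        · rw [max_eq_right hr, min_eq_left hr, abs_of_nonpos hr]; ring
        · rw [max_eq_left hr, min_eq_right hr, abs_of_nonneg hr]; ring

/-- The regularisation at scale `δ` of a product of steps. -/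
def recovery (σ : ℝ) (T : Finset ℝ) (δ x : ℝ) : ℝ := σ * ∏ t ∈ T, ramp δ t x

section Recovery

variable {σ : ℝ} {T : Finset ℝ} {δ : ℝ}

theorem continuous_recovery (σ : ℝ) (T : Finset ℝ) (δ : ℝ) : Continuous (recovery σ T δ) :=
  continuous_const.mul (continuous_finsetProd _ fun t _ => continuous_ramp δ t)

theorem abs_prod_le_one {ι : Type*} (T : Finset ι) {f : ι → ℝ} (h : ∀ i ∈ T, |f i| ≤ 1) :
    |∏ i ∈ T, f i| ≤ 1 := by
  rw [Finset.abs_prod]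
  exact Finset.prod_le_one (fun i _ => abs_nonneg _) h

theorem abs_recovery_le (hσ : |σ| ≤ 1) (x : ℝ) : |recovery σ T δ x| ≤ 1 := by
  rw [recovery, abs_mul]
  exact mul_le_one₀ hσ (abs_nonneg _) (abs_prod_le_one T fun t _ => abs_ramp_le δ t x)

theorem abs_prod_sub_prod_le {ι : Type*} (T : Finset ι) (f g : ι → ℝ)
    (hf : ∀ i, |f i| ≤ 1) (hg : ∀ i, |g i| ≤ 1) :
    |∏ i ∈ T, f i - ∏ i ∈ T, g i| ≤ ∑ i ∈ T, |f i - g i| := by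
  classical
  induction T using Finset.induction_on with
  | empty => simp
  | insert t T ht ih =>
    rw [Finset.prod_insert ht, Finset.prod_insert ht, Finset.sum_insert ht]
    have e : f t * ∏ i ∈ T, f i - g t * ∏ i ∈ T, g i =
        (f t - g t) * ∏ i ∈ T, f i + g t * (∏ i ∈ T, f i - ∏ i ∈ T, g i) := by ring
    rw [e]
    refine (abs_add_le _ _).trans ?_
    rw [abs_mul, abs_mul]
    have h1 := mul_le_mul_of_nonneg_left (abs_prod_le_one T fun i _ => hf i) (abs_nonneg (f t - g t))
    have h2 := mul_le_mul_of_nonneg_right (hg t) (abs_nonneg (∏ i ∈ T, f i - ∏ i ∈ T, g i))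
    linarith

theorem abs_recovery_sub_le (hσ : |σ| ≤ 1) (hδ : 0 < δ) (x y : ℝ) :
    |recovery σ T δ x - recovery σ T δ y| ≤ T.card / δ * |x - y| := by
  rw [recovery, recovery, ← mul_sub, abs_mul]
  calc |σ| * |∏ t ∈ T, ramp δ t x - ∏ t ∈ T, ramp δ t y|
      ≤ 1 * ∑ t ∈ T, |ramp δ t x - ramp δ t y| := by
        gcongr
        exact abs_prod_sub_prod_le T _ _ (fun t => abs_ramp_le δ t x) fun t => abs_ramp_le δ t y
    _ ≤ 1 * ∑ t ∈ T, |x - y| / δ := by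
        gcongr with t _; exact abs_ramp_sub_le hδ t x y
    _ = _ := by rw [Finset.sum_const, nsmul_eq_mul]; ring

/-- The function is Lipschitz, and $r^2r^{-1-2s}$ is integrable at $0$ because $s<1$. -/
theorem memHs_recovery (hσ : |σ| ≤ 1) (hδ : 0 < δ) {s : ℝ} (hs : s < 1) :
    MemHs s (recovery σ T δ) := by
  have hm := (continuous_recovery σ T δ).measurable
  refine ⟨MemLp.of_bound hm.aestronglyMeasurable 1 (ae_of_all _ fun x => abs_recovery_le hσ x), ?_⟩
  have h := gagliardoSq_le_of_shift_le s hm (Ψ := fun r => (T.card / δ) ^ 2 * r ^ 2) fun r _ _ => by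
    calc ∫⁻ x in Ioo (0 : ℝ) 1,
          ENNReal.ofReal (|recovery σ T δ x - recovery σ T δ (x + r)| ^ 2)
        ≤ ∫⁻ x in Ioo (0 : ℝ) 1, ENNReal.ofReal ((T.card / δ) ^ 2 * |r| ^ 2) := by
          refine lintegral_mono fun x => ?_
          have := abs_recovery_sub_le (T := T) hσ hδ x (x + r)
          rw [sub_add_cancel_left, abs_neg] at this
          rw [← mul_pow]
          gcongr
      _ = _ := by simp
  refine h.trans_lt (ENNReal.mul_lt_top (by norm_num) ?_)
  have hint : IntegrableOn (fun r : ℝ => (T.card / δ) ^ 2 * r ^ (1 - 2 * s)) (Ioo 0 1) :=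
    (((intervalIntegral.intervalIntegrable_rpow' (a := 0) (b := 1)
      (show -1 < 1 - 2 * s by linarith)).1).mono_set Ioo_subset_Ioc_self).const_mul _
  refine lt_of_eq_of_lt ?_ hint.lintegral_lt_top
  refine setLIntegral_congr_fun measurableSet_Ioo fun r hr => ?_
  congr 1
  rw [mul_assoc]
  congr 1
  rw [← Real.rpow_natCast r 2, ← Real.rpow_add hr.1]
  congr 1
  push_cast
  ring

theorem exists_separation (T : Finset ℝ) :
    ∃ a : ℝ, 0 < a ∧ a < 1 ∧ ∀ t ∈ T, ∀ t' ∈ T, t ≠ t' → 4 * a ≤ |t - t'| := by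
  have h : ∀ᶠ a in 𝓝[>] (0 : ℝ), ∀ t ∈ T, ∀ t' ∈ T, t ≠ t' → 4 * a ≤ |t - t'| := by
    rw [eventually_all_finset]
    intro t _
    rw [eventually_all_finset]
    intro t' _
    by_cases htt : t = t'
    · exact Eventually.of_forall fun a h => absurd htt h
    · have : 0 < |t - t'| / 4 := by have := abs_pos.2 (sub_ne_zero.2 htt); positivity
      filter_upwards [Ioo_mem_nhdsGT this] with a ha _
      linarith [ha.2]
  obtain ⟨a, h1, h2⟩ := (h.and eventually_small).exists
  exact ⟨a, h2.1, h2.2, h1⟩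

/-- A ramp that changes between $x$ and $y$ is centred within $2a$ of $x$, and the separation $4a$
allows only one such centre. The other factors agree at $x$ and $y$ and have modulus at most $1$. -/
theorem recovery_sub_sq_le (hσ : |σ| ≤ 1) (hδ : 0 < δ) {a : ℝ} (hδa : δ ≤ a)
    (hsep : ∀ t ∈ T, ∀ t' ∈ T, t ≠ t' → 4 * a ≤ |t - t'|) {x y : ℝ} (hxy : |x - y| < a) :
    |recovery σ T δ x - recovery σ T δ y| ^ 2 ≤ ∑ t ∈ T, |ramp δ t x - ramp δ t y| ^ 2 := by
  by_cases h : ∃ t ∈ T, ramp δ t x ≠ ramp δ t y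
  · obtain ⟨t, ht, hne⟩ := h
    have hnear : ∀ t' ∈ T, ramp δ t' x ≠ ramp δ t' y → |t' - x| < 2 * a := by
      intro t' _ hne'
      obtain ⟨h1, h2⟩ := ramp_ne hδ hne'
      rw [abs_lt] at hxy
      rw [abs_lt]
      have h3 : max x y < x + a := max_lt (by linarith) (by linarith)
      have h4 : x - a < min x y := lt_min (by linarith) (by linarith)
      constructor <;> linarith
    have heq : ∀ t' ∈ T.erase t, ramp δ t' x = ramp δ t' y := by
      intro t' ht'
      by_contra hne'
      have h1 := hnear t ht hne
      have h2 := hnear t' (Finset.mem_of_mem_erase ht') hne'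
      have h3 := hsep t ht t' (Finset.mem_of_mem_erase ht') (Finset.ne_of_mem_erase ht').symm
      have h4 : |t - t'| ≤ |t - x| + |t' - x| := by
        have := abs_sub_le t x t'
        rwa [abs_sub_comm x t'] at this
      linarith
    have e : recovery σ T δ x - recovery σ T δ y =
        σ * (∏ t' ∈ T.erase t, ramp δ t' y) * (ramp δ t x - ramp δ t y) := by
      rw [recovery, recovery, ← Finset.mul_prod_erase T _ ht, ← Finset.mul_prod_erase T _ ht,
        Finset.prod_congr rfl heq]
      ring
    have hle : |recovery σ T δ x - recovery σ T δ y| ≤ |ramp δ t x - ramp δ t y| := by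
      rw [e, abs_mul, abs_mul]
      refine mul_le_of_le_one_left (abs_nonneg _) ?_
      exact mul_le_one₀ hσ (abs_nonneg _) (abs_prod_le_one _ fun t _ => abs_ramp_le δ t y)
    calc |recovery σ T δ x - recovery σ T δ y| ^ 2 ≤ |ramp δ t x - ramp δ t y| ^ 2 := by gcongr
      _ ≤ _ := Finset.single_le_sum (f := fun t => |ramp δ t x - ramp δ t y| ^ 2)
          (fun t _ => by positivity) ht
  · push Not at h
    have e : recovery σ T δ x = recovery σ T δ y := by
      rw [recovery, recovery, Finset.prod_congr rfl h]
    rw [e, sub_self, abs_zero]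
    simp only [ne_eq, OfNat.ofNat_ne_zero, not_false_eq_true, zero_pow]
    positivity

theorem lintegral_recovery_shift_le (hσ : |σ| ≤ 1) (hδ : 0 < δ) {a : ℝ} (hδa : δ ≤ a)
    (hsep : ∀ t ∈ T, ∀ t' ∈ T, t ≠ t' → 4 * a ≤ |t - t'|) {r M : ℝ} (hr : |r| < a)
    (h : ∀ t x, |ramp δ t x - ramp δ t (x + r)| ≤ M) (S : Set ℝ) :
    ∫⁻ x in S, ENNReal.ofReal (|recovery σ T δ x - recovery σ T δ (x + r)| ^ 2) ≤
      ENNReal.ofReal (T.card * (M ^ 2 * (2 * δ + |r|))) := by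
  calc ∫⁻ x in S, ENNReal.ofReal (|recovery σ T δ x - recovery σ T δ (x + r)| ^ 2)
      ≤ ∫⁻ x in S, ∑ t ∈ T, ENNReal.ofReal (|ramp δ t x - ramp δ t (x + r)| ^ 2) := by
        refine lintegral_mono fun x => ?_
        rw [← ENNReal.ofReal_sum_of_nonneg fun t _ => by positivity]
        refine ENNReal.ofReal_le_ofReal (recovery_sub_sq_le hσ hδ hδa hsep ?_)
        rwa [sub_add_cancel_left, abs_neg]
    _ = ∑ t ∈ T, ∫⁻ x in S, ENNReal.ofReal (|ramp δ t x - ramp δ t (x + r)| ^ 2) :=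
        lintegral_finsetSum _ fun t _ => by
          have := (continuous_ramp δ t).measurable
          fun_prop
    _ ≤ ∑ t ∈ T, ENNReal.ofReal (M ^ 2 * (2 * δ + |r|)) :=
        Finset.sum_le_sum fun t _ => lintegral_ramp_shift_le hδ t (h t) S
    _ = _ := by
        rw [Finset.sum_const, nsmul_eq_mul, ENNReal.ofReal_mul T.card.cast_nonneg,
          ENNReal.ofReal_natCast]

theorem gagliardoSq_recovery_le (hσ : |σ| ≤ 1) (hδ : 0 < δ) {a s : ℝ} (ha1 : a < 1)
    (hδa : 2 * δ < a) (hs1 : 1 / 4 ≤ s) (hs2 : s ≤ 3 / 4)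
    (hsep : ∀ t ∈ T, ∀ t' ∈ T, t ≠ t' → 4 * a ≤ |t - t'|) :
    gagliardoSq s (recovery σ T δ) ≤ ENNReal.ofReal
      (8 * T.card * (∫ r in δ..1, r ^ (-(2 * s))) + (8 * (a ^ 3)⁻¹ +
        100 * T.card * δ ^ (1 - 2 * s))) := by
  set N := (T.card : ℝ)
  have hN : 0 ≤ N := Nat.cast_nonneg _
  have ha : 0 < a := by linarith
  have hm := (continuous_recovery σ T δ).measurable
  -- Up to $2\delta$ the Lipschitz bound applies, with $2\delta+r\le4\delta$. Up to $a$ the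
  -- oscillation $2$ on length $2\delta+r$ gives the main term $4Nr$, which the two signs of the
  -- shift double to $8Nr$. Beyond $a$ the jumps are no longer separated and the crude bound $4$
  -- suffices.
  set Ψ : ℝ → ℝ := fun r => if r ≤ 2 * δ then 4 * N / δ * r ^ 2 else
    N * (4 * (2 * δ + r)) + if a ≤ r then 4 else 0 with hΨ
  have h := gagliardoSq_le_of_shift_le s hm (Ψ := Ψ) fun r hr0 hr1 => by
    by_cases hr2 : |r| ≤ 2 * δ
    · refine (lintegral_recovery_shift_le hσ hδ (by linarith) hsep (by linarith)
        (M := |r| / δ) (fun t x => ?_) _).trans ?_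
      · simpa using abs_ramp_sub_le hδ t x (x + r)
      · simp only [hΨ, if_pos hr2]
        apply ENNReal.ofReal_le_ofReal
        calc N * ((|r| / δ) ^ 2 * (2 * δ + |r|)) ≤ N * ((|r| / δ) ^ 2 * (4 * δ)) := by
              gcongr; linarith
          _ = 4 * N / δ * |r| ^ 2 := by field_simp
    · simp only [hΨ, if_neg hr2]
      by_cases hr3 : a ≤ |r|
      · rw [if_pos hr3]
        calc ∫⁻ x in Ioo (0 : ℝ) 1,
              ENNReal.ofReal (|recovery σ T δ x - recovery σ T δ (x + r)| ^ 2)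
            ≤ ∫⁻ x in Ioo (0 : ℝ) 1, ENNReal.ofReal 4 := by
              refine lintegral_mono fun x => ENNReal.ofReal_le_ofReal ?_
              have h1 := abs_recovery_le (T := T) (δ := δ) hσ x
              have h2 := abs_recovery_le (T := T) (δ := δ) hσ (x + r)
              have h3 := abs_sub (recovery σ T δ x) (recovery σ T δ (x + r))
              calc _ ≤ (2 : ℝ) ^ 2 := by gcongr; linarith
                _ = 4 := by norm_num
          _ = ENNReal.ofReal 4 := by simp
          _ ≤ _ := by
              apply ENNReal.ofReal_le_ofReal
              have : 0 ≤ N * (4 * (2 * δ + |r|)) := by positivity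
              linarith
      · rw [if_neg hr3, add_zero]
        refine (lintegral_recovery_shift_le hσ hδ (by linarith) hsep (not_le.1 hr3)
          (M := 2) (fun t x => ?_) _).trans ?_
        · have h1 := abs_ramp_le δ t x
          have h2 := abs_ramp_le δ t (x + r)
          have h3 := abs_sub (ramp δ t x) (ramp δ t (x + r))
          linarith
        · apply ENNReal.ofReal_le_ofReal
          apply le_of_eq
          norm_num
          exact Or.inl rfl
  refine h.trans ?_
  have hδ2 : 0 < 2 * δ := by linarith
  have hsplit : Ioo (0 : ℝ) 1 = Ioc 0 (2 * δ) ∪ Ioo (2 * δ) 1 :=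
    (Ioc_union_Ioo_eq_Ioo hδ2.le (by linarith)).symm
  have i0 : IntervalIntegrable (fun r : ℝ => 4 * N / δ * r ^ (1 - 2 * s)) volume 0 (2 * δ) :=
    (intervalIntegral.intervalIntegrable_rpow' (by linarith)).const_mul _
  have j1 := intervalIntegrable_rpow_of_pos (p := -(2 * s)) hδ2 one_pos
  have j2 := intervalIntegrable_rpow_of_pos (p := -(1 + 2 * s)) hδ2 one_pos
  have i1 : IntervalIntegrable (fun r : ℝ => 4 * N * r ^ (-(2 * s)) +
      4 * N * (2 * δ) * r ^ (-(1 + 2 * s)) + 4 * (a ^ 3)⁻¹) volume (2 * δ) 1 :=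
    ((j1.const_mul _).add (j2.const_mul _)).add intervalIntegrable_const
  have p1 : ∫⁻ r in Ioc 0 (2 * δ), ENNReal.ofReal (Ψ r * r ^ (-(1 + 2 * s))) =
      ENNReal.ofReal (∫ r in (0 : ℝ)..2 * δ, 4 * N / δ * r ^ (1 - 2 * s)) := by
    rw [intervalIntegral.integral_of_le hδ2.le, ofReal_integral_eq_lintegral_ofReal
      ((intervalIntegrable_iff_integrableOn_Ioc_of_le hδ2.le).1 i0)]
    · refine setLIntegral_congr_fun measurableSet_Ioc fun r hr => ?_
      simp only [hΨ, if_pos hr.2]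
      congr 1
      rw [mul_assoc]
      congr 1
      rw [← Real.rpow_natCast r 2, ← Real.rpow_add hr.1]
      congr 1
      push_cast
      ring
    · refine (ae_restrict_mem measurableSet_Ioc).mono fun r hr => ?_
      have := hr.1
      simp only [Pi.zero_apply]
      positivity
  have p2 : ∫⁻ r in Ioo (2 * δ) 1, ENNReal.ofReal (Ψ r * r ^ (-(1 + 2 * s))) ≤
      ENNReal.ofReal (∫ r in 2 * δ..1, (4 * N * r ^ (-(2 * s)) +
      4 * N * (2 * δ) * r ^ (-(1 + 2 * s)) + 4 * (a ^ 3)⁻¹)) := by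
    rw [intervalIntegral.integral_of_le (by linarith), ofReal_integral_eq_lintegral_ofReal
      ((intervalIntegrable_iff_integrableOn_Ioc_of_le (by linarith)).1 i1)]
    · refine le_trans ?_ (lintegral_mono_set Ioo_subset_Ioc_self)
      refine setLIntegral_mono' measurableSet_Ioo fun r hr => ENNReal.ofReal_le_ofReal ?_
      have hr0 : 0 < r := hδ2.trans hr.1
      simp only [hΨ, if_neg (not_le.2 hr.1)]
      have e1 : r * r ^ (-(1 + 2 * s)) = r ^ (-(2 * s)) := by
        nth_rewrite 1 [← Real.rpow_one r]
        rw [← Real.rpow_add hr0]; congr 1; ring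
      have e2 : (if a ≤ r then (4 : ℝ) else 0) * r ^ (-(1 + 2 * s)) ≤ 4 * (a ^ 3)⁻¹ := by
        split_ifs with har
        · have h1 : r ^ (-(1 + 2 * s)) ≤ a ^ (-(1 + 2 * s)) :=
            Real.rpow_le_rpow_of_nonpos ha har (by linarith)
          have h2 : a ^ (-(1 + 2 * s)) ≤ a ^ (-3 : ℝ) :=
            Real.rpow_le_rpow_of_exponent_ge ha ha1.le (by linarith)
          have h3 : a ^ (-3 : ℝ) = (a ^ 3)⁻¹ := by rw [Real.rpow_neg ha.le]; norm_num
          linarith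
        · rw [zero_mul]; positivity
      rw [add_mul]
      have e3 : N * (4 * (2 * δ + r)) * r ^ (-(1 + 2 * s)) =
          4 * N * r ^ (-(2 * s)) + 4 * N * (2 * δ) * r ^ (-(1 + 2 * s)) := by
        rw [← e1]; ring
      linarith
    · refine (ae_restrict_mem measurableSet_Ioc).mono fun r hr => ?_
      have : 0 < r := hδ2.trans hr.1
      simp only [Pi.zero_apply]
      positivity
  rw [hsplit, lintegral_union measurableSet_Ioo
    (disjoint_left.2 fun x hx hx' => not_lt.2 hx.2 hx'.1), p1]
  have q1 : (∫ r in (0 : ℝ)..2 * δ, 4 * N / δ * r ^ (1 - 2 * s)) ≤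
      32 * N * δ ^ (1 - 2 * s) := by
    rw [intervalIntegral.integral_const_mul, integral_rpow (Or.inl (by linarith))]
    have e1 : (2 * δ) ^ (1 - 2 * s + 1) ≤ 4 * (δ * δ ^ (1 - 2 * s)) := by
      rw [Real.mul_rpow two_pos.le hδ.le]
      have : (2 : ℝ) ^ (1 - 2 * s + 1) ≤ 2 ^ (2 : ℝ) :=
        Real.rpow_le_rpow_of_exponent_le (by norm_num) (by linarith)
      have h4 : (2 : ℝ) ^ (2 : ℝ) = 4 := by norm_num
      have e3 : δ ^ (1 - 2 * s + 1) = δ * δ ^ (1 - 2 * s) := by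
        rw [Real.rpow_add hδ, Real.rpow_one, mul_comm]
      rw [e3]
      gcongr
      linarith
    have e2 : (0 : ℝ) ^ (1 - 2 * s + 1) = 0 := Real.zero_rpow (by linarith)
    rw [e2, sub_zero]
    calc 4 * N / δ * ((2 * δ) ^ (1 - 2 * s + 1) / (1 - 2 * s + 1))
        ≤ 4 * N / δ * (4 * (δ * δ ^ (1 - 2 * s)) / (1 / 2)) := by
          gcongr
          linarith
      _ = 32 * N * δ ^ (1 - 2 * s) := by field_simp; ring
  have q2 : (∫ r in 2 * δ..1, (4 * N * r ^ (-(2 * s)) +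
      4 * N * (2 * δ) * r ^ (-(1 + 2 * s)) + 4 * (a ^ 3)⁻¹)) ≤
      4 * N * (∫ r in δ..1, r ^ (-(2 * s))) + 16 * N * δ ^ (1 - 2 * s) + 4 * (a ^ 3)⁻¹ := by
    rw [intervalIntegral.integral_add ((j1.const_mul _).add (j2.const_mul _))
      intervalIntegrable_const, intervalIntegral.integral_add (j1.const_mul _) (j2.const_mul _),
      intervalIntegral.integral_const_mul, intervalIntegral.integral_const_mul,
      intervalIntegral.integral_const]
    have k1 : (∫ r in 2 * δ..1, r ^ (-(2 * s))) ≤ ∫ r in δ..1, r ^ (-(2 * s)) := by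
      rw [← intervalIntegral.integral_add_adjacent_intervals
        (intervalIntegrable_rpow_of_pos hδ hδ2) j1]
      have : 0 ≤ ∫ r in δ..2 * δ, r ^ (-(2 * s)) :=
        intervalIntegral.integral_nonneg (by linarith) fun r hr =>
          Real.rpow_nonneg (by linarith [hr.1]) _
      linarith
    have k2 := mul_integral_kernel_le (show 0 < s by linarith) hδ2 one_pos
    have k3 : (2 * δ) ^ (1 - 2 * s) / (2 * s) ≤ 4 * δ ^ (1 - 2 * s) := by
      rw [div_le_iff₀ (by linarith), Real.mul_rpow two_pos.le hδ.le]
      have : (2 : ℝ) ^ (1 - 2 * s) ≤ 2 ^ (1 : ℝ) :=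
        Real.rpow_le_rpow_of_exponent_le (by norm_num) (by linarith)
      rw [Real.rpow_one] at this
      have hp : 0 < δ ^ (1 - 2 * s) := by positivity
      calc (2 : ℝ) ^ (1 - 2 * s) * δ ^ (1 - 2 * s) ≤ 2 * δ ^ (1 - 2 * s) := by gcongr
        _ ≤ 4 * δ ^ (1 - 2 * s) * (2 * s) := by nlinarith
    have k4 : (1 - 2 * δ) • (4 * (a ^ 3)⁻¹) ≤ 4 * (a ^ 3)⁻¹ := by
      rw [smul_eq_mul]
      refine mul_le_of_le_one_left (by positivity) (by linarith)
    have k5 : 4 * N * (2 * δ) * (∫ r in 2 * δ..1, r ^ (-(1 + 2 * s))) ≤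
        16 * N * δ ^ (1 - 2 * s) := by
      calc 4 * N * (2 * δ) * (∫ r in 2 * δ..1, r ^ (-(1 + 2 * s)))
          = 4 * N * (2 * δ * ∫ r in 2 * δ..1, r ^ (-(1 + 2 * s))) := by ring
        _ ≤ 4 * N * (4 * δ ^ (1 - 2 * s)) :=
          mul_le_mul_of_nonneg_left (k2.trans k3) (by positivity)
        _ = _ := by ring
    have k6 : 4 * N * (∫ r in 2 * δ..1, r ^ (-(2 * s))) ≤
        4 * N * (∫ r in δ..1, r ^ (-(2 * s))) := by gcongr
    linarith
  have hI : 0 ≤ ∫ r in δ..1, r ^ (-(2 * s)) :=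
    intervalIntegral.integral_nonneg (by linarith) fun r hr =>
      Real.rpow_nonneg (by linarith [hr.1]) _
  calc _ ≤ 2 * (ENNReal.ofReal (32 * N * δ ^ (1 - 2 * s)) + ENNReal.ofReal
        (4 * N * (∫ r in δ..1, r ^ (-(2 * s))) + 16 * N * δ ^ (1 - 2 * s) + 4 * (a ^ 3)⁻¹)) := by
        gcongr
        exact p2.trans (ENNReal.ofReal_le_ofReal q2)
    _ = ENNReal.ofReal (2 * (32 * N * δ ^ (1 - 2 * s) +
        (4 * N * (∫ r in δ..1, r ^ (-(2 * s))) + 16 * N * δ ^ (1 - 2 * s) + 4 * (a ^ 3)⁻¹))) := by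
        rw [← ENNReal.ofReal_add (by positivity) (by positivity), ENNReal.ofReal_mul two_pos.le,
          ENNReal.ofReal_ofNat]
    _ ≤ _ := by
        apply ENNReal.ofReal_le_ofReal
        -- The layer terms add up to $2(32+16)=96\le100$.
        have : 0 ≤ N * δ ^ (1 - 2 * s) := by positivity
        linarith

/-- The set where the regularisation differs from the product of steps. -/
def layerSet (T : Finset ℝ) (δ : ℝ) : Set ℝ := ⋃ t ∈ T, Ioo (t - δ) (t + δ)

theorem measurableSet_layerSet (T : Finset ℝ) (δ : ℝ) : MeasurableSet (layerSet T δ) :=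
  T.measurableSet_biUnion fun _ _ => measurableSet_Ioo

theorem volume_layerSet_le (T : Finset ℝ) (δ : ℝ) :
    volume (layerSet T δ) ≤ T.card * ENNReal.ofReal (2 * δ) := by
  refine (measure_biUnion_finset_le T _).trans ?_
  simp only [Real.volume_Ioo]
  rw [Finset.sum_congr rfl fun t _ => show ENNReal.ofReal (t + δ - (t - δ)) =
    ENNReal.ofReal (2 * δ) by congr 1; ring, Finset.sum_const, nsmul_eq_mul]

theorem recovery_eq_of_notMem (hδ : 0 < δ) {x : ℝ} (hx : x ∉ layerSet T δ) :
    recovery σ T δ x = σ * ∏ t ∈ T, stepAt t x := by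
  rw [recovery]
  congr 1
  refine Finset.prod_congr rfl fun t ht => ramp_eq_stepAt hδ fun h => hx ?_
  exact mem_biUnion (Finset.mem_coe.2 ht) h

theorem lintegral_potential_recovery_le {W : ℝ → ℝ} (hW : IsDoubleWell W) (hσ : σ = 1 ∨ σ = -1)
    (hδ : 0 < δ) {M : ℝ} (hM : ∀ z, |z| ≤ 1 → W z ≤ M) :
    ∫⁻ x in Ioo (0 : ℝ) 1, ENNReal.ofReal (W (recovery σ T δ x)) ≤
      ENNReal.ofReal (M * (T.card * (2 * δ))) := by
  have hM0 : 0 ≤ M := (hW.nonneg 0).trans (hM 0 (by simp))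
  refine (setLIntegral_le_lintegral _ _).trans ?_
  calc ∫⁻ x, ENNReal.ofReal (W (recovery σ T δ x))
      ≤ ∫⁻ x, (layerSet T δ).indicator (fun _ => ENNReal.ofReal M) x := by
        refine lintegral_mono fun x => ?_
        by_cases hx : x ∈ layerSet T δ
        · rw [indicator_of_mem hx]
          exact ENNReal.ofReal_le_ofReal (hM _ (abs_recovery_le (abs_le_one_of_eq_or hσ) x))
        · rw [indicator_of_notMem hx, recovery_eq_of_notMem hδ hx, (hW.eq_zero_iff _).2]
          · simp
          · rcases hσ with rfl | rfl <;>
              rcases prod_eq_one_or T (fun t => stepAt t x) (fun t _ => stepAt_eq_or t x) with h | h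
              <;> simp [h]
    _ = ENNReal.ofReal M * volume (layerSet T δ) :=
        lintegral_indicator_const (measurableSet_layerSet T δ) _
    _ ≤ ENNReal.ofReal M * (T.card * ENNReal.ofReal (2 * δ)) := by
        gcongr; exact volume_layerSet_le T δ
    _ = _ := by
        rw [ENNReal.ofReal_mul hM0, ENNReal.ofReal_mul T.card.cast_nonneg, ENNReal.ofReal_natCast]

theorem eLpNorm_recovery_sub_le (hσ : σ = 1 ∨ σ = -1) (hδ : 0 < δ) :
    eLpNorm (fun x => recovery σ T δ x - σ * ∏ t ∈ T, stepAt t x) 2 unitVol ≤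
      2 * (T.card * ENNReal.ofReal (2 * δ)) ^ (1 / 2 : ℝ) := by
  have h1 : eLpNorm (fun x => recovery σ T δ x - σ * ∏ t ∈ T, stepAt t x) 2 unitVol ≤
      eLpNorm ((layerSet T δ).indicator fun _ => (2 : ℝ)) 2 unitVol := by
    refine eLpNorm_mono fun x => ?_
    by_cases hx : x ∈ layerSet T δ
    · rw [indicator_of_mem hx, Real.norm_eq_abs, Real.norm_eq_abs, abs_two]
      have h1 := abs_recovery_le (T := T) (δ := δ) (abs_le_one_of_eq_or hσ) x
      have h2 : |σ * ∏ t ∈ T, stepAt t x| ≤ 1 := by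
        rw [abs_mul]
        exact mul_le_one₀ (abs_le_one_of_eq_or hσ) (abs_nonneg _)
          (abs_prod_le_one T fun t _ => abs_le_one_of_eq_or (stepAt_eq_or t x))
      have h3 := abs_sub (recovery σ T δ x) (σ * ∏ t ∈ T, stepAt t x)
      linarith
    · rw [indicator_of_notMem hx, recovery_eq_of_notMem hδ hx, sub_self]
  refine h1.trans ?_
  rw [eLpNorm_indicator_const (measurableSet_layerSet T δ) (by norm_num) (by norm_num)]
  have e : ‖(2 : ℝ)‖ₑ = 2 := by
    rw [Real.enorm_eq_ofReal two_pos.le, ENNReal.ofReal_ofNat]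
  rw [e, ENNReal.toReal_ofNat]
  gcongr
  exact (Measure.restrict_apply_le _ _).trans (volume_layerSet_le T δ)

end Recovery

/-- The potential cost is $O(\lambda)$ because $\delta\le\varepsilon$. The normalisation turns the
main seminorm term into exactly $8$ per jump, and the remaining terms are $O(\lambda)$ by
$L\le\lambda$ and $L\delta^{1-2s}\le\lambda$. -/
theorem exists_rescaledEnergy_recovery_le {W : ℝ → ℝ} (hW : IsDoubleWell W) {σ : ℝ}
    (hσ : σ = 1 ∨ σ = -1) (T : Finset ℝ) {s : ℝ → ℝ} (hlim : Tendsto s (𝓝[>] 0) (𝓝 (1 / 2))) :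
    ∃ K : ℝ, ∀ᶠ ε in 𝓝[>] 0,
      rescaledEnergy W ε (s ε) (recovery σ T (layerWidth ε (s ε))) ≤
        ENNReal.ofReal (8 * T.card + K * scalingFactor ε (s ε)) := by
  obtain ⟨a, ha, ha1, hsep⟩ := exists_separation T
  obtain ⟨z₀, -, hmax⟩ := (isCompact_Icc (a := (-1 : ℝ)) (b := 1)).exists_isMaxOn
    ⟨0, by constructor <;> norm_num⟩ hW.continuous.continuousOn
  set M := W z₀
  have hM : ∀ z, |z| ≤ 1 → W z ≤ M := fun z hz => hmax (abs_le.1 hz)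
  have hM0 : 0 ≤ M := hW.nonneg _
  refine ⟨2 * M * T.card + (8 * (a ^ 3)⁻¹ + 100 * T.card), ?_⟩
  filter_upwards [eventually_small, eventually_exponent_near hlim,
    Ioo_mem_nhdsGT (show 0 < a / 2 by linarith)] with ε h hs ha2
  obtain ⟨hε, hε1⟩ := h
  have hs0 : 0 < s ε := by linarith
  have hδ := layerWidth_pos (s := s ε) hε
  have hδε := layerWidth_le (s := s ε) hε hε1
  have hlp := scalingFactor_pos hε hε1 hs0
  have hLp := seminormFactor_pos hε hε1 hs0
  have h1 := lintegral_potential_recovery_le (T := T) hW hσ hδ hM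
  have h2 := gagliardoSq_recovery_le (T := T) (abs_le_one_of_eq_or hσ) hδ ha1
    (by linarith [ha2.2]) hs.1 hs.2 hsep
  have h3 := seminormFactor_mul_integral hε hε1 hs0
  have h4 := seminormFactor_mul_layerWidth_rpow_le hε hε1 hs0
  have h5 := seminormFactor_le hε hε1 hs0
  set δ := layerWidth ε (s ε)
  set l := scalingFactor ε (s ε)
  have hI : 0 ≤ ∫ r in δ..1, r ^ (-(2 * s ε)) :=
    intervalIntegral.integral_nonneg (by linarith) fun r hr =>
      Real.rpow_nonneg (by linarith [hr.1]) _
  unfold rescaledEnergy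
  refine (add_le_add (mul_le_mul_right h1 _) (mul_le_mul_right h2 _)).trans ?_
  change ENNReal.ofReal (l / ε) * _ + ENNReal.ofReal (seminormFactor ε (s ε)) * _ ≤ _
  rw [← ENNReal.ofReal_mul (by positivity), ← ENNReal.ofReal_mul hLp.le,
    ← ENNReal.ofReal_add (by positivity) (mul_nonneg hLp.le (by positivity))]
  apply ENNReal.ofReal_le_ofReal
  have e1 : l / ε * (M * (T.card * (2 * δ))) ≤ 2 * M * T.card * l := by
    have : δ / ε ≤ 1 := (div_le_one hε).2 hδε
    calc l / ε * (M * (T.card * (2 * δ))) = 2 * M * T.card * l * (δ / ε) := by ring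
      _ ≤ 2 * M * T.card * l := mul_le_of_le_one_right (by positivity) this
  have e2 : seminormFactor ε (s ε) * (8 * (a ^ 3)⁻¹) ≤ l * (8 * (a ^ 3)⁻¹) := by gcongr
  have e3 : (100 * T.card : ℝ) * (seminormFactor ε (s ε) * δ ^ (1 - 2 * s ε)) ≤
    100 * T.card * l := by gcongr
  linear_combination e1 + e2 + e3 + (8 * T.card : ℝ) * h3

/-! ### Translation estimates for the phases -/

/-- The `L¹` modulus of continuity of `f` on `(0,1)` for the translation by `R`. -/
def shiftModulus (f : ℝ → ℝ) (R : ℝ) : ℝ≥0∞ := ∫⁻ x in Ioo 0 (1 - R), ‖f x - f (x + R)‖ₑ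

theorem shiftModulus_add_le {f : ℝ → ℝ} (hf : Measurable f) {R R' : ℝ} (hR : 0 ≤ R)
    (hR' : 0 ≤ R') : shiftModulus f (R + R') ≤ shiftModulus f R + shiftModulus f R' := by
  have h2 : ∫⁻ x in Ioo 0 (1 - (R + R')), ‖f (x + R) - f (x + R + R')‖ₑ ≤ shiftModulus f R' := by
    have := (measurePreserving_add_right volume R).setLIntegral_comp_preimage_emb
      (MeasurableEquiv.addRight R).measurableEmbedding (fun x => ‖f x - f (x + R')‖ₑ)
      (Ioo R (1 - R'))
    have e : (fun x => x + R) ⁻¹' Ioo R (1 - R') = Ioo 0 (1 - (R + R')) := by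
      rw [preimage_add_const_Ioo, sub_self]; congr 1; ring
    rw [e] at this
    rw [this]
    exact lintegral_mono_set (Ioo_subset_Ioo_left hR)
  calc shiftModulus f (R + R')
      ≤ ∫⁻ x in Ioo 0 (1 - (R + R')), (‖f x - f (x + R)‖ₑ + ‖f (x + R) - f (x + R + R')‖ₑ) := by
        refine lintegral_mono fun x => ?_
        rw [← add_assoc]
        refine le_trans (le_of_eq ?_) (enorm_add_le _ _)
        congr 1
        ring
    _ = (∫⁻ x in Ioo 0 (1 - (R + R')), ‖f x - f (x + R)‖ₑ) +
          ∫⁻ x in Ioo 0 (1 - (R + R')), ‖f (x + R) - f (x + R + R')‖ₑ :=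
        lintegral_add_left (by fun_prop) _
    _ ≤ _ := add_le_add (lintegral_mono_set (Ioo_subset_Ioo_right (by linarith))) h2

/-- This transfers control from a small, unknown scale to a fixed one at linear cost. -/
theorem shiftModulus_nat_mul_le {f : ℝ → ℝ} (hf : Measurable f) {R : ℝ} (hR : 0 ≤ R) (n : ℕ) :
    shiftModulus f (n * R) ≤ n * shiftModulus f R := by
  induction n with
  | zero => simp [shiftModulus]
  | succ n ih =>
    push_cast
    rw [add_mul, one_mul, add_mul, one_mul]
    exact (shiftModulus_add_le hf (by positivity) hR).trans (by gcongr)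

theorem lintegral_Ioc_mul {N : ℝ} (hN : 0 < N) (a b : ℝ) (F : ℝ → ℝ≥0∞) :
    ∫⁻ R in Ioc (N * a) (N * b), F R = ENNReal.ofReal N * ∫⁻ r in Ioc a b, F (N * r) := by
  have hemb : MeasurableEmbedding (fun x : ℝ => N * x) :=
    (Homeomorph.mulLeft₀ N hN.ne').measurableEmbedding
  have h : ∀ g : ℝ → ℝ≥0∞, ∫⁻ R, g R = ENNReal.ofReal N * ∫⁻ r, g (N * r) := fun g => by
    conv_lhs => rw [← Real.smul_map_volume_mul_left hN.ne']
    rw [lintegral_smul_measure, hemb.lintegral_map, abs_of_pos hN, smul_eq_mul]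
  rw [← lintegral_indicator measurableSet_Ioc, h, ← lintegral_indicator measurableSet_Ioc]
  congr 1
  refine lintegral_congr fun r => ?_
  by_cases hr : r ∈ Ioc a b
  · rw [indicator_of_mem hr, indicator_of_mem]
    exact ⟨by have := hr.1; gcongr, by have := hr.2; gcongr⟩
  · rw [indicator_of_notMem hr, indicator_of_notMem]
    rintro ⟨h1, h2⟩
    exact hr ⟨lt_of_mul_lt_mul_left h1 hN.le, le_of_mul_le_mul_left h2 hN⟩

theorem measurable_shiftMeasure {A B : Set ℝ} (hA : MeasurableSet A) (hB : MeasurableSet B) :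
    Measurable (shiftMeasure A B) := by
  have : MeasurableSet {p : ℝ × ℝ | p.1 ∈ A ∧ p.1 + p.2 ∈ B} :=
    (measurable_fst hA).inter ((measurable_fst.add measurable_snd) hB)
  exact measurable_measure_prodMk_right this

/-- The indicator changes only along a passage between the two phases, unless $x$ or $x+R$ lies in
$Z$; the last alternative gives the factor two. -/
theorem shiftModulus_indicator_le {A B Z : Set ℝ} (hB : MeasurableSet B) {R : ℝ} (hR : 0 ≤ R)
    (hcov : Ioo (0 : ℝ) 1 ⊆ A ∪ B ∪ Z) :
    shiftModulus (B.indicator 1) R ≤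
      shiftMeasure A B R + shiftMeasure B A R + 2 * volume Z := by
  set E := {x | x ∈ Ioo 0 (1 - R) ∧ ¬ (x ∈ B ↔ x + R ∈ B)} with hE
  have hEm : MeasurableSet E := by
    refine measurableSet_Ioo.inter (MeasurableSet.compl ?_)
    exact MeasurableSet.iff hB ((measurable_add_const R) hB)
  have h1 : shiftModulus (B.indicator 1) R ≤ volume E := by
    unfold shiftModulus
    rw [← lintegral_indicator measurableSet_Ioo, ← lintegral_indicator_one hEm]
    refine lintegral_mono fun x => ?_
    by_cases hx : x ∈ Ioo 0 (1 - R)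
    · rw [indicator_of_mem hx]
      by_cases hxB : x ∈ B <;> by_cases hxR : x + R ∈ B
      · simp [hxB, hxR]
      · have : x ∈ E := ⟨hx, by tauto⟩
        simp [hxB, hxR, this]
      · have : x ∈ E := ⟨hx, by tauto⟩
        simp [hxB, hxR, this]
      · simp [hxB, hxR]
    · rw [indicator_of_notMem hx]; exact zero_le
  refine h1.trans ?_
  have hsub : E ⊆ ((A ∩ (fun x => x + R) ⁻¹' B) ∪ (B ∩ (fun x => x + R) ⁻¹' A)) ∪
      (Z ∪ (fun x => x + R) ⁻¹' Z) := by
    rintro x ⟨hx, hne⟩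
    have c1 : x ∈ A ∪ B ∪ Z := hcov ⟨hx.1, by linarith [hx.2]⟩
    have c2 : x + R ∈ A ∪ B ∪ Z := hcov ⟨by linarith [hx.1], by linarith [hx.2]⟩
    simp only [mem_union, mem_inter_iff, mem_preimage] at c1 c2 ⊢
    tauto
  refine (measure_mono hsub).trans ((measure_union_le _ _).trans (add_le_add
    (measure_union_le _ _) ((measure_union_le _ _).trans ?_)))
  rw [measure_preimage_add_right, two_mul]

/-- Among the dyadic shells there is one on which the integral is at most average. -/
theorem exists_dyadic_shell {a p : ℝ} (ha : 0 < a) (h : ℝ → ℝ≥0∞) (M : ℝ) (hM : 0 ≤ M) (K : ℕ)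
    (hsum : ∫⁻ r in Ioc (a * (1 / 2) ^ K) a, h r <
      ENNReal.ofReal (M * ∫ r in a * (1 / 2) ^ K..a, r ^ p)) :
    ∃ k < K, ∫⁻ r in Ioc (a * (1 / 2) ^ (k + 1)) (a * (1 / 2) ^ k), h r ≤
      ENNReal.ofReal (M * ∫ r in a * (1 / 2) ^ (k + 1)..a * (1 / 2) ^ k, r ^ p) := by
  by_contra hcon
  push Not at hcon
  refine not_le.2 hsum ?_
  clear hsum
  have hpow : ∀ k : ℕ, 0 < a * (1 / 2 : ℝ) ^ k := fun k => by positivity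
  have hle : ∀ k : ℕ, a * (1 / 2 : ℝ) ^ k ≤ a := fun k =>
    mul_le_of_le_one_right ha.le (pow_le_one₀ (by norm_num) (by norm_num))
  have hstep : ∀ k : ℕ, a * (1 / 2 : ℝ) ^ (k + 1) ≤ a * (1 / 2 : ℝ) ^ k := fun k => by
    rw [pow_succ]
    have := hpow k
    linarith
  have hnn : ∀ {x y : ℝ}, 0 < x → x ≤ y → 0 ≤ ∫ r in x..y, r ^ p := fun hx hxy =>
    intervalIntegral.integral_nonneg hxy fun r hr => Real.rpow_nonneg (hx.le.trans hr.1) _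
  induction K with
  | zero => simp
  | succ K ih =>
    have ih' := ih fun k hk => hcon k (hk.trans (Nat.lt_succ_self K))
    have hK := hcon K (Nat.lt_succ_self K)
    rw [← intervalIntegral.integral_add_adjacent_intervals
      (intervalIntegrable_rpow_of_pos (hpow (K + 1)) (hpow K))
      (intervalIntegrable_rpow_of_pos (hpow K) ha), mul_add,
      ENNReal.ofReal_add (mul_nonneg hM (hnn (hpow _) (hstep K)))
        (mul_nonneg hM (hnn (hpow _) (hle K))),
      ← Ioc_union_Ioc_eq_Ioc (hstep K) (hle K),
      lintegral_union measurableSet_Ioc (Ioc_disjoint_Ioc_of_le le_rfl)]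
    exact add_le_add hK.le ih'

/-- The region in `(0,1)` where `f` is near or below the lower well. -/
def lowerPhase (f : ℝ → ℝ) : Set ℝ := Ioo 0 1 ∩ {x | f x < -(1 / 2)}

/-- The region in `(0,1)` where `f` is near or above the upper well. -/
def upperPhase (f : ℝ → ℝ) : Set ℝ := Ioo 0 1 ∩ {x | 1 / 2 < f x}

/-- The region in `(0,1)` where `f` is between the wells. -/
def middlePhase (f : ℝ → ℝ) : Set ℝ := Ioo 0 1 ∩ {x | |f x| ≤ 1 / 2}

section Phases

variable {f : ℝ → ℝ}

theorem measurableSet_lowerPhase (hf : Measurable f) : MeasurableSet (lowerPhase f) :=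
  measurableSet_Ioo.inter (measurableSet_lt hf measurable_const)

theorem measurableSet_upperPhase (hf : Measurable f) : MeasurableSet (upperPhase f) :=
  measurableSet_Ioo.inter (measurableSet_lt measurable_const hf)

theorem disjoint_phases : Disjoint (lowerPhase f) (upperPhase f) := by
  refine disjoint_left.2 fun x hx hx' => ?_
  have h1 := hx.2
  have h2 := hx'.2
  simp only [mem_ofPred_eq] at h1 h2
  linarith

theorem Ioo_subset_phases : Ioo (0 : ℝ) 1 ⊆ lowerPhase f ∪ upperPhase f ∪ middlePhase f := by
  intro x hx
  by_cases h1 : f x < -(1 / 2)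
  · exact Or.inl (Or.inl ⟨hx, h1⟩)
  by_cases h2 : 1 / 2 < f x
  · exact Or.inl (Or.inr ⟨hx, h2⟩)
  exact Or.inr ⟨hx, abs_le.2 ⟨not_lt.1 h1, not_lt.1 h2⟩⟩

/-- Values in the two phases differ by at least $1$, and the factor two in `le_localEnergy` pays for
the two directions of passage. -/
theorem lintegral_kernel_shiftMeasure_le (hf : Measurable f) (s : ℝ) :
    ∫⁻ r in Ioi (0 : ℝ), ENNReal.ofReal (r ^ (-(1 + 2 * s))) *
      (shiftMeasure (lowerPhase f) (upperPhase f) r +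
        shiftMeasure (upperPhase f) (lowerPhase f) r) ≤ gagliardoSq s f := by
  have hA := measurableSet_lowerPhase hf
  have hB := measurableSet_upperPhase hf
  have key : ∀ {A B : Set ℝ}, MeasurableSet A → MeasurableSet B →
      ∫⁻ r in Ioi (0 : ℝ), ENNReal.ofReal (r ^ (-(1 + 2 * s))) * shiftMeasure A B r ≤
        setInteraction s A B := by
    intro A B hA hB
    rw [setInteraction_eq s hA hB]
    refine le_trans (le_of_eq ?_) (setLIntegral_le_lintegral (Ioi 0) _)
    refine setLIntegral_congr_fun measurableSet_Ioi fun r hr => ?_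
    rw [abs_of_pos (mem_Ioi.1 hr), one_div, Real.rpow_neg (mem_Ioi.1 hr).le]
  have hloc := le_localEnergy s (u := f) (I := Ioo 0 1) (d := 1) hA hB zero_le_one
    inter_subset_left inter_subset_left disjoint_phases (by
      rintro x ⟨-, hx⟩ y ⟨-, hy⟩
      simp only [mem_ofPred_eq] at hx hy
      rw [abs_sub_comm]
      exact le_trans (by linarith) (le_abs_self _))
  simp_rw [mul_add]
  rw [lintegral_add_left (by have := measurable_shiftMeasure hA hB; fun_prop)]
  refine (add_le_add (key hA hB) (key hB hA)).trans (le_trans (le_of_eq ?_) hloc)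
  rw [setInteraction_comm s (upperPhase f)]
  norm_num [two_mul]

/-- On some dyadic shell at a scale $\rho\ge z$ the passages integrate to $O(\rho^2)$, and $Z$ adds
only $z\rho\le\rho^2$. With $a=N\rho$, subadditivity costs one factor $N$ and the change of
variables another, which produces $O(a^2)$ whatever $\rho$ is. -/
theorem lintegral_shiftModulus_le (hf : Measurable f) {s z a L C : ℝ} (hs0 : 0 < s)
    (hs1 : s ≤ 1) (hz : 0 < z) (hza : 2 * z ≤ a) (hL : 0 < L) (hC : 0 ≤ C)
    (hZ : volume (middlePhase f) ≤ ENNReal.ofReal z)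
    (hE : ENNReal.ofReal L * gagliardoSq s f ≤ ENNReal.ofReal C)
    (hint : 1 / 2 ≤ L * ∫ r in 2 * z..a, r ^ (-(2 * s))) :
    ∫⁻ R in Ioc (a / 2) a, shiftModulus ((upperPhase f).indicator 1) R ≤
      ENNReal.ofReal ((4 * (C + 1) + 1) * a ^ 2) := by
  have ha : 0 < a := by linarith
  have hA := measurableSet_lowerPhase hf
  have hB := measurableSet_upperPhase hf
  set A := lowerPhase f
  set B := upperPhase f
  set H : ℝ → ℝ≥0∞ := fun r => shiftMeasure A B r + shiftMeasure B A r with hH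
  have hHm : Measurable H := (measurable_shiftMeasure hA hB).add (measurable_shiftMeasure hB hA)
  -- The last shell ends at $a2^{-K}\in[z,2z)$.
  obtain ⟨K, hK1, hK2⟩ := exists_nat_pow_near_of_lt_one (x := z / a) (y := 1 / 2) (by positivity)
    (by rw [div_le_one ha]; linarith) (by norm_num) (by norm_num)
  have hpow : ∀ k : ℕ, 0 < a * (1 / 2 : ℝ) ^ k := fun k => by positivity
  have hKz : z ≤ a * (1 / 2) ^ K := by rw [div_le_iff₀ ha] at hK2; linarith
  have hKz2 : a * (1 / 2) ^ K ≤ 2 * z := by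
    rw [lt_div_iff₀ ha, pow_succ] at hK1; linarith
  -- As $L\int r^{-2s}\ge1/2$, this makes the comparison integral at least $(C+1)/L$, strictly above
  -- the bound $C/L$ on the seminorm, as the choice of a shell requires.
  set M := 2 * (C + 1) with hM
  have hgag : gagliardoSq s f ≤ ENNReal.ofReal (C / L) := by
    calc gagliardoSq s f = ENNReal.ofReal L⁻¹ * (ENNReal.ofReal L * gagliardoSq s f) := by
          rw [← mul_assoc, ← ENNReal.ofReal_mul (by positivity), inv_mul_cancel₀ hL.ne',
            ENNReal.ofReal_one, one_mul]
      _ ≤ ENNReal.ofReal L⁻¹ * ENNReal.ofReal C := by gcongr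
      _ = _ := by rw [← ENNReal.ofReal_mul (by positivity)]; congr 1; ring
  have hlow : (C + 1) / L ≤ M * ∫ r in a * (1 / 2) ^ K..a, r ^ (-(2 * s)) := by
    have h1 : (∫ r in 2 * z..a, r ^ (-(2 * s))) ≤ ∫ r in a * (1 / 2) ^ K..a, r ^ (-(2 * s)) := by
      rw [← intervalIntegral.integral_add_adjacent_intervals
        (intervalIntegrable_rpow_of_pos (hpow K) (show 0 < 2 * z by linarith))
        (intervalIntegrable_rpow_of_pos (show 0 < 2 * z by linarith) ha)]
      have : 0 ≤ ∫ r in a * (1 / 2) ^ K..2 * z, r ^ (-(2 * s)) :=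
        intervalIntegral.integral_nonneg hKz2 fun r hr => Real.rpow_nonneg
          ((hpow K).le.trans hr.1) _
      linarith
    rw [div_le_iff₀ hL]
    calc C + 1 = M * (1 / 2) := by rw [hM]; ring
      _ ≤ M * (L * ∫ r in 2 * z..a, r ^ (-(2 * s))) := by gcongr
      _ ≤ M * (L * ∫ r in a * (1 / 2) ^ K..a, r ^ (-(2 * s))) := by gcongr
      _ = _ := by ring
  obtain ⟨k, hk, hshell⟩ := exists_dyadic_shell (p := -(2 * s)) ha
    (fun r => ENNReal.ofReal (r ^ (-(1 + 2 * s))) * H r) M (by positivity) K (by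
      calc ∫⁻ r in Ioc (a * (1 / 2) ^ K) a, ENNReal.ofReal (r ^ (-(1 + 2 * s))) * H r
          ≤ gagliardoSq s f :=
            (lintegral_mono_set fun r hr => (hpow K).trans hr.1).trans
              (lintegral_kernel_shiftMeasure_le hf s)
        _ ≤ ENNReal.ofReal (C / L) := hgag
        _ < ENNReal.ofReal ((C + 1) / L) := by
            rw [ENNReal.ofReal_lt_ofReal_iff (by positivity)]
            gcongr
            linarith
        _ ≤ _ := ENNReal.ofReal_le_ofReal hlow)
  set ρ := a * (1 / 2 : ℝ) ^ k with hρ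
  have hρ0 : 0 < ρ := hpow k
  have hρ2 : a * (1 / 2 : ℝ) ^ (k + 1) = ρ / 2 := by rw [hρ, pow_succ]; ring
  rw [hρ2] at hshell
  have hzρ : z ≤ ρ := hKz.trans (by
    rw [hρ]
    gcongr ?_ * ?_
    exact pow_le_pow_of_le_one (by norm_num) (by norm_num) hk.le)
  have hHle : ∫⁻ r in Ioc (ρ / 2) ρ, H r ≤ ENNReal.ofReal (2 * M * ρ ^ 2) := by
    calc ∫⁻ r in Ioc (ρ / 2) ρ, H r
        ≤ ∫⁻ r in Ioc (ρ / 2) ρ, ENNReal.ofReal (ρ ^ (1 + 2 * s)) *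
            (ENNReal.ofReal (r ^ (-(1 + 2 * s))) * H r) := by
          refine setLIntegral_mono' measurableSet_Ioc fun r hr => ?_
          have hr0 : 0 < r := by linarith [hr.1]
          rw [← mul_assoc, ← ENNReal.ofReal_mul (by positivity)]
          refine le_mul_of_one_le_left' ?_
          rw [← ENNReal.ofReal_one]
          apply ENNReal.ofReal_le_ofReal
          rw [Real.rpow_neg hr0.le, ← div_eq_mul_inv, one_le_div (by positivity)]
          have := hr.2
          gcongr
      _ = ENNReal.ofReal (ρ ^ (1 + 2 * s)) *
            ∫⁻ r in Ioc (ρ / 2) ρ, ENNReal.ofReal (r ^ (-(1 + 2 * s))) * H r :=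
          lintegral_const_mul' _ _ ENNReal.ofReal_ne_top
      _ ≤ ENNReal.ofReal (ρ ^ (1 + 2 * s)) *
            ENNReal.ofReal (M * ∫ r in ρ / 2..ρ, r ^ (-(2 * s))) := by gcongr
      _ ≤ _ := by
          rw [← ENNReal.ofReal_mul (by positivity)]
          apply ENNReal.ofReal_le_ofReal
          have hρh : 0 < ρ / 2 := by positivity
          have h1 : (∫ r in ρ / 2..ρ, r ^ (-(2 * s))) ≤ ρ / 2 * (4 * ρ ^ (-(2 * s))) := by
            calc (∫ r in ρ / 2..ρ, r ^ (-(2 * s))) ≤ ∫ r in ρ / 2..ρ, (ρ / 2) ^ (-(2 * s)) :=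
                  intervalIntegral.integral_mono_on (by linarith)
                    (intervalIntegrable_rpow_of_pos hρh hρ0) intervalIntegrable_const
                    fun r hr => Real.rpow_le_rpow_of_nonpos hρh hr.1 (by linarith)
              _ = ρ / 2 * (ρ / 2) ^ (-(2 * s)) := by
                  rw [intervalIntegral.integral_const, smul_eq_mul]; congr 1; ring
              _ ≤ ρ / 2 * (4 * ρ ^ (-(2 * s))) := by
                  gcongr
                  rw [Real.div_rpow hρ0.le two_pos.le, Real.rpow_neg two_pos.le, div_inv_eq_mul,
                    mul_comm]
                  gcongr
                  calc (2 : ℝ) ^ (2 * s) ≤ 2 ^ (2 : ℝ) :=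
                        Real.rpow_le_rpow_of_exponent_le (by norm_num) (by linarith)
                    _ = 4 := by norm_num
          have h2 : ρ ^ (1 + 2 * s) * ρ ^ (-(2 * s)) = ρ := by
            rw [← Real.rpow_add hρ0]; simp
          calc ρ ^ (1 + 2 * s) * (M * ∫ r in ρ / 2..ρ, r ^ (-(2 * s)))
              ≤ ρ ^ (1 + 2 * s) * (M * (ρ / 2 * (4 * ρ ^ (-(2 * s))))) := by gcongr
            _ = 2 * M * ρ * (ρ ^ (1 + 2 * s) * ρ ^ (-(2 * s))) := by ring
            _ = 2 * M * ρ ^ 2 := by rw [h2]; ring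
  have hGle : ∫⁻ r in Ioc (ρ / 2) ρ, shiftModulus (B.indicator 1) r ≤
      ENNReal.ofReal (2 * M * ρ ^ 2 + z * ρ) := by
    calc ∫⁻ r in Ioc (ρ / 2) ρ, shiftModulus (B.indicator 1) r
        ≤ ∫⁻ r in Ioc (ρ / 2) ρ, (H r + ENNReal.ofReal (2 * z)) := by
          refine setLIntegral_mono' measurableSet_Ioc fun r hr => ?_
          refine (shiftModulus_indicator_le hB (by linarith [hr.1]) Ioo_subset_phases).trans ?_
          rw [ENNReal.ofReal_mul two_pos.le, ENNReal.ofReal_ofNat]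
          gcongr
      _ = (∫⁻ r in Ioc (ρ / 2) ρ, H r) + ENNReal.ofReal (2 * z) * ENNReal.ofReal (ρ / 2) := by
          rw [lintegral_add_left hHm, setLIntegral_const, Real.volume_Ioc]
          congr 3
          ring
      _ ≤ ENNReal.ofReal (2 * M * ρ ^ 2) + ENNReal.ofReal (2 * z) * ENNReal.ofReal (ρ / 2) := by
          gcongr
      _ = _ := by
          rw [← ENNReal.ofReal_mul (by positivity), ← ENNReal.ofReal_add (by positivity)
            (by positivity)]
          congr 2
          ring
  have hN : ((2 ^ k : ℕ) : ℝ) * ρ = a := by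
    rw [hρ]; push_cast; rw [mul_left_comm, ← mul_pow]; norm_num
  set N := 2 ^ k
  have hN0 : (0 : ℝ) < N := by positivity
  have hcov : Ioc (a / 2) a = Ioc ((N : ℝ) * (ρ / 2)) (N * ρ) := by
    rw [hN, ← hN]; congr 1; ring
  rw [hcov, lintegral_Ioc_mul hN0]
  calc ENNReal.ofReal N * ∫⁻ r in Ioc (ρ / 2) ρ, shiftModulus (B.indicator 1) (N * r)
      ≤ ENNReal.ofReal N * ∫⁻ r in Ioc (ρ / 2) ρ, ENNReal.ofReal N *
          shiftModulus (B.indicator 1) r := by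
        gcongr ENNReal.ofReal N * ?_
        refine setLIntegral_mono' measurableSet_Ioc fun r hr => ?_
        rw [ENNReal.ofReal_natCast]
        exact shiftModulus_nat_mul_le (measurable_one.indicator hB) (by linarith [hr.1]) N
    _ = ENNReal.ofReal N * (ENNReal.ofReal N *
          ∫⁻ r in Ioc (ρ / 2) ρ, shiftModulus (B.indicator 1) r) := by
        rw [lintegral_const_mul' _ _ ENNReal.ofReal_ne_top]
    _ ≤ ENNReal.ofReal N * (ENNReal.ofReal N * ENNReal.ofReal (2 * M * ρ ^ 2 + z * ρ)) := by
        gcongr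
    _ ≤ _ := by
        rw [← ENNReal.ofReal_mul hN0.le, ← ENNReal.ofReal_mul hN0.le]
        apply ENNReal.ofReal_le_ofReal
        calc (N : ℝ) * (N * (2 * M * ρ ^ 2 + z * ρ)) ≤ N * (N * (2 * M * ρ ^ 2 + ρ * ρ)) := by
              gcongr
          _ = (2 * M + 1) * (N * ρ) ^ 2 := by ring
          _ = (4 * (C + 1) + 1) * a ^ 2 := by rw [hN, hM]; ring

end Phases

/-- The average of the indicator of `B` over `(x + a/2, x + a]`. -/
def shiftAverage (B : Set ℝ) (a x : ℝ) : ℝ :=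
  2 / a * (volume.real (B ∩ Iic (x + a)) - volume.real (B ∩ Iic (x + a / 2)))

section Average

variable {B : Set ℝ}

theorem measurable_shiftAverage (hB01 : B ⊆ Ioo 0 1) (a : ℝ) : Measurable (shiftAverage B a) := by
  have hmono : Monotone fun y => volume.real (B ∩ Iic y) := fun x y hxy =>
    measureReal_mono (inter_subset_inter_right _ (Iic_subset_Iic.2 hxy))
      ((measure_mono (inter_subset_left.trans hB01)).trans_lt (by simp)).ne
  have := hmono.measurable
  unfold shiftAverage
  exact measurable_const.mul ((this.comp (measurable_add_const _)).sub
    (this.comp (measurable_add_const _)))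

theorem shiftAverage_eq_integral (hB : MeasurableSet B) (hB01 : B ⊆ Ioo 0 1) {a : ℝ} (ha : 0 < a)
    (x : ℝ) : shiftAverage B a x = 2 / a * ∫ R in Ioc (a / 2) a, B.indicator 1 (x + R) := by
  have hfin : ∀ y, volume (B ∩ Iic y) ≠ ∞ := fun y =>
    ((measure_mono (inter_subset_left.trans hB01)).trans_lt (by simp)).ne
  rw [shiftAverage]
  congr 1
  have h1 : B ∩ Ioc (x + a / 2) (x + a) = (B ∩ Iic (x + a)) \ (B ∩ Iic (x + a / 2)) := by
    ext y
    simp only [mem_inter_iff, mem_Ioc, mem_Iic, Set.mem_sdiff]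
    constructor
    · rintro ⟨h1, h2, h3⟩; exact ⟨⟨h1, h3⟩, fun h => by linarith [h.2]⟩
    · rintro ⟨⟨h1, h2⟩, h3⟩
      exact ⟨h1, not_le.1 fun h => h3 ⟨h1, h⟩, h2⟩
  rw [← measureReal_sdiff (inter_subset_inter_right _ (Iic_subset_Iic.2 (by linarith)))
    (hB.inter measurableSet_Iic) (hfin _), ← h1]
  have h2 : ∫ R in Ioc (a / 2) a, B.indicator (1 : ℝ → ℝ) (x + R) =
      ∫ R, ((fun R => x + R) ⁻¹' (B ∩ Ioc (x + a / 2) (x + a))).indicator (1 : ℝ → ℝ) R := by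
    rw [← integral_indicator measurableSet_Ioc]
    congr 1
    ext R
    have hiff : R ∈ (fun R => x + R) ⁻¹' (B ∩ Ioc (x + a / 2) (x + a)) ↔
        R ∈ Ioc (a / 2) a ∧ x + R ∈ B := by
      simp only [mem_Ioc, mem_preimage, mem_inter_iff, add_lt_add_iff_left, add_le_add_iff_left]
      tauto
    by_cases h1 : R ∈ Ioc (a / 2) a <;> by_cases h2 : x + R ∈ B <;>
      simp only [indicator, hiff, h1, h2, and_true, and_false, if_true, if_false, Pi.one_apply]
  rw [h2, integral_indicator_one ((measurable_const_add x) (hB.inter measurableSet_Ioc))]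
  simp only [Measure.real]
  rw [measure_preimage_add]

theorem abs_shiftAverage_le (hB : MeasurableSet B) (hB01 : B ⊆ Ioo 0 1) {a : ℝ} (ha : 0 < a)
    (x : ℝ) : |shiftAverage B a x| ≤ 1 := by
  rw [shiftAverage_eq_integral hB hB01 ha, abs_mul, abs_of_pos (by positivity)]
  have h := norm_setIntegral_le_of_norm_le_const (μ := volume) (s := Ioc (a / 2) a) (C := 1)
    (f := fun R => B.indicator (1 : ℝ → ℝ) (x + R)) (by simp) fun R _ => by
      by_cases h : x + R ∈ B <;> simp [h]
  rw [Real.norm_eq_abs, Real.volume_real_Ioc_of_le (by linarith), one_mul] at h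
  calc 2 / a * |∫ R in Ioc (a / 2) a, B.indicator (1 : ℝ → ℝ) (x + R)|
      ≤ 2 / a * (a - a / 2) := by gcongr
    _ = 1 := by field_simp; ring

/-- The difference is the mean of $1_B(x)-1_B(x+R)$ over $R\in(a/2,a]$. Tonelli gives the modulus on
$(0,1-a)$, and the remaining strip of width $a$ costs at most $2a$. -/
theorem lintegral_sub_shiftAverage_le (hB : MeasurableSet B) (hB01 : B ⊆ Ioo 0 1) {a : ℝ}
    (ha : 0 < a) (ha1 : a < 1) :
    ∫⁻ x in Ioo (0 : ℝ) 1, ‖B.indicator 1 x - shiftAverage B a x‖ₑ ≤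
      ENNReal.ofReal (2 / a) * (∫⁻ R in Ioc (a / 2) a, shiftModulus (B.indicator 1) R) +
        ENNReal.ofReal (2 * a) := by
  have hm : Measurable (B.indicator (1 : ℝ → ℝ)) := measurable_one.indicator hB
  have hbd : ∀ x, ‖B.indicator (1 : ℝ → ℝ) x‖ ≤ 1 := fun x => by
    by_cases h : x ∈ B <;> simp [h]
  have hpt : ∀ x, ‖B.indicator 1 x - shiftAverage B a x‖ₑ ≤ ENNReal.ofReal (2 / a) *
      ∫⁻ R in Ioc (a / 2) a, ‖B.indicator (1 : ℝ → ℝ) x - B.indicator 1 (x + R)‖ₑ := by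
    intro x
    have hi : IntegrableOn (fun R => B.indicator (1 : ℝ → ℝ) (x + R)) (Ioc (a / 2) a) :=
      Measure.integrableOn_of_bounded (M := 1) (by simp)
        (hm.comp (measurable_const_add x)).aestronglyMeasurable (ae_of_all _ fun R => hbd _)
    have e : B.indicator 1 x - shiftAverage B a x =
        2 / a * ∫ R in Ioc (a / 2) a, (B.indicator (1 : ℝ → ℝ) x - B.indicator 1 (x + R)) := by
      have hc : IntegrableOn (fun _ => B.indicator (1 : ℝ → ℝ) x) (Ioc (a / 2) a) :=
        integrableOn_const (by simp)
      rw [integral_sub hc hi, setIntegral_const,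
        Real.volume_real_Ioc_of_le (by linarith), shiftAverage_eq_integral hB hB01 ha, smul_eq_mul,
        mul_sub]
      congr 1
      field_simp
      ring
    rw [e, enorm_mul, Real.enorm_eq_ofReal (by positivity)]
    gcongr
    exact enorm_integral_le_lintegral_enorm _
  have hsplit : Ioo (0 : ℝ) 1 = Ioo 0 (1 - a) ∪ Ico (1 - a) 1 :=
    (Ioo_union_Ico_eq_Ioo (by linarith) (by linarith)).symm
  rw [hsplit]
  refine (lintegral_union_le _ _ _).trans (add_le_add ?_ ?_)
  · calc ∫⁻ x in Ioo 0 (1 - a), ‖B.indicator 1 x - shiftAverage B a x‖ₑ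
        ≤ ∫⁻ x in Ioo 0 (1 - a), ENNReal.ofReal (2 / a) *
            ∫⁻ R in Ioc (a / 2) a, ‖B.indicator (1 : ℝ → ℝ) x - B.indicator 1 (x + R)‖ₑ :=
          lintegral_mono hpt
      _ = ENNReal.ofReal (2 / a) * ∫⁻ R in Ioc (a / 2) a, ∫⁻ x in Ioo 0 (1 - a),
            ‖B.indicator (1 : ℝ → ℝ) x - B.indicator 1 (x + R)‖ₑ := by
          rw [lintegral_const_mul' _ _ ENNReal.ofReal_ne_top]
          congr 1
          refine lintegral_lintegral_swap (Measurable.aemeasurable ?_)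
          have h1 : Measurable fun p : ℝ × ℝ => B.indicator (1 : ℝ → ℝ) p.1 :=
            hm.comp measurable_fst
          have h2 : Measurable fun p : ℝ × ℝ => B.indicator (1 : ℝ → ℝ) (p.1 + p.2) :=
            hm.comp (measurable_fst.add measurable_snd)
          exact (h1.sub h2).enorm
      _ ≤ _ := by
          gcongr ENNReal.ofReal (2 / a) * ?_
          refine setLIntegral_mono' measurableSet_Ioc fun R hR => ?_
          exact lintegral_mono_set (Ioo_subset_Ioo_right (by linarith [hR.2]))
  · calc ∫⁻ x in Ico (1 - a) 1, ‖B.indicator 1 x - shiftAverage B a x‖ₑ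
        ≤ ∫⁻ x in Ico (1 - a) 1, 2 := by
          refine lintegral_mono fun x => ?_
          rw [← ENNReal.ofReal_ofNat, ← ofReal_norm]
          apply ENNReal.ofReal_le_ofReal
          have h1 := norm_sub_le (B.indicator (1 : ℝ → ℝ) x) (shiftAverage B a x)
          have h2 := hbd x
          have h3 := abs_shiftAverage_le hB hB01 ha x
          rw [Real.norm_eq_abs (shiftAverage B a x)] at h1
          linarith
      _ = ENNReal.ofReal (2 * a) := by
          rw [setLIntegral_const, Real.volume_Ico, ENNReal.ofReal_mul two_pos.le,
            ENNReal.ofReal_ofNat]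
          congr 2
          ring

end Average

/-! ### Selection of a subsequence and compactness in measure -/

/-- A selection principle: the distribution functions of a sequence of sets converge along a
subsequence. -/
theorem exists_subseq_tendsto_volume (B : ℕ → Set ℝ)
    (hB01 : ∀ j, B j ⊆ Ioo 0 1) :
    ∃ φ : ℕ → ℕ, StrictMono φ ∧ ∀ y, ∃ l : ℝ,
      Tendsto (fun j => volume.real (B (φ j) ∩ Iic y)) atTop (𝓝 l) := by
  have hfin : ∀ j y, volume (B j ∩ Iic y) ≠ ∞ := fun j y =>
    ((measure_mono (inter_subset_left.trans (hB01 j))).trans_lt (by simp)).ne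
  have hmem : ∀ j, (fun q : ℚ => volume.real (B j ∩ Iic (q : ℝ))) ∈
      Set.pi univ fun _ : ℚ => Icc (0 : ℝ) 1 := by
    intro j q _
    refine ⟨measureReal_nonneg, ?_⟩
    calc volume.real (B j ∩ Iic (q : ℝ)) ≤ volume.real (Ioo (0 : ℝ) 1) :=
          measureReal_mono (inter_subset_left.trans (hB01 j)) (by simp)
      _ = 1 := by simp
  obtain ⟨l, -, φ, hφ, hlim⟩ :=
    (isCompact_univ_pi fun _ : ℚ => isCompact_Icc (a := (0 : ℝ)) (b := 1)).tendsto_subseq hmem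
  rw [tendsto_pi_nhds] at hlim
  refine ⟨φ, hφ, fun y => ?_⟩
  refine cauchySeq_tendsto_of_complete (Metric.cauchySeq_iff'.2 fun η hη => ?_)
  obtain ⟨q, hq1, hq2⟩ := exists_rat_btwn (show y < y + η / 4 by linarith)
  -- The distribution functions are uniformly $1$-Lipschitz, so convergence at rational points,
  -- obtained from Tychonoff's theorem, extends to all points.
  have hnear : ∀ j, |volume.real (B j ∩ Iic y) - volume.real (B j ∩ Iic (q : ℝ))| ≤ η / 4 := by
    intro j
    have h1 : volume.real (B j ∩ Iic y) ≤ volume.real (B j ∩ Iic (q : ℝ)) :=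
      measureReal_mono (inter_subset_inter_right _ (Iic_subset_Iic.2 hq1.le)) (hfin _ _)
    have h2 : volume.real (B j ∩ Iic (q : ℝ)) ≤ volume.real (B j ∩ Iic y) + (q - y) := by
      calc volume.real (B j ∩ Iic (q : ℝ))
          ≤ volume.real ((B j ∩ Iic y) ∪ Ioc y q) := by
            refine measureReal_mono ?_ (measure_union_lt_top (hfin j y).lt_top (by simp)).ne
            rintro x ⟨hx1, hx2⟩
            by_cases h : x ≤ y
            · exact Or.inl ⟨hx1, h⟩
            · exact Or.inr ⟨not_le.1 h, hx2⟩
        _ ≤ volume.real (B j ∩ Iic y) + volume.real (Ioc y (q : ℝ)) := measureReal_union_le _ _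
        _ = _ := by rw [Real.volume_real_Ioc_of_le hq1.le]
    rw [abs_le]
    constructor <;> linarith
  obtain ⟨N, hN⟩ := Metric.cauchySeq_iff'.1 (hlim q).cauchySeq (η / 2) (by linarith)
  refine ⟨N, fun n hn => ?_⟩
  have h1 := hnear (φ n)
  have h2 := hnear (φ N)
  have h3 := hN n hn
  simp only [Function.comp, Real.dist_eq] at h3 ⊢
  rw [abs_le] at h1 h2
  rw [abs_lt] at h3 ⊢
  constructor <;> linarith [h1.1, h1.2, h2.1, h2.2, h3.1, h3.2]

/-- Compactness on a bounded range, and the positive lower limits at infinity outside it. Only here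
does the behaviour of $W$ at infinity enter. -/
theorem exists_pos_le_potential_away {W : ℝ → ℝ} (hW : IsDoubleWell W) {η : ℝ} (hη : 0 < η) :
    ∃ c > 0, ∀ z, η ≤ |z - 1| → η ≤ |z + 1| → c ≤ W z := by
  obtain ⟨c₁, hc₁, h₁⟩ := hW.liminf_atTop
  obtain ⟨c₂, hc₂, h₂⟩ := hW.liminf_atBot
  obtain ⟨R₁, hR₁⟩ := eventually_atTop.1 h₁
  obtain ⟨R₂, hR₂⟩ := eventually_atBot.1 h₂
  set S := Icc R₂ R₁ ∩ {z | η ≤ |z - 1| ∧ η ≤ |z + 1|} with hS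
  have hSc : IsCompact S := by
    refine isCompact_Icc.inter_right (IsClosed.inter ?_ ?_)
    · exact isClosed_le continuous_const (continuous_id.sub continuous_const).abs
    · exact isClosed_le continuous_const (continuous_id.add continuous_const).abs
  have hmain : ∃ c₃ > 0, ∀ z ∈ S, c₃ ≤ W z := by
    rcases S.eq_empty_or_nonempty with he | hne
    · exact ⟨1, one_pos, fun z hz => by rw [he] at hz; exact absurd hz (notMem_empty z)⟩
    · obtain ⟨z₀, hz₀, hmin⟩ := hSc.exists_isMinOn hne hW.continuous.continuousOn
      refine ⟨W z₀, lt_of_le_of_ne (hW.nonneg _) fun h => ?_, fun z hz => hmin hz⟩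
      obtain ⟨-, ha, hb⟩ := hz₀
      rcases (hW.eq_zero_iff z₀).1 h.symm with h | h
      · rw [h, sub_self, abs_zero] at ha; linarith
      · rw [h, neg_add_cancel, abs_zero] at hb; linarith
  obtain ⟨c₃, hc₃, h₃⟩ := hmain
  refine ⟨min c₁ (min c₂ c₃), lt_min hc₁ (lt_min hc₂ hc₃), fun z ha hb => ?_⟩
  rcases le_total R₁ z with h | h
  · exact (min_le_left _ _).trans (hR₁ z h)
  rcases le_total z R₂ with h' | h'
  · exact ((min_le_right _ _).trans (min_le_left _ _)).trans (hR₂ z h')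
  · exact ((min_le_right _ _).trans (min_le_right _ _)).trans (h₃ z ⟨⟨h', h⟩, ha, hb⟩)

section Compactness

variable {W : ℝ → ℝ} {s : ℝ → ℝ} {ε : ℕ → ℝ} {v : ℕ → ℝ → ℝ} {C : ℝ}

theorem eventually_lintegral_sub_shiftAverage_le (hW : IsDoubleWell W)
    (hs : ∀ ε : ℝ, 0 < ε → s ε ∈ Ioo (0 : ℝ) 1) (hlim : Tendsto s (𝓝[>] 0) (𝓝 (1 / 2)))
    (hε : Tendsto ε atTop (𝓝[>] 0)) (hv : ∀ j, Measurable (v j)) (hC : 0 ≤ C)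
    (hF : ∀ j, rescaledEnergy W (ε j) (s (ε j)) (v j) ≤ ENNReal.ofReal C)
    {a : ℝ} (ha : 0 < a) (ha1 : a < 1) :
    ∀ᶠ j in atTop, ∫⁻ x in Ioo (0 : ℝ) 1,
      ‖(upperPhase (v j)).indicator 1 x - shiftAverage (upperPhase (v j)) a x‖ₑ ≤
        ENNReal.ofReal ((8 * (C + 1) + 4) * a) := by
  obtain ⟨c, hc, hcW⟩ := exists_pos_le_potential hW (η := 1 / 2) (by norm_num) (by norm_num)
  set K := max 1 (C / c)
  have hK : 1 ≤ K := le_max_left _ _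
  filter_upwards [eventually_scale hs hε, hε.eventually (eventually_exponent_near hlim),
    -- The constant $K$ is doubled because `lintegral_shiftModulus_le` needs the kernel mass from
    -- $2z$ on.
    hε.eventually (eventually_seminormFactor_mul_integral_ge hlim
      (show 1 ≤ 2 * K by linarith) ha (show (0 : ℝ) < 1 / 2 by norm_num)),
    ((tendsto_div_scalingFactor hlim (2 * K)).comp hε).eventually (gt_mem_nhds ha)]
    with j hscale hsj hint hz
  obtain ⟨he, he1, hs0⟩ := hscale
  have hvol := volume_potential_ge_le hW.continuous (hv j) he he1 hs0 hc (hF j)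
  simp only [Function.comp] at hz
  have hlp := scalingFactor_pos he he1 hs0
  have e2 : 2 * K * ε j / scalingFactor (ε j) (s (ε j)) =
    2 * (K * ε j / scalingFactor (ε j) (s (ε j))) := by ring
  rw [e2] at hz hint
  have hZ : volume (middlePhase (v j)) ≤
      ENNReal.ofReal (K * ε j / scalingFactor (ε j) (s (ε j))) := by
    calc volume (middlePhase (v j)) ≤ unitVol {x | c ≤ W (v j x)} := by
          rw [unitVol_apply_eq, inter_comm]
          refine measure_mono (inter_subset_inter_right _ fun x hx => hcW _ ?_)
          norm_num
          norm_num at hx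
          exact hx
      _ ≤ _ := hvol
      _ ≤ _ := by
          apply ENNReal.ofReal_le_ofReal
          have : C / c ≤ K := le_max_right 1 (C / c)
          gcongr
  have h1 := lintegral_shiftModulus_le (hv j) (s := s (ε j)) (a := a) (C := C) hs0
    (by linarith) (by positivity) hz.le (seminormFactor_pos he he1 hs0) hC hZ
    (le_add_self.trans (hF j)) (by linarith)
  refine (lintegral_sub_shiftAverage_le (measurableSet_upperPhase (hv j)) inter_subset_left
    ha ha1).trans ?_
  refine (add_le_add (mul_le_mul_right h1 _) le_rfl).trans (le_of_eq ?_)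
  rw [← ENNReal.ofReal_mul (by positivity), ← ENNReal.ofReal_add (by positivity) (by positivity)]
  congr 1
  field_simp
  ring

/-- For fixed $a$ the averages converge pointwise and boundedly, hence in $L^1$, and the indicators
are $O(a)$-close to them. The subsequence is selected before $a$, so no further diagonal argument is
needed. -/
theorem exists_subseq_cauchy (hW : IsDoubleWell W)
    (hs : ∀ ε : ℝ, 0 < ε → s ε ∈ Ioo (0 : ℝ) 1) (hlim : Tendsto s (𝓝[>] 0) (𝓝 (1 / 2)))
    (hε : Tendsto ε atTop (𝓝[>] 0)) (hv : ∀ j, Measurable (v j)) (hC : 0 ≤ C)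
    (hF : ∀ j, rescaledEnergy W (ε j) (s (ε j)) (v j) ≤ ENNReal.ofReal C) :
    ∃ φ : ℕ → ℕ, StrictMono φ ∧ ∀ η : ℝ≥0∞, 0 < η → ∃ N, ∀ m ≥ N, ∀ n ≥ N,
      ∫⁻ x in Ioo (0 : ℝ) 1, ‖(upperPhase (v (φ m))).indicator (1 : ℝ → ℝ) x -
        (upperPhase (v (φ n))).indicator 1 x‖ₑ < η := by
  obtain ⟨φ, hφ, hl⟩ := exists_subseq_tendsto_volume (fun j => upperPhase (v j))
    fun j => inter_subset_left
  choose l hl using hl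
  refine ⟨φ, hφ, fun η hη => ?_⟩
  set D := 8 * (C + 1) + 4 with hD
  have hD0 : 0 < D := by positivity
  obtain ⟨a, haη, ha, ha1⟩ : ∃ a : ℝ, ENNReal.ofReal (2 * (D + 1) * a) < η ∧ 0 < a ∧ a < 1 := by
    have hcont : Tendsto (fun a : ℝ => ENNReal.ofReal (2 * (D + 1) * a)) (𝓝[>] 0) (𝓝 0) := by
      have h1 : Continuous fun a : ℝ => ENNReal.ofReal (2 * (D + 1) * a) :=
        ENNReal.continuous_ofReal.comp (by fun_prop)
      have h2 := (h1.tendsto 0).mono_left (nhdsWithin_le_nhds (s := Ioi 0))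
      simpa using h2
    obtain ⟨a, h1, h2⟩ := ((hcont.eventually (gt_mem_nhds hη)).and eventually_small).exists
    exact ⟨a, h1, h2⟩
  set B : ℕ → Set ℝ := fun j => upperPhase (v (φ j)) with hB
  have hBm : ∀ j, MeasurableSet (B j) := fun j => measurableSet_upperPhase (hv _)
  have hB01 : ∀ j, B j ⊆ Ioo 0 1 := fun j => inter_subset_left
  set S : ℝ → ℝ := fun x => 2 / a * (l (x + a) - l (x + a / 2)) with hS
  have hSlim : ∀ x, Tendsto (fun j => shiftAverage (B j) a x) atTop (𝓝 (S x)) := fun x =>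
    ((hl (x + a)).sub (hl (x + a / 2))).const_mul _
  have hSm : Measurable S :=
    measurable_of_tendsto_metrizable (fun j => measurable_shiftAverage (hB01 j) a)
      (tendsto_pi_nhds.2 hSlim)
  have hS1 : ∀ x, |S x| ≤ 1 := fun x => le_of_tendsto (hSlim x).abs
    (Eventually.of_forall fun j => abs_shiftAverage_le (hBm j) (hB01 j) ha x)
  have hdom : Tendsto (fun j => ∫⁻ x in Ioo (0 : ℝ) 1, ‖shiftAverage (B j) a x - S x‖ₑ) atTop
      (𝓝 0) := by
    have := tendsto_lintegral_of_dominated_convergence (μ := unitVol)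
      (F := fun j x => ‖shiftAverage (B j) a x - S x‖ₑ) (f := fun _ => 0) (fun _ => 2)
      (fun j => ((measurable_shiftAverage (hB01 j) a).sub hSm).enorm)
      (fun j => ae_of_all _ fun x => by
        change ‖shiftAverage (B j) a x - S x‖ₑ ≤ 2
        rw [← ENNReal.ofReal_ofNat, ← ofReal_norm, Real.norm_eq_abs]
        apply ENNReal.ofReal_le_ofReal
        have h1 := abs_sub (shiftAverage (B j) a x) (S x)
        have h2 := abs_shiftAverage_le (hBm j) (hB01 j) ha x
        linarith [hS1 x])
      (by simp) (ae_of_all _ fun x => by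
        have := ((hSlim x).sub_const (S x)).enorm
        simpa using this)
    simpa using this
  have hev := (hφ.tendsto_atTop.eventually
    (eventually_lintegral_sub_shiftAverage_le hW hs hlim hε hv hC hF ha ha1)).and
    (hdom.eventually (gt_mem_nhds (show (0 : ℝ≥0∞) < ENNReal.ofReal a by simpa using ha)))
  obtain ⟨N, hN⟩ := eventually_atTop.1 hev
  have hfm : ∀ j, Measurable ((B j).indicator (1 : ℝ → ℝ)) := fun j =>
    measurable_one.indicator (hBm j)
  have hclose : ∀ n ≥ N, ∫⁻ x in Ioo (0 : ℝ) 1, ‖(B n).indicator 1 x - S x‖ₑ ≤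
      ENNReal.ofReal ((D + 1) * a) := by
    intro n hn
    obtain ⟨h1, h2⟩ := hN n hn
    calc ∫⁻ x in Ioo (0 : ℝ) 1, ‖(B n).indicator 1 x - S x‖ₑ
        ≤ ∫⁻ x in Ioo (0 : ℝ) 1, (‖(B n).indicator 1 x - shiftAverage (B n) a x‖ₑ +
            ‖shiftAverage (B n) a x - S x‖ₑ) := by
          refine lintegral_mono fun x => ?_
          refine le_trans (le_of_eq ?_) (enorm_add_le _ _)
          congr 1
          ring
      _ = _ := lintegral_add_right _ ((measurable_shiftAverage (hB01 n) a).sub hSm).enorm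
      _ ≤ ENNReal.ofReal (D * a) + ENNReal.ofReal a := add_le_add h1 h2.le
      _ = _ := by
          rw [← ENNReal.ofReal_add (by positivity) ha.le]; congr 1; ring
  refine ⟨N, fun m hm n hn => lt_of_le_of_lt ?_ haη⟩
  calc ∫⁻ x in Ioo (0 : ℝ) 1, ‖(B m).indicator (1 : ℝ → ℝ) x - (B n).indicator 1 x‖ₑ
      ≤ ∫⁻ x in Ioo (0 : ℝ) 1, (‖(B m).indicator 1 x - S x‖ₑ + ‖(B n).indicator 1 x - S x‖ₑ) := by
        refine lintegral_mono fun x => ?_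
        rw [← enorm_neg ((B n).indicator 1 x - S x)]
        refine le_trans (le_of_eq ?_) (enorm_add_le _ _)
        congr 1
        ring
    _ = _ := lintegral_add_right _ ((hfm n).sub hSm).enorm
    _ ≤ ENNReal.ofReal ((D + 1) * a) + ENNReal.ofReal ((D + 1) * a) :=
        add_le_add (hclose m hm) (hclose n hn)
    _ = _ := by
        rw [← ENNReal.ofReal_add (by positivity) (by positivity)]; congr 1; ring

/-- The limit is $2F-1$, with $F$ the $L^1$ limit of the upper phase indicators: off a set of small
measure $v_j$ is close to a well, and the indicator tells which one. -/
theorem exists_subseq_tendstoInMeasure (hW : IsDoubleWell W)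
    (hs : ∀ ε : ℝ, 0 < ε → s ε ∈ Ioo (0 : ℝ) 1) (hlim : Tendsto s (𝓝[>] 0) (𝓝 (1 / 2)))
    (hε : Tendsto ε atTop (𝓝[>] 0)) (hv : ∀ j, Measurable (v j)) (hC : 0 ≤ C)
    (hF : ∀ j, rescaledEnergy W (ε j) (s (ε j)) (v j) ≤ ENNReal.ofReal C) :
    ∃ (u : MeasFun) (φ : ℕ → ℕ), StrictMono φ ∧
      TendstoInMeasure unitVol (fun j => v (φ j)) atTop u := by
  obtain ⟨φ, hφ, hcau⟩ := exists_subseq_cauchy hW hs hlim hε hv hC hF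
  set f : ℕ → ℝ → ℝ := fun j => (upperPhase (v (φ j))).indicator 1 with hf
  have hfm : ∀ j, Measurable (f j) := fun j =>
    measurable_one.indicator (measurableSet_upperPhase (hv _))
  have hfL : ∀ j, MemLp (f j) 1 unitVol := fun j =>
    MemLp.of_bound (hfm j).aestronglyMeasurable 1 (ae_of_all _ fun x => by
      by_cases h : x ∈ upperPhase (v (φ j)) <;> simp [hf, h])
  have hseq : CauchySeq fun j => (hfL j).toLp (f j) := by
    rw [EMetric.cauchySeq_iff]
    intro η hη
    obtain ⟨N, hN⟩ := hcau η hη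
    refine ⟨N, fun m hm n hn => ?_⟩
    rw [Lp.edist_toLp_toLp, eLpNorm_one_eq_lintegral_enorm]
    exact hN m hm n hn
  obtain ⟨F, hFlim⟩ := cauchySeq_tendsto_of_complete hseq
  have hmeas : TendstoInMeasure unitVol f atTop F :=
    (tendstoInMeasure_of_tendsto_Lp hFlim).congr_left fun j => (hfL j).coeFn_toLp
  have hFm : AEStronglyMeasurable (fun x => 2 * F x - 1) unitVol :=
    ((Lp.aestronglyMeasurable F).const_mul 2).sub aestronglyMeasurable_const
  refine ⟨AEEqFun.mk _ hFm, φ, hφ, ?_⟩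
  refine TendstoInMeasure.congr_right (AEEqFun.coeFn_mk _ hFm).symm ?_
  rw [tendstoInMeasure_iff_dist] at hmeas ⊢
  intro η hη
  -- The bound $1/2$ makes the phase agree with the nearest well, and $\eta/2+2\cdot\eta/4=\eta$
  -- closes the triangle inequality.
  set η' := min (η / 2) (1 / 2) with hη'
  have hη'0 : 0 < η' := lt_min (by positivity) (by norm_num)
  obtain ⟨c, hc, hcW⟩ := exists_pos_le_potential_away hW hη'0
  have h1 : Tendsto (fun j => ENNReal.ofReal (C / c * ε (φ j) /
      scalingFactor (ε (φ j)) (s (ε (φ j)))) + unitVol {x | η / 4 ≤ dist (f j x) (F x)}) atTop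
      (𝓝 0) := by
    have h2 := ENNReal.tendsto_ofReal (((tendsto_div_scalingFactor hlim (C / c)).comp hε).comp
      hφ.tendsto_atTop)
    have h3 := h2.add (hmeas (η / 4) (by positivity))
    simpa using h3
  refine tendsto_of_tendsto_of_tendsto_of_le_of_le' tendsto_const_nhds h1
    (Eventually.of_forall fun _ => zero_le) ?_
  filter_upwards [hφ.tendsto_atTop.eventually (eventually_scale hs hε)] with j hj
  refine le_trans ?_ (add_le_add (volume_potential_ge_le hW.continuous (hv (φ j)) hj.1 hj.2.1
    hj.2.2 hc (hF (φ j))) le_rfl)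
  rw [unitVol_apply_eq, unitVol_apply_eq, unitVol_apply_eq]
  refine le_trans (measure_mono ?_) (measure_union_le _ _)
  rintro x ⟨hx, hx01⟩
  by_contra hcon
  rw [mem_union, not_or] at hcon
  have hd : dist (f j x) (F x) < η / 4 := not_le.1 fun h => hcon.2 ⟨h, hx01⟩
  have hw : ¬ c ≤ W (v (φ j) x) := fun h => hcon.1 ⟨h, hx01⟩
  have hη1 : η' ≤ η / 2 := min_le_left _ _
  have hη2 : η' ≤ 1 / 2 := min_le_right _ _
  have hnear : |v (φ j) x - (2 * f j x - 1)| < η' := by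
    by_cases hp : η' ≤ |v (φ j) x - 1|
    · have hm : |v (φ j) x + 1| < η' := not_le.1 fun h => hw (hcW _ hp h)
      have hnot : x ∉ upperPhase (v (φ j)) := fun h => by
        have := h.2
        simp only [mem_ofPred_eq] at this
        linarith [(abs_lt.1 hm).2]
      simpa [hf, hnot] using hm
    · have hp' := not_le.1 hp
      have hin : x ∈ upperPhase (v (φ j)) :=
        ⟨hx01, by
          simp only [mem_ofPred_eq]
          linarith [(abs_lt.1 hp').1]⟩
      have e : (2 : ℝ) - 1 = 1 := by norm_num
      simpa [hf, hin, e] using hp'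
  simp only [mem_ofPred_eq] at hx
  rw [Real.dist_eq] at hx hd
  have htri : |v (φ j) x - (2 * F x - 1)| ≤
      |v (φ j) x - (2 * f j x - 1)| + 2 * |f j x - F x| := by
    have e : v (φ j) x - (2 * F x - 1) = (v (φ j) x - (2 * f j x - 1)) + 2 * (f j x - F x) := by
      ring
    rw [e]
    refine (abs_add_le _ _).trans (le_of_eq ?_)
    rw [abs_mul, abs_two]
  linarith

end Compactness

/-! ### Passage to classes of functions and conclusion -/

theorem gagliardoSq_congr {s : ℝ} {f g : ℝ → ℝ} (h : f =ᵐ[unitVol] g) :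
    gagliardoSq s f = gagliardoSq s g := by
  unfold gagliardoSq
  refine lintegral_congr_ae ?_
  filter_upwards [h] with x hx
  refine lintegral_congr_ae ?_
  filter_upwards [h] with y hy
  rw [hx, hy]

theorem rescaledEnergy_congr {W : ℝ → ℝ} {ε s : ℝ} {f g : ℝ → ℝ} (h : f =ᵐ[unitVol] g) :
    rescaledEnergy W ε s f = rescaledEnergy W ε s g := by
  unfold rescaledEnergy
  rw [gagliardoSq_congr h]
  congr 2
  refine lintegral_congr_ae ?_
  filter_upwards [h] with x hx
  rw [hx]

theorem limitEnergy_of_memBVpm {u : ℝ → ℝ} (hu : MemBVpm u) :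
    limitEnergy u = 8 * ((jumpSet u).encard : ℝ≥0∞) := by
  rw [limitEnergy, if_pos hu]

/-- Existence of recovery families for functions of bounded variation with values `±1`. -/
theorem exists_recovery {W : ℝ → ℝ} (hW : IsDoubleWell W) {s : ℝ → ℝ}
    (hs : ∀ ε : ℝ, 0 < ε → s ε ∈ Ioo (0 : ℝ) 1) (hlim : Tendsto s (𝓝[>] 0) (𝓝 (1 / 2)))
    (u : MeasFun) (hu : MemBVpm u) :
    ∃ v : ℝ → MeasFun, (∀ ε : ℝ, 0 < ε → MemHs (s ε) (v ε)) ∧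
      Tendsto (fun ε => eLpNorm (fun x => v ε x - u x) 2 unitVol) (𝓝[>] 0) (𝓝 0) ∧
      Tendsto (fun ε => rescaledEnergy W ε (s ε) (v ε)) (𝓝[>] 0)
        (𝓝 (8 * ((jumpSet u).encard : ℝ≥0∞))) := by
  have hfin := hu.finite_essJumps
  set T := hfin.toFinset with hT
  obtain ⟨σ, hσ, hae⟩ := ae_eq_prod_stepAt hu.1 hfin.coe_toFinset
  have hlimE : limitEnergy u = 8 * (T.card : ℝ≥0∞) := limitEnergy_eq_of_finite hu.1 hfin
  have hm : ∀ ε, AEStronglyMeasurable (recovery σ T (layerWidth ε (s ε))) unitVol := fun ε =>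
    (continuous_recovery _ _ _).aestronglyMeasurable
  set v : ℝ → MeasFun := fun ε => AEEqFun.mk _ (hm ε) with hv
  have hvae : ∀ ε, v ε =ᵐ[unitVol] recovery σ T (layerWidth ε (s ε)) := fun ε =>
    AEEqFun.coeFn_mk _ _
  have hL2 : Tendsto (fun ε => eLpNorm (fun x => v ε x - u x) 2 unitVol) (𝓝[>] 0) (𝓝 0) := by
    have h1 : Tendsto (fun ε : ℝ => 2 * ((T.card : ℝ≥0∞) * ENNReal.ofReal (2 * ε)) ^ (1 / 2 : ℝ))
        (𝓝[>] 0) (𝓝 0) := by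
      have h2 : Tendsto (fun ε : ℝ => ENNReal.ofReal (2 * ε)) (𝓝[>] 0) (𝓝 0) := by
        have h3 : Continuous fun ε : ℝ => ENNReal.ofReal (2 * ε) :=
          ENNReal.continuous_ofReal.comp (by fun_prop)
        simpa using (h3.tendsto 0).mono_left (nhdsWithin_le_nhds (s := Ioi 0))
      have h4 := ENNReal.Tendsto.const_mul (a := (T.card : ℝ≥0∞)) h2
        (Or.inr (ENNReal.natCast_ne_top _))
      rw [mul_zero] at h4
      have h5 := h4.ennrpow_const (1 / 2 : ℝ)
      rw [ENNReal.zero_rpow_of_pos (by norm_num)] at h5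
      have h6 := ENNReal.Tendsto.const_mul (a := 2) h5 (Or.inr (by norm_num))
      rwa [mul_zero] at h6
    refine tendsto_of_tendsto_of_tendsto_of_le_of_le' tendsto_const_nhds h1
      (Eventually.of_forall fun _ => zero_le) ?_
    filter_upwards [eventually_small] with ε hε
    have e : (fun x => v ε x - u x) =ᵐ[unitVol]
        fun x => recovery σ T (layerWidth ε (s ε)) x - σ * ∏ t ∈ T, stepAt t x := by
      filter_upwards [hvae ε, hae] with x h1 h2
      rw [h1, h2]
    rw [eLpNorm_congr_ae e]
    refine (eLpNorm_recovery_sub_le hσ (layerWidth_pos hε.1)).trans ?_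
    have := layerWidth_le (s := s ε) hε.1 hε.2
    gcongr
  refine ⟨v, fun ε hε => ?_, hL2, ?_⟩
  · have h := memHs_recovery (T := T) (abs_le_one_of_eq_or hσ)
      (layerWidth_pos (s := s ε) hε) (hs ε hε).2
    exact ⟨(memLp_congr_ae (hvae ε)).2 h.1, by rw [gagliardoSq_congr (hvae ε)]; exact h.2⟩
  · rw [← limitEnergy_of_memBVpm hu]
    refine tendsto_of_seq_tendsto fun e he => ?_
    have hconv : TendstoInMeasure unitVol (fun j => (v (e j) : ℝ → ℝ)) atTop u :=
      tendstoInMeasure_of_tendsto_eLpNorm two_ne_zero (fun j => (v (e j)).aestronglyMeasurable)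
        u.aestronglyMeasurable (hL2.comp he)
    -- The liminf inequality, applied to the recovery family itself, supplies the lower half of the
    -- limit.
    refine tendsto_of_le_liminf_of_limsup_le
      (limitEnergy_le_liminf hW hs hlim he (fun j => (v (e j)).measurable) u.measurable hconv) ?_
    obtain ⟨K, hK⟩ := exists_rescaledEnergy_recovery_le hW hσ T hlim
    have h1 : Tendsto (fun j => ENNReal.ofReal (8 * T.card + K * scalingFactor (e j) (s (e j))))
        atTop (𝓝 (limitEnergy u)) := by
      have h2 := ((((tendsto_scalingFactor hlim).comp he).const_mul K).const_add (8 * T.card : ℝ))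
      rw [mul_zero, add_zero] at h2
      have h3 := ENNReal.tendsto_ofReal h2
      rw [ENNReal.ofReal_mul (by norm_num), ENNReal.ofReal_natCast, ENNReal.ofReal_ofNat,
        ← hlimE] at h3
      exact h3
    rw [← h1.limsup_eq]
    refine limsup_le_limsup ?_
    filter_upwards [he.eventually hK] with j hj
    change rescaledEnergy W (e j) (s (e j)) (v (e j)) ≤ _
    rw [rescaledEnergy_congr (hvae (e j))]
    exact hj

end

theorem mainTheorem1 (W : ℝ → ℝ) (hW : IsDoubleWell W) (s : ℝ → ℝ)
    (hs : ∀ ε : ℝ, 0 < ε → s ε ∈ Ioo (0 : ℝ) 1)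
    (hlim : Tendsto s (𝓝[>] 0) (𝓝 (1 / 2))) :
    -- Gamma-convergence in measure: lower bound and recovery sequences
    GammaConverges (fun ε u => rescaledEnergy W ε (s ε) u) (fun u => limitEnergy u) ∧
    -- compactness in measure of sequences with bounded energy
    (∀ (ε : ℕ → ℝ) (v : ℕ → MeasFun), Tendsto ε atTop (𝓝[>] 0) →
      limsup (fun j => rescaledEnergy W (ε j) (s (ε j)) (v j)) atTop < ∞ →
      ∃ (u : MeasFun) (φ : ℕ → ℕ), MemBVpm u ∧ StrictMono φ ∧
        ConvInMeasure (fun j => v (φ j)) u) ∧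
    -- the recovery functions can be taken in the fractional Sobolev space, converging in L^2
    (∀ u : MeasFun, MemBVpm u → ∃ v : ℝ → MeasFun,
      (∀ ε : ℝ, 0 < ε → MemHs (s ε) (v ε)) ∧
      Tendsto (fun ε => eLpNorm (fun x => v ε x - u x) 2 unitVol) (𝓝[>] 0) (𝓝 0) ∧
      Tendsto (fun ε => rescaledEnergy W ε (s ε) (v ε)) (𝓝[>] 0)
        (𝓝 (8 * ((jumpSet u).encard : ℝ≥0∞)))) := by
  refine ⟨fun ε hε => ⟨fun u v hconv => ?_, fun u => ?_⟩, fun ε v hε hbd => ?_,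
    fun u hu => exists_recovery hW hs hlim u hu⟩
  · exact limitEnergy_le_liminf hW hs hlim hε (fun j => (v j).measurable) u.measurable hconv
  · by_cases hu : MemBVpm u
    · obtain ⟨v, -, hL2, hE⟩ := exists_recovery hW hs hlim u hu
      refine ⟨fun j => v (ε j), ?_, ?_⟩
      · exact tendstoInMeasure_of_tendsto_eLpNorm two_ne_zero
          (fun j => (v (ε j)).aestronglyMeasurable) u.aestronglyMeasurable (hL2.comp hε)
      · change limsup (fun j => rescaledEnergy W (ε j) (s (ε j)) (v (ε j))) atTop ≤ limitEnergy u
        rw [limitEnergy_of_memBVpm hu]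
        exact (hE.comp hε).limsup_eq.le
    · refine ⟨fun _ => u, fun η hη => ?_, ?_⟩
      · simp [hη.ne']
      · change _ ≤ limitEnergy (u : ℝ → ℝ)
        rw [limitEnergy, if_neg hu]
        exact le_top
  · obtain ⟨C, hC1, hC2⟩ := exists_between hbd
    obtain ⟨N, hN⟩ := eventually_atTop.1 (eventually_lt_of_limsup_lt hC1)
    -- The energy bound holds only for large indices; dropping the first $N$ terms makes it uniform.
    have hshift : StrictMono fun j : ℕ => j + N := fun a b h => Nat.add_lt_add_right h N
    have hF : ∀ j, rescaledEnergy W (ε (j + N)) (s (ε (j + N))) (v (j + N)) ≤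
        ENNReal.ofReal C.toReal := fun j => by
      rw [ENNReal.ofReal_toReal hC2.ne]
      exact (hN (j + N) (Nat.le_add_left N j)).le
    obtain ⟨u, φ, hφ, hconv⟩ := exists_subseq_tendstoInMeasure hW hs hlim
      (hε.comp hshift.tendsto_atTop) (v := fun j => v (j + N)) (fun j => (v (j + N)).measurable)
      ENNReal.toReal_nonneg hF
    refine ⟨u, fun j => φ j + N, ?_, hshift.comp hφ, hconv⟩
    have hle := limitEnergy_le_of_bounded_energy hW hs hlim
      ((hε.comp hshift.tendsto_atTop).comp hφ.tendsto_atTop)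
      (v := fun j => v (φ j + N)) (fun j => (v (φ j + N)).measurable) u.measurable hconv
      fun j => hF (φ j)
    by_contra hu
    rw [limitEnergy, if_neg hu] at hle
    exact absurd hle (not_le.2 ENNReal.ofReal_lt_top)
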